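/- Consider real $n_1\times n_2$ matrices with the Frobenius norm. For $r\ge 1$ let $\mathcal X_r$ be the set of $n_1\times n_2$ matrices of rank at most $r$, and call a linear subspace $\mathcal U\subseteq\mathbb R^{n_1\times n_2}$ $\varepsilon$-robustly $r$-entangled if $\|v-u\|\ge\varepsilon$ for every $v\in\mathcal X_r$ with $\|v\|=1$ and every $u\in\mathcal U$ (for $r=1$: $\varepsilon$-robustly entangled). Given matrices $u_1,\dots,u_m$ with $\|u_i\|\le 1$ and $\rho>0$, the $\rho$-perturbed subspace is $\widetilde{\mathcal U}=\mathrm{span}(u_1+z_1,\dots,u_m+z_m)$, where the $z_i$ are independent and have i.i.d. $N(0,\rho^2)$ entries. Write $\bar\rho=\min(\rho,1)$. There are an algorithm (a single program of a real RAM, i.e. a random-access machine with exact real arithmetic $+,-,\times,/,\sqrt{\cdot}$ and comparisons at unit cost, whose input consists of $n_1,n_2,r,m$ and an orthonormal basis of an $m$-dimensional subspace of $\mathbb R^{n_1\times n_2}$, and whose output is either "don't know" or a real number $\eta$) and absolute constants $c,C>0$, and for every positive integer $r$ there are constants $c_r,c'_r,\kappa_r>0$ depending only on $r$, such that the following holds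 for all positive integers $n_1,n_2$ with $r<\min\{n_1,n_2\}$ and all $\rho>0$. 1. On every orthonormal input the algorithm halts within $(n_1n_2/\bar\rho)^{Cr}$ steps, and whenever it outputs a number $\eta$, then $\eta>0$ and the input subspace is $\eta$-robustly $r$-entangled. 2. If $m\le c_r\,n_1n_2$ and $u_1,\dots,u_m$ are arbitrary matrices of norm at most $1$, then with probability at least $1-\exp(-\kappa_r n_1n_2)$ the $\rho$-perturbed subspace $\widetilde{\mathcal U}$ has dimension $m$, it is $\eta_0$-robustly $r$-entangled for $$\eta_0=\frac{c'_r\,\bar\rho^{\,r+1}}{(n_1n_2)^{cr}},$$ and the algorithm, given any orthonormal basis of $\widetilde{\mathcal U}$, outputs some $\eta\ge\eta_0$, and so certifies this. In particular, for $r=1$ this is robust certification of entanglement of smoothed subspaces. -/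

import Mathlib

open MeasureTheory ProbabilityTheory

/-! ### Real random-access machines

Programs of a uniform real RAM.  The machine has an integer memory (used for counters, sizes and
addresses) and a real memory.  Real cells are always addressed through integer cells.  One step
is charged for every instruction and for every evaluation of a test.  The integer memory only has
addition and truncated subtraction, and there is no conversion from reals to integers, so
unit cost is a reasonable measure of time. -/

namespace RealRAM

/-- A memory configuration: the integer memory and the real memory. -/
structure State where
  nat : ℕ → ℕ
  real : ℕ → ℝ

/-- Elementary instructions. Write `M` for the integer memory and `R` for the real memory. -/
inductive Instr where
  /-- `M[a] := k` -/
  | natConst (a k : ℕ)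
  /-- `M[a] := M[b] + M[c]` -/
  | natAdd (a b c : ℕ)
  /-- `M[a] := M[b] - M[c]` (truncated at `0`) -/
  | natSub (a b c : ℕ)
  /-- `M[a] := M[M[b]]` -/
  | natLoad (a b : ℕ)
  /-- `M[M[a]] := M[b]` -/
  | natStore (a b : ℕ)
  /-- `R[M[a]] := k` -/
  | realConst (a : ℕ) (k : ℤ)
  /-- `R[M[a]] := R[M[b]] + R[M[c]]` -/
  | realAdd (a b c : ℕ)
  /-- `R[M[a]] := R[M[b]] - R[M[c]]` -/
  | realSub (a b c : ℕ)
  /-- `R[M[a]] := R[M[b]] * R[M[c]]` -/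
  | realMul (a b c : ℕ)
  /-- `R[M[a]] := R[M[b]] / R[M[c]]` (with the value `0` for a zero denominator) -/
  | realDiv (a b c : ℕ)
  /-- `R[M[a]] := √R[M[b]]` (with the value `0` for a negative argument) -/
  | realSqrt (a b : ℕ)

namespace State

/-- Write `v` into the integer cell `a`. -/
def setNat (s : State) (a v : ℕ) : State := { s with nat := Function.update s.nat a v }

/-- Write `v` into the real cell whose address is stored in the integer cell `a`. -/
noncomputable def setReal (s : State) (a : ℕ) (v : ℝ) : State :=
  { s with real := Function.update s.real (s.nat a) v }

/-- The content of the real cell whose address is stored in the integer cell `a`. -/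
def getReal (s : State) (a : ℕ) : ℝ := s.real (s.nat a)

end State

/-- The effect of an instruction. -/
noncomputable def Instr.apply : Instr → State → State
  | .natConst a k, s => s.setNat a k
  | .natAdd a b c, s => s.setNat a (s.nat b + s.nat c)
  | .natSub a b c, s => s.setNat a (s.nat b - s.nat c)
  | .natLoad a b, s => s.setNat a (s.nat (s.nat b))
  | .natStore a b, s => s.setNat (s.nat a) (s.nat b)
  | .realConst a k, s => s.setReal a (k : ℝ)
  | .realAdd a b c, s => s.setReal a (s.getReal b + s.getReal c)
  | .realSub a b c, s => s.setReal a (s.getReal b - s.getReal c)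
  | .realMul a b c, s => s.setReal a (s.getReal b * s.getReal c)
  | .realDiv a b c, s => s.setReal a (s.getReal b / s.getReal c)
  | .realSqrt a b, s => s.setReal a (Real.sqrt (s.getReal b))

/-- Tests: strict comparison of two integer cells, or of two (indirectly addressed) real cells. -/
inductive Test where
  | natLt (a b : ℕ)
  | realLt (a b : ℕ)

/-- The truth of a test in a state. -/
def Test.Holds : Test → State → Prop
  | .natLt a b, s => s.nat a < s.nat b
  | .realLt a b, s => s.getReal a < s.getReal b

/-- Programs: finite texts built by sequencing, branching and loops. -/
inductive Program where
  | instr (i : Instr)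
  | seq (P Q : Program)
  | branch (T : Test) (P Q : Program)
  | loop (T : Test) (P : Program)

/-- `Exec P s s' t`: started in the state `s`, the program `P` halts in the state `s'` after
exactly `t` steps. -/
inductive Exec : Program → State → State → ℕ → Prop where
  | instr (i : Instr) (s : State) : Exec (.instr i) s (i.apply s) 1
  | seq {P Q : Program} {s₁ s₂ s₃ : State} {t₁ t₂ : ℕ}
      (h₁ : Exec P s₁ s₂ t₁) (h₂ : Exec Q s₂ s₃ t₂) : Exec (.seq P Q) s₁ s₃ (t₁ + t₂)
  | branch_true {T : Test} {P Q : Program} {s s' : State} {t : ℕ}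
      (hT : T.Holds s) (h : Exec P s s' t) : Exec (.branch T P Q) s s' (t + 1)
  | branch_false {T : Test} {P Q : Program} {s s' : State} {t : ℕ}
      (hT : ¬ T.Holds s) (h : Exec Q s s' t) : Exec (.branch T P Q) s s' (t + 1)
  | loop_stop {T : Test} {P : Program} {s : State}
      (hT : ¬ T.Holds s) : Exec (.loop T P) s s 1
  | loop_step {T : Test} {P : Program} {s₁ s₂ s₃ : State} {t₁ t₂ : ℕ}
      (hT : T.Holds s₁) (h₁ : Exec P s₁ s₂ t₁) (h₂ : Exec (.loop T P) s₂ s₃ t₂) :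
      Exec (.loop T P) s₁ s₃ (t₁ + t₂ + 1)

end RealRAM

/-! ### Matrices, rank and robust entanglement -/

/-- The space of real `n₁ × n₂` matrices with the Frobenius norm. -/
abbrev MatSpace (n₁ n₂ : ℕ) : Type := EuclideanSpace ℝ (Fin n₁ × Fin n₂)

/-- A vector of `MatSpace n₁ n₂` as a matrix. -/
def MatSpace.toMatrix {n₁ n₂ : ℕ} (v : MatSpace n₁ n₂) : Matrix (Fin n₁) (Fin n₂) ℝ :=
  Matrix.of fun i j => v (i, j)

/-- The determinantal variety of matrices of rank at most `r`. -/
def rankVariety (n₁ n₂ r : ℕ) : Set (MatSpace n₁ n₂) := {v | v.toMatrix.rank ≤ r}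

/-- `U` is `ε`-robustly `r`-entangled: every matrix of unit Frobenius norm and of rank at most `r`
has distance at least `ε` from every element of `U`. -/
def IsRobustlyEntangled {n₁ n₂ : ℕ} (r : ℕ) (ε : ℝ) (U : Submodule ℝ (MatSpace n₁ n₂)) : Prop :=
  ∀ v ∈ rankVariety n₁ n₂ r, ‖v‖ = 1 → ∀ u ∈ U, ε ≤ ‖v - u‖

/-! ### Input and output of a certification program -/

/-- The input: the sizes `n₁, n₂, r, m` are in the integer cells `0, 1, 2, 3`, and the coordinate
`(i, j)` of the vector `b k` is in the real cell `k * (n₁ * n₂) + i * n₂ + j`; all other cells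
are `0`. -/
noncomputable def inputState (n₁ n₂ r m : ℕ) (b : Fin m → MatSpace n₁ n₂) : RealRAM.State where
  nat a := if a = 0 then n₁ else if a = 1 then n₂ else if a = 2 then r else if a = 3 then m else 0
  real a :=
    if h : a < m * (n₁ * n₂) then
      b (finProdFinEquiv.symm ⟨a, h⟩).1 (finProdFinEquiv.symm (finProdFinEquiv.symm ⟨a, h⟩).2)
    else 0

/-- The output: `none` ("don't know") if the integer cell `0` contains `0`, and otherwise
`some η` ("the subspace is `η`-far from the variety"), where `η` is the content of the real
cell `0`. -/
noncomputable def outputOf (s : RealRAM.State) : Option ℝ :=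
  if s.nat 0 = 0 then none else some (s.real 0)

/-- On the input `b`, the program `P` halts after exactly `t` steps with the output `o`. -/
def Outputs (P : RealRAM.Program) {n₁ n₂ m : ℕ} (r : ℕ) (b : Fin m → MatSpace n₁ n₂)
    (o : Option ℝ) (t : ℕ) : Prop :=
  ∃ s, RealRAM.Exec P (inputState n₁ n₂ r m b) s t ∧ outputOf s = o

/-! ### Smoothed subspaces -/

/-- The law of `m` independent random `n₁ × n₂` matrices with i.i.d. `N(0, ρ²)` entries. -/
noncomputable def gaussianNoise (m n₁ n₂ : ℕ) (ρ : ℝ) :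
    Measure (Fin m × (Fin n₁ × Fin n₂) → ℝ) :=
  Measure.pi fun _ => gaussianReal 0 (ρ ^ 2).toNNReal

/-- The subspace spanned by the perturbed matrices `u i + z i`. -/
noncomputable def perturbedSpan {m n₁ n₂ : ℕ} (u : Fin m → MatSpace n₁ n₂)
    (z : Fin m × (Fin n₁ × Fin n₂) → ℝ) : Submodule ℝ (MatSpace n₁ n₂) :=
  Submodule.span ℝ (Set.range fun i => u i + WithLp.toLp 2 fun p => z (i, p))

/-! Put d = r + 1 and N = n₁n₂. All minors of order d vanish on matrices of rank at most r. Polarize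
them in their rows: `mixedMinor` takes its a-th row from the a-th of d matrices, so it is
multilinear in these matrices. Its values on all d-tuples of basis vectors of the subspace, at all
positions, form a matrix L with N^d rows and m^d columns (`minorMatrix`). Suppose ‖y‖² ≤ p‖Ly‖² for
all y. If u = Σ x_j b_j is close to a unit matrix v of rank at most r, then L sends the tensor power
of x, which has norm ‖u‖^d, to the minors of u; these are close to the vanishing minors of v. So u
cannot be too close (`isRobustlyEntangled_of_gram`). By Cauchy–Schwarz, p = tr (LᵀL)⁻¹ is admissible
(`Matrix.sum_sq_le_trace_mul`). The algorithm computes LᵀL, inverts it by principal pivot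
transforms, and answers 1/(√(1+p) N^{3d}) if the product of the pivots is positive. Such an answer
is always correct (`certifierOutput_sound`).

It remains to see that L is well conditioned for a smoothed subspace. It suffices that each column I
keeps a distance τ from the span of the other columns, already when restricted to minors whose a-th
row and column come from the a-th of d disjoint blocks. With n positions in each product of blocks,
the column I then contains the diagonal term ∏ w_{I a}(g_a), a pure tensor of d independent random
vectors. Fix all entries outside these d vectors. Every other term of any minor shares only a proper
subset of the d factors with the diagonal term. So the tensors that annihilate all other terms,
whatever the free entries are, form a space V cut out by at most d·d^d·m(n+m)^{d-1} linear
conditions (`finrank_annihilator`). For m a small multiple of n this leaves most of the dimension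
n^d. If column I is nearly dependent on the others, the contraction of the pure tensor with every
bounded v ∈ V is small.

That is improbable: a space of more than d·k·n^{d-1} dimensions contains an echelon tree of
branching number k (`exists_echelonTree`). Exposing the d random vectors one at a time, each inner
node of the tree gives k triangular affine forms, all of which are small with probability at most
ε^k (`measure_smallContraction_le`). With k proportional to n this beats the union bound over the
m^d columns. A crude Gaussian tail bound controls the change from the perturbed matrices to an
orthonormal basis (`minors_of_orthonormal`).

For the machine model, integer expressions, real expressions and statements are compiled to
programs, with correctness and a cost bound proved by structural induction. As the program is fixed,
its cost is a fixed polynomial in a bound B on the loop counts, and B = N^{3d} gives the running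
time. -/

namespace RealRAM

/-! ### Total correctness with time bounds -/

/-- Soundness concerns every possible run, while the construction exhibits one run. Determinism
identifies the two. -/
theorem Exec.det {P : Program} {s s₁ : State} {t₁ : ℕ} (h₁ : Exec P s s₁ t₁) :
    ∀ {s₂ : State} {t₂ : ℕ}, Exec P s s₂ t₂ → s₁ = s₂ ∧ t₁ = t₂ := by
  induction h₁ with
  | instr i s => intro s₂ t₂ h; cases h; exact ⟨rfl, rfl⟩
  | seq _ _ ih₁ ih₂ =>
    intro s₂ t₂ h
    cases h with
    | seq a b =>
      obtain ⟨rfl, rfl⟩ := ih₁ a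
      obtain ⟨rfl, rfl⟩ := ih₂ b
      exact ⟨rfl, rfl⟩
  | branch_true hT _ ih =>
    intro s₂ t₂ h
    cases h with
    | branch_true _ a => obtain ⟨rfl, rfl⟩ := ih a; exact ⟨rfl, rfl⟩
    | branch_false hF _ => exact absurd hT hF
  | branch_false hT _ ih =>
    intro s₂ t₂ h
    cases h with
    | branch_true hF _ => exact absurd hF hT
    | branch_false _ a => obtain ⟨rfl, rfl⟩ := ih a; exact ⟨rfl, rfl⟩
  | loop_stop hT =>
    intro s₂ t₂ h
    cases h with
    | loop_stop _ => exact ⟨rfl, rfl⟩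
    | loop_step hF _ _ => exact absurd hF hT
  | loop_step hT _ _ ih₁ ih₂ =>
    intro s₂ t₂ h
    cases h with
    | loop_stop hF => exact absurd hT hF
    | loop_step _ a b =>
      obtain ⟨rfl, rfl⟩ := ih₁ a
      obtain ⟨rfl, rfl⟩ := ih₂ b
      exact ⟨rfl, rfl⟩

/-- Started in `s`, the program `P` halts within `c` steps in a state satisfying `Q`. -/
def Runs (P : Program) (s : State) (c : ℕ) (Q : State → Prop) : Prop :=
  ∃ s' t, Exec P s s' t ∧ t ≤ c ∧ Q s'

theorem Runs.mono {P : Program} {s : State} {c c' : ℕ} {Q Q' : State → Prop}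
    (h : Runs P s c Q) (hc : c ≤ c') (hQ : ∀ s', Q s' → Q' s') : Runs P s c' Q' := by
  obtain ⟨s', t, h₁, h₂, h₃⟩ := h
  exact ⟨s', t, h₁, h₂.trans hc, hQ _ h₃⟩

theorem Runs.instr {i : Instr} {s : State} {c : ℕ} {Q : State → Prop} (hc : 1 ≤ c)
    (h : Q (i.apply s)) : Runs (.instr i) s c Q :=
  ⟨_, _, Exec.instr i s, hc, h⟩

theorem Runs.seq {P R : Program} {s : State} {c c₁ c₂ : ℕ} {Q : State → Prop}
    (h : Runs P s c₁ fun s' => Runs R s' c₂ Q) (hc : c₁ + c₂ ≤ c) : Runs (.seq P R) s c Q := by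
  obtain ⟨s₁, t₁, h₁, h₂, s₂, t₂, h₃, h₄, h₅⟩ := h
  exact ⟨s₂, _, .seq h₁ h₃, by omega, h₅⟩

theorem Runs.cons {i : Instr} {R : Program} {s : State} {c : ℕ} {Q : State → Prop} (hc : 1 ≤ c)
    (h : Runs R (i.apply s) (c - 1) Q) : Runs (.seq (.instr i) R) s c Q :=
  Runs.seq (c₁ := 1) (Runs.instr le_rfl h) (by omega)

theorem Runs.branch {T : Test} {P R : Program} {s : State} {c : ℕ} {Q : State → Prop}
    (h₁ : T.Holds s → Runs P s c Q) (h₂ : ¬ T.Holds s → Runs R s c Q) :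
    Runs (.branch T P R) s (c + 1) Q := by
  by_cases hT : T.Holds s
  · obtain ⟨s', t, a, b, e⟩ := h₁ hT
    exact ⟨s', _, .branch_true hT a, by omega, e⟩
  · obtain ⟨s', t, a, b, e⟩ := h₂ hT
    exact ⟨s', _, .branch_false hT a, by omega, e⟩

/-- The number n of iterations is known beforehand, so total correctness is an induction on the
number of iterations left. Each iteration pays one extra step for its test, and the final failing
test pays the last one. -/
theorem Runs.loop {T : Test} {P : Program} (Inv : ℕ → State → Prop) (n c : ℕ) {s : State}
    {Q : State → Prop}
    (hstep : ∀ i < n, ∀ s, Inv i s → T.Holds s ∧ Runs P s c (Inv (i + 1)))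
    (hexit : ∀ s, Inv n s → ¬ T.Holds s ∧ Q s) (h0 : Inv 0 s) :
    Runs (.loop T P) s (n * (c + 1) + 1) Q := by
  suffices H : ∀ k ≤ n, ∀ s, Inv (n - k) s → Runs (.loop T P) s (k * (c + 1) + 1) Q from
    H n le_rfl s (by simpa using h0)
  intro k
  induction k with
  | zero =>
    intro _ s hs
    obtain ⟨h₁, h₂⟩ := hexit s (by simpa using hs)
    exact ⟨s, 1, by constructor; exact h₁, by omega, h₂⟩
  | succ k ih =>
    intro hk s hs
    obtain ⟨hT, s₁, t₁, h₁, h₂, h₃⟩ := hstep (n - (k + 1)) (by omega) s hs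
    rw [show n - (k + 1) + 1 = n - k by omega] at h₃
    obtain ⟨s₂, t₂, h₄, h₅, h₆⟩ := ih (by omega) s₁ h₃
    refine ⟨s₂, _, .loop_step hT h₁ h₄, ?_, h₆⟩
    rw [add_mul]
    omega

@[simp] theorem State.setNat_nat (s : State) (a v : ℕ) :
    (s.setNat a v).nat = Function.update s.nat a v := rfl
@[simp] theorem State.setNat_real (s : State) (a v : ℕ) : (s.setNat a v).real = s.real := rfl
@[simp] theorem State.setReal_nat (s : State) (a : ℕ) (v : ℝ) : (s.setReal a v).nat = s.nat := rfl
@[simp] theorem State.setReal_real (s : State) (a : ℕ) (v : ℝ) :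
    (s.setReal a v).real = Function.update s.real (s.nat a) v := rfl

/-! ### Integer expressions -/

/-- Integer expressions over integer variables. -/
inductive NExpr where
  | var (x : ℕ)
  | const (k : ℕ)
  | add (a b : NExpr)
  | sub (a b : NExpr)
  | mul (a b : NExpr)
  | div (a b : NExpr)
  | pow (a b : NExpr)

namespace NExpr

/-- The value of an integer expression. -/
def eval (env : ℕ → ℕ) : NExpr → ℕ
  | var x => env x
  | const k => k
  | add a b => a.eval env + b.eval env
  | sub a b => a.eval env - b.eval env
  | mul a b => a.eval env * b.eval env
  | div a b => a.eval env / b.eval env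
  | pow a b => a.eval env ^ b.eval env

/-- The numbers of iterations needed for the evaluation are at most `B`. -/
def Bd (B : ℕ) (env : ℕ → ℕ) : NExpr → Prop
  | var _ => True
  | const _ => True
  | add a b => a.Bd B env ∧ b.Bd B env
  | sub a b => a.Bd B env ∧ b.Bd B env
  | mul a b => a.Bd B env ∧ b.Bd B env ∧ b.eval env ≤ B
  | div a b => a.Bd B env ∧ b.Bd B env ∧ a.eval env ≤ B
  | pow a b => a.Bd B env ∧ b.Bd B env ∧ a.eval env ≤ B ∧ b.eval env ≤ B

/-- All variables are in the list `A`. -/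
def WF (A : List ℕ) : NExpr → Prop
  | var x => x ∈ A
  | const _ => True
  | add a b | sub a b | mul a b | div a b | pow a b => a.WF A ∧ b.WF A

/-- A bound for the evaluation time. -/
def cost (B : ℕ) : NExpr → ℕ
  | var _ => 2
  | const _ => 1
  | add a b | sub a b => a.cost B + b.cost B + 1
  | mul a b => a.cost B + b.cost B + (3 * B + 10)
  | div a b => a.cost B + b.cost B + (3 * B + 10)
  | pow a b => a.cost B + b.cost B + (B * (3 * B + 20) + 10)

/-- `M[d] := M[d] * M[d + 1]` -/
def mulProg (d : ℕ) : Program :=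
  .seq (.instr (.natConst (d + 2) 0)) <| .seq (.instr (.natConst (d + 3) 0)) <|
  .seq (.instr (.natConst (d + 4) 1)) <|
  .seq (.loop (.natLt (d + 3) (d + 1))
    (.seq (.instr (.natAdd (d + 2) (d + 2) d)) (.instr (.natAdd (d + 3) (d + 3) (d + 4))))) <|
  .seq (.instr (.natConst (d + 3) 0)) (.instr (.natAdd d (d + 2) (d + 3)))

/-- `M[d] := M[d] / M[d + 1]` -/
def divProg (d : ℕ) : Program :=
  .seq (.instr (.natConst (d + 2) 0)) <| .seq (.instr (.natConst (d + 3) 0)) <|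
  .seq (.instr (.natConst (d + 4) 1)) <|
  .seq (.branch (.natLt (d + 3) (d + 1))
    -- Only strict tests exist, so the dividend is raised by one: "divisor < remainder + 1" then
    -- means that the divisor still fits. The enclosing branch excludes the divisor 0, for which the
    -- loop would not end and the quotient is 0.
    (.seq (.instr (.natAdd d d (d + 4)))
      (.loop (.natLt (d + 1) d)
        (.seq (.instr (.natSub d d (d + 1))) (.instr (.natAdd (d + 2) (d + 2) (d + 4))))))
    (.instr (.natConst (d + 2) 0))) <|
  .instr (.natAdd d (d + 2) (d + 3))

/-- `M[d] := M[d] ^ M[d + 1]` -/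
def powProg (d : ℕ) : Program :=
  .seq (.instr (.natConst (d + 2) 1)) <| .seq (.instr (.natConst (d + 3) 0)) <|
  .seq (.instr (.natConst (d + 4) 1)) <|
  .seq (.loop (.natLt (d + 3) (d + 1))
    (.seq (.instr (.natConst (d + 5) 0)) <| .seq (.instr (.natConst (d + 6) 0)) <|
     .seq (.instr (.natAdd (d + 5) (d + 2) (d + 5))) <|
     .seq (.instr (.natAdd (d + 6) d (d + 6))) <|
     .seq (mulProg (d + 5)) <|
     .seq (.instr (.natConst (d + 2) 0)) <|
     .seq (.instr (.natAdd (d + 2) (d + 5) (d + 2))) (.instr (.natAdd (d + 3) (d + 3) (d + 4))))) <|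
  .seq (.instr (.natConst (d + 3) 0)) (.instr (.natAdd d (d + 2) (d + 3)))

/-- A program that evaluates the expression into the integer cell `d`, and changes only integer
cells from `d` on. -/
def compile : NExpr → ℕ → Program
  | var x, d => .seq (.instr (.natConst d 0)) (.instr (.natAdd d x d))
  | const k, d => .instr (.natConst d k)
  | add a b, d => .seq (a.compile d) <| .seq (b.compile (d + 1)) <| .instr (.natAdd d d (d + 1))
  | sub a b, d => .seq (a.compile d) <| .seq (b.compile (d + 1)) <| .instr (.natSub d d (d + 1))
  | mul a b, d => .seq (a.compile d) <| .seq (b.compile (d + 1)) <| mulProg d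
  | div a b, d => .seq (a.compile d) <| .seq (b.compile (d + 1)) <| divProg d
  | pow a b, d => .seq (a.compile d) <| .seq (b.compile (d + 1)) <| powProg d

/-- The final state `s'` is `s` with the value `v` in the integer cell `d`, up to integer cells
after `d`. -/
def Post (d v : ℕ) (s s' : State) : Prop :=
  s'.nat d = v ∧ (∀ x < d, s'.nat x = s.nat x) ∧ s'.real = s.real

theorem runs_mulProg (d B : ℕ) (s : State) (hB : s.nat (d + 1) ≤ B) :
    Runs (mulProg d) s (3 * B + 9) (Post d (s.nat d * s.nat (d + 1)) s) := by
  unfold mulProg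
  refine .cons (by omega) (.cons (by omega) (.cons (by omega) ?_))
  refine Runs.seq (c₁ := s.nat (d + 1) * (2 + 1) + 1) (c₂ := 2)
    (Runs.loop (fun i s' => s'.nat (d + 2) = s.nat d * i ∧ s'.nat (d + 3) = i ∧ s'.nat (d + 4) = 1 ∧
      s'.nat (d + 1) = s.nat (d + 1) ∧ s'.nat d = s.nat d ∧ (∀ x < d, s'.nat x = s.nat x) ∧
      s'.real = s.real) (s.nat (d + 1)) 2 ?_ ?_ ?_) (by omega)
  · rintro i hi s' ⟨h₁, h₂, h₃, h₄, h₅, h₆, h₇⟩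
    refine ⟨by simpa [Test.Holds, h₂, h₄] using hi, ?_⟩
    refine .cons (by omega) (.instr (by omega) ?_)
    simp only [Instr.apply, State.setNat_nat, State.setNat_real, Function.update_apply]
    refine ⟨by simp [h₁, h₅, mul_add], by simp [h₂, h₃], by simp [h₃], by simp [h₄], by simp [h₅],
      fun x hx => ?_, h₇⟩
    simp [show x ≠ d + 3 by omega, show x ≠ d + 2 by omega, h₆ x hx]
  · rintro s' ⟨h₁, h₂, h₃, h₄, h₅, h₆, h₇⟩
    refine ⟨by simp [Test.Holds, h₂, h₄], ?_⟩
    refine .cons (by omega) (.instr (by omega) ?_)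
    simp only [Instr.apply, State.setNat_nat, State.setNat_real, Function.update_apply, Post]
    refine ⟨by simp [h₁], fun x hx => ?_, h₇⟩
    simp [show x ≠ d + 3 by omega, show x ≠ d by omega, h₆ x hx]
  · simp only [Instr.apply, State.setNat_nat, State.setNat_real, Function.update_apply]
    refine ⟨by simp, by simp, by simp, by simp, by simp, fun x hx => ?_, trivial⟩
    simp [show x ≠ d + 3 by omega, show x ≠ d + 2 by omega, show x ≠ d + 4 by omega]

theorem runs_divProg (d B : ℕ) (s : State) (hB : s.nat d ≤ B) :
    Runs (divProg d) s (3 * B + 9) (Post d (s.nat d / s.nat (d + 1)) s) := by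
  unfold divProg
  refine .cons (by omega) (.cons (by omega) (.cons (by omega) ?_))
  refine Runs.seq (c₁ := 3 * B + 2 + 1) (c₂ := 1) (Runs.branch ?_ ?_) (by omega)
  · intro hT
    have hb : 0 < s.nat (d + 1) := by
      simpa [Test.Holds, Instr.apply, Function.update_apply] using hT
    have hq : s.nat d / s.nat (d + 1) ≤ B := (Nat.div_le_self _ _).trans hB
    refine .cons (by omega) ?_
    refine Runs.mono (c := s.nat d / s.nat (d + 1) * (2 + 1) + 1) (Runs.loop
      (fun i s' => s'.nat d = s.nat d + 1 - i * s.nat (d + 1) ∧ s'.nat (d + 2) = i ∧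
        s'.nat (d + 3) = 0 ∧ s'.nat (d + 4) = 1 ∧
      s'.nat (d + 1) = s.nat (d + 1) ∧ (∀ x < d, s'.nat x = s.nat x) ∧
      s'.real = s.real) (s.nat d / s.nat (d + 1)) 2 ?_ ?_ ?_) (by omega) fun _ h => h
    · rintro i hi s' ⟨h₁, h₂, h₃, h₄, h₅, h₆, h₇⟩
      have h8 : (i + 1) * s.nat (d + 1) ≤ s.nat d := (Nat.le_div_iff_mul_le hb).1 hi
      rw [add_mul] at h8
      refine ⟨by simp [Test.Holds, h₁, h₅]; omega, ?_⟩
      refine .cons (by omega) (.instr (by omega) ?_)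
      simp only [Instr.apply, State.setNat_nat, State.setNat_real, Function.update_apply]
      refine ⟨?_, by simp [h₂, h₄], by simp [h₃], by simp [h₄], by simp [h₅],
        fun x hx => ?_, h₇⟩
      · simp [h₁, h₅, add_mul]; omega
      · simp [show x ≠ d + 2 by omega, show x ≠ d by omega, h₆ x hx]
    · rintro s' ⟨h₁, h₂, h₃, h₄, h₅, h₆, h₇⟩
      have h8 := Nat.lt_div_mul_add (a := s.nat d) hb
      refine ⟨by simp [Test.Holds, h₁, h₅]; omega, ?_⟩
      refine .instr (by omega) ?_
      simp only [Instr.apply, State.setNat_nat, State.setNat_real, Function.update_apply, Post]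
      refine ⟨by simp [h₂, h₃], fun x hx => ?_, h₇⟩
      simp [show x ≠ d by omega, h₆ x hx]
    · simp only [Instr.apply, State.setNat_nat, State.setNat_real, Function.update_apply]
      refine ⟨by simp, by simp, by simp, by simp, by simp, fun x hx => ?_, trivial⟩
      simp [show x ≠ d + 3 by omega, show x ≠ d + 2 by omega, show x ≠ d + 4 by omega,
        show x ≠ d by omega]
  · intro hT
    have hb : s.nat (d + 1) = 0 := by
      simpa [Test.Holds, Instr.apply, Function.update_apply] using hT
    refine .instr (by omega) (.instr (by omega) ?_)
    simp only [Instr.apply, State.setNat_nat, State.setNat_real, Function.update_apply, Post]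
    refine ⟨by simp [hb], fun x hx => ?_, trivial⟩
    simp [show x ≠ d + 3 by omega, show x ≠ d + 2 by omega, show x ≠ d + 4 by omega,
        show x ≠ d by omega]

theorem runs_powProg (d B : ℕ) (s : State) (hB : s.nat d ≤ B) (hB' : s.nat (d + 1) ≤ B) :
    Runs (powProg d) s (B * (3 * B + 17) + 8) (Post d (s.nat d ^ s.nat (d + 1)) s) := by
  unfold powProg
  have hmul : s.nat (d + 1) * (3 * B + 16 + 1) ≤ B * (3 * B + 17) := Nat.mul_le_mul_right _ hB'
  refine .cons (by omega) (.cons (by omega) (.cons (by omega) ?_))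
  refine Runs.seq (c₁ := s.nat (d + 1) * (3 * B + 16 + 1) + 1) (c₂ := 2)
    (Runs.loop (fun i s' => s'.nat (d + 2) = s.nat d ^ i ∧ s'.nat (d + 3) = i ∧ s'.nat (d + 4) = 1 ∧
      s'.nat (d + 1) = s.nat (d + 1) ∧ s'.nat d = s.nat d ∧ (∀ x < d, s'.nat x = s.nat x) ∧
      s'.real = s.real) (s.nat (d + 1)) (3 * B + 16) ?_ ?_ ?_) (by omega)
  · rintro i hi s' ⟨h₁, h₂, h₃, h₄, h₅, h₆, h₇⟩
    refine ⟨by simpa [Test.Holds, h₂, h₄] using hi, ?_⟩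
    refine .cons (by omega) (.cons (by omega) (.cons (by omega) (.cons (by omega) ?_)))
    refine Runs.seq (c₂ := 3) ((runs_mulProg (d + 5) B _ ?_).mono le_rfl ?_) (by omega)
    · simp [Instr.apply, h₅, hB]
    rintro s'' ⟨g₁, g₂, g₃⟩
    simp only [Instr.apply, State.setNat_nat, State.setNat_real, Function.update_apply] at g₁ g₂ g₃
    have k2 := g₂ (d + 2) (by omega)
    have k3 := g₂ (d + 3) (by omega)
    have k4 := g₂ (d + 4) (by omega)
    have k1 := g₂ (d + 1) (by omega)
    have k0 := g₂ d (by omega)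
    simp at g₁ k0 k1 k2 k3 k4
    refine .cons (by omega) (.cons (by omega) (.instr (by omega) ?_))
    simp only [Instr.apply, State.setNat_nat, State.setNat_real, Function.update_apply]
    refine ⟨by simp [g₁, h₁, h₅, pow_succ], by simp [k3, k4, h₂, h₃], by simp [k4, h₃],
      by simp [k1, h₄], by simp [k0, h₅], fun x hx => ?_, g₃.trans h₇⟩
    have kx := g₂ x (by omega)
    simp [show x ≠ d + 5 by omega, show x ≠ d + 6 by omega] at kx
    simp [show x ≠ d + 3 by omega, show x ≠ d + 2 by omega, kx, h₆ x hx]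
  · rintro s' ⟨h₁, h₂, h₃, h₄, h₅, h₆, h₇⟩
    refine ⟨by simp [Test.Holds, h₂, h₄], ?_⟩
    refine .cons (by omega) (.instr (by omega) ?_)
    simp only [Instr.apply, State.setNat_nat, State.setNat_real, Function.update_apply, Post]
    refine ⟨by simp [h₁], fun x hx => ?_, h₇⟩
    simp [show x ≠ d + 3 by omega, show x ≠ d by omega, h₆ x hx]
  · simp only [Instr.apply, State.setNat_nat, State.setNat_real, Function.update_apply]
    refine ⟨by simp, by simp, by simp, by simp, by simp, fun x hx => ?_, trivial⟩
    simp [show x ≠ d + 3 by omega, show x ≠ d + 2 by omega, show x ≠ d + 4 by omega]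

/-- The second operand is compiled at `d + 1`, so its temporaries leave the value of the first in
cell `d` intact. -/
theorem runs_binary {a b : NExpr} {d va vb v ca cb cR c : ℕ} {s : State} {R : Program}
    (ha : Runs (a.compile d) s ca (Post d va s))
    (hb : ∀ s', Post d va s s' → Runs (b.compile (d + 1)) s' cb (Post (d + 1) vb s'))
    (hR : ∀ s', s'.nat d = va → s'.nat (d + 1) = vb → Runs R s' cR (Post d v s'))
    (hc : ca + cb + cR ≤ c) :
    Runs (.seq (a.compile d) <| .seq (b.compile (d + 1)) R) s c (Post d v s) := by
  refine Runs.seq (c₂ := cb + cR) (ha.mono le_rfl fun s₁ h₁ => ?_) (by omega)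
  refine Runs.seq (c₂ := cR) ((hb s₁ h₁).mono le_rfl fun s₂ h₂ => ?_) le_rfl
  refine (hR s₂ ((h₂.2.1 d (by omega)).trans h₁.1) h₂.1).mono le_rfl fun s₃ h₃ => ?_
  exact ⟨h₃.1, fun x hx => (h₃.2.1 x hx).trans ((h₂.2.1 x (by omega)).trans (h₁.2.1 x hx)),
    h₃.2.2.trans (h₂.2.2.trans h₁.2.2)⟩

/-- All variables lie below `d` and all temporaries from `d` on, so the environment survives every
subevaluation. This is the whole content of the register discipline. -/
theorem runs_compile {B : ℕ} {env : ℕ → ℕ} {A : List ℕ} (e : NExpr) (hWF : e.WF A)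
    (hBd : e.Bd B env) : ∀ {d : ℕ} {s : State}, (∀ x ∈ A, x < d) → (∀ x ∈ A, s.nat x = env x) →
    Runs (e.compile d) s (e.cost B) (Post d (e.eval env) s) := by
  induction e with
  | var x =>
    intro d s hd hs
    refine .cons (by simp [cost]) (.instr (by simp [cost]) ?_)
    have := hd x hWF
    simp only [Instr.apply, State.setNat_nat, State.setNat_real, Function.update_apply, Post, eval]
    refine ⟨by simp [this.ne, hs x hWF], fun y hy => by simp [hy.ne], trivial⟩
  | const k =>
    intro d s hd hs
    refine .instr (by simp [cost]) ?_
    simp only [Instr.apply, State.setNat_nat, State.setNat_real, Function.update_apply, Post, eval]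
    exact ⟨by simp, fun y hy => by simp [hy.ne], trivial⟩
  | add a b iha ihb =>
    intro d s hd hs
    refine runs_binary (cR := 1) (iha hWF.1 hBd.1 hd hs) (fun s' h' => ihb hWF.2 hBd.2
      (fun x hx => (hd x hx).trans (by omega)) (fun x hx => (h'.2.1 x (hd x hx)).trans (hs x hx)))
      (fun s' h₁ h₂ => .instr le_rfl ?_) (by simp [cost])
    simp only [Instr.apply, State.setNat_nat, State.setNat_real, Function.update_apply, Post, eval]
    exact ⟨by simp [h₁, h₂], fun y hy => by simp [hy.ne], trivial⟩
  | sub a b iha ihb =>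
    intro d s hd hs
    refine runs_binary (cR := 1) (iha hWF.1 hBd.1 hd hs) (fun s' h' => ihb hWF.2 hBd.2
      (fun x hx => (hd x hx).trans (by omega)) (fun x hx => (h'.2.1 x (hd x hx)).trans (hs x hx)))
      (fun s' h₁ h₂ => .instr le_rfl ?_) (by simp [cost])
    simp only [Instr.apply, State.setNat_nat, State.setNat_real, Function.update_apply, Post, eval]
    exact ⟨by simp [h₁, h₂], fun y hy => by simp [hy.ne], trivial⟩
  | mul a b iha ihb =>
    intro d s hd hs
    refine runs_binary (iha hWF.1 hBd.1 hd hs) (fun s' h' => ihb hWF.2 hBd.2.1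
      (fun x hx => (hd x hx).trans (by omega)) (fun x hx => (h'.2.1 x (hd x hx)).trans (hs x hx)))
      (fun s' h₁ h₂ => ?_) (c := cost B (mul a b)) (cR := 3 * B + 9) (by simp [cost])
    have := runs_mulProg d B s' (h₂.trans_le hBd.2.2)
    rwa [h₁, h₂] at this
  | div a b iha ihb =>
    intro d s hd hs
    refine runs_binary (iha hWF.1 hBd.1 hd hs) (fun s' h' => ihb hWF.2 hBd.2.1
      (fun x hx => (hd x hx).trans (by omega)) (fun x hx => (h'.2.1 x (hd x hx)).trans (hs x hx)))
      (fun s' h₁ h₂ => ?_) (c := cost B (div a b)) (cR := 3 * B + 9) (by simp [cost])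
    have := runs_divProg d B s' (h₁.trans_le hBd.2.2)
    rwa [h₁, h₂] at this
  | pow a b iha ihb =>
    intro d s hd hs
    refine runs_binary (iha hWF.1 hBd.1 hd hs) (fun s' h' => ihb hWF.2 hBd.2.1
      (fun x hx => (hd x hx).trans (by omega)) (fun x hx => (h'.2.1 x (hd x hx)).trans (hs x hx)))
      (fun s' h₁ h₂ => ?_) (c := cost B (pow a b)) (cR := B * (3 * B + 17) + 8)
      (by simp only [cost, mul_add]; omega)
    have := runs_powProg d B s' (h₁.trans_le hBd.2.2.1) (h₂.trans_le hBd.2.2.2)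
    rwa [h₁, h₂] at this

end NExpr

end RealRAM


namespace RealRAM

/-! ### Real expressions -/

/-- Real expressions over integer variables and the real memory. -/
inductive RExpr where
  | cell (e : NExpr)
  | const (k : ℤ)
  | add (a b : RExpr)
  | sub (a b : RExpr)
  | mul (a b : RExpr)
  | div (a b : RExpr)
  | sqrt (a : RExpr)
  /-- `a` if `e < f`, and `b` otherwise -/
  | ite (e f : NExpr) (a b : RExpr)
  /-- the sum of the values of `a` for `x < e` -/
  | sum (x : ℕ) (e : NExpr) (a : RExpr)
  /-- the product of the values of `a` for `x < e` -/
  | prod (x : ℕ) (e : NExpr) (a : RExpr)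

namespace RExpr

open Function (update)

/-- The value of a real expression. -/
noncomputable def eval (mem : ℕ → ℝ) : RExpr → (ℕ → ℕ) → ℝ
  | cell e, env => mem (e.eval env)
  | const k, _ => k
  | add a b, env => a.eval mem env + b.eval mem env
  | sub a b, env => a.eval mem env - b.eval mem env
  | mul a b, env => a.eval mem env * b.eval mem env
  | div a b, env => a.eval mem env / b.eval mem env
  | sqrt a, env => Real.sqrt (a.eval mem env)
  | ite e f a b, env => if e.eval env < f.eval env then a.eval mem env else b.eval mem env
  | sum x e a, env => ∑ k ∈ Finset.range (e.eval env), a.eval mem (update env x k)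
  | prod x e a, env => ∏ k ∈ Finset.range (e.eval env), a.eval mem (update env x k)

/-- The numbers of iterations are at most `B`, and all addresses are less than the value of the
variable `4`, where the scratch space begins. -/
def Bd (B : ℕ) : RExpr → (ℕ → ℕ) → Prop
  | cell e, env => e.Bd B env ∧ e.eval env < env 4
  | const _, _ => True
  | add a b, env | sub a b, env | mul a b, env | div a b, env => a.Bd B env ∧ b.Bd B env
  | sqrt a, env => a.Bd B env
  | ite e f a b, env => e.Bd B env ∧ f.Bd B env ∧ a.Bd B env ∧ b.Bd B env
  | sum x e a, env | prod x e a, env =>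
    e.Bd B env ∧ e.eval env ≤ B ∧ ∀ k < e.eval env, a.Bd B (update env x k)

/-- The free variables are in `A`, and all bound variables are at least `d` and increasing. -/
def WF : RExpr → List ℕ → ℕ → Prop
  | cell e, A, _ => e.WF A
  | const _, _, _ => True
  | add a b, A, d | sub a b, A, d | mul a b, A, d | div a b, A, d => a.WF A d ∧ b.WF A d
  | sqrt a, A, d => a.WF A d
  | ite e f a b, A, d => e.WF A ∧ f.WF A ∧ a.WF A d ∧ b.WF A d
  | sum x e a, A, d | prod x e a, A, d => d ≤ x ∧ e.WF A ∧ a.WF (x :: A) (x + 2)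

/-- A bound for the evaluation time. -/
def cost (B : ℕ) : RExpr → ℕ
  | cell e => e.cost B + 5
  | const _ => 5
  | add a b | sub a b | mul a b | div a b => a.cost B + b.cost B + 5
  | sqrt a => a.cost B + 5
  | ite e f a b => e.cost B + f.cost B + (a.cost B + b.cost B) + 5
  | sum _ e a | prod _ e a => e.cost B + (B * (a.cost B + 10) + 5)

/-- `M[d] := M[4] + k` -/
def setAddr (d k : ℕ) (P : Program) : Program :=
  .seq (.instr (.natConst d k)) <| .seq (.instr (.natAdd d 4 d)) P

/-- A program that applies the instruction `I` to the scratch cells `h` and `h + 1`. -/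
def opProg (I : ℕ → ℕ → ℕ → Instr) (d h : ℕ) : Program :=
  setAddr d h <| setAddr (d + 1) (h + 1) <| .instr (I d d (d + 1))

/-- Evaluate the accumulated operation `I` of the values of a program `P` for `x < M[x + 1]`, with
the initial value `k`. -/
def foldProg (I : ℕ → ℕ → ℕ → Instr) (k : ℤ) (x h : ℕ) (P : Program) : Program :=
  .seq (.instr (.natConst x 0)) <|
  setAddr (x + 2) h <| .seq (.instr (.realConst (x + 2) k)) <|
  .loop (.natLt x (x + 1)) <| .seq P <| .seq (opProg I (x + 2) h) <|
  .seq (.instr (.natConst (x + 2) 1)) (.instr (.natAdd x x (x + 2)))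

/-- A program that evaluates the expression into the scratch cell `h`, and changes only integer
cells from `d` on and scratch cells from `h` on. -/
def compile : RExpr → ℕ → ℕ → Program
  | cell e, d, h => .seq (e.compile d) <| setAddr (d + 1) h <|
      .seq (.instr (.realConst (d + 1) 0)) (.instr (.realAdd (d + 1) d (d + 1)))
  | const k, d, h => setAddr d h <| .instr (.realConst d k)
  | add a b, d, h => .seq (a.compile d h) <| .seq (b.compile d (h + 1)) <| opProg .realAdd d h
  | sub a b, d, h => .seq (a.compile d h) <| .seq (b.compile d (h + 1)) <| opProg .realSub d h
  | mul a b, d, h => .seq (a.compile d h) <| .seq (b.compile d (h + 1)) <| opProg .realMul d h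
  | div a b, d, h => .seq (a.compile d h) <| .seq (b.compile d (h + 1)) <| opProg .realDiv d h
  | sqrt a, d, h => .seq (a.compile d h) <| setAddr d h <| .instr (.realSqrt d d)
  | ite e f a b, d, h => .seq (e.compile d) <| .seq (f.compile (d + 1)) <|
      .branch (.natLt d (d + 1)) (a.compile d h) (b.compile d h)
  | sum x e a, _, h => .seq (e.compile (x + 1)) <|
      foldProg .realAdd 0 x h (a.compile (x + 2) (h + 1))
  | prod x e a, _, h => .seq (e.compile (x + 1)) <|
      foldProg .realMul 1 x h (a.compile (x + 2) (h + 1))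

/-- The final state `s'` is `s` with the value `v` in the scratch cell `h`, up to integer cells
from `d` on and later scratch cells. -/
def Post (d h : ℕ) (v : ℝ) (s s' : State) : Prop :=
  s'.real (s.nat 4 + h) = v ∧ (∀ x < d, s'.nat x = s.nat x) ∧
    ∀ a < s.nat 4 + h, s'.real a = s.real a

/-- The state agrees with the environment on the variables in `A`, and with the memory. -/
def Rel (A : List ℕ) (env : ℕ → ℕ) (mem : ℕ → ℝ) (s : State) : Prop :=
  (∀ x ∈ A, s.nat x = env x) ∧ ∀ a < env 4, s.real a = mem a

theorem Rel.of_post {A : List ℕ} {env : ℕ → ℕ} {mem : ℕ → ℝ} {s s' : State} {d h : ℕ} {v : ℝ}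
    (hr : Rel A env mem s) (h4 : 4 ∈ A) (hA : ∀ x ∈ A, x < d) (hp : Post d h v s s') :
    Rel A env mem s' := by
  have := hr.1 4 h4
  exact ⟨fun x hx => (hp.2.1 x (hA x hx)).trans (hr.1 x hx),
    fun a ha => (hp.2.2 a (by omega)).trans (hr.2 a ha)⟩

theorem runs_setAddr {d k c : ℕ} {P : Program} {s : State} {Q : State → Prop} (hd : 4 < d)
    (hc : 2 ≤ c) (h : Runs P (s.setNat d (s.nat 4 + k)) (c - 2) Q) :
    Runs (setAddr d k P) s c Q := by
  refine .cons (by omega) (.cons (by omega) ?_)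
  have e : (Instr.natAdd d 4 d).apply ((Instr.natConst d k).apply s)
      = s.setNat d (s.nat 4 + k) := by
    simp [Instr.apply, State.setNat, hd.ne]
  rwa [e]

/-- The instruction `I` computes the operation `op`. -/
def IsOp (I : ℕ → ℕ → ℕ → Instr) (op : ℝ → ℝ → ℝ) : Prop :=
  ∀ a b c s, (I a b c).apply s = s.setReal a (op (s.getReal b) (s.getReal c))

theorem runs_opProg {I : ℕ → ℕ → ℕ → Instr} {op : ℝ → ℝ → ℝ} (hI : IsOp I op) {d : ℕ} (h : ℕ)
    (hd : 4 < d) (s : State) : Runs (opProg I d h) s 5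
      (Post d h (op (s.real (s.nat 4 + h)) (s.real (s.nat 4 + (h + 1)))) s) := by
  refine runs_setAddr hd (by omega) (runs_setAddr (by omega) (by omega) (.instr (by omega) ?_))
  rw [hI]
  have h4 : (4 : ℕ) ≠ d := by omega
  simp only [Post, State.setReal_real, State.setReal_nat, State.setNat_nat, State.getReal,
    State.setNat_real]
  refine ⟨by simp [h4], fun x hx => ?_, fun a ha => ?_⟩
  · simp [hx.ne, show x ≠ d + 1 by omega]
  · simp [show a ≠ s.nat 4 + h by omega]

theorem runs_binary {I : ℕ → ℕ → ℕ → Instr} {op : ℝ → ℝ → ℝ} (hI : IsOp I op) {a b : RExpr}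
    {va vb : ℝ} {d h ca cb : ℕ} {s : State} (hd : 4 < d)
    (ha : Runs (a.compile d h) s ca (Post d h va s))
    (hb : ∀ s', Post d h va s s' →
      Runs (b.compile d (h + 1)) s' cb (Post d (h + 1) vb s')) :
    Runs (.seq (a.compile d h) <| .seq (b.compile d (h + 1)) <| opProg I d h) s (ca + cb + 5)
      (Post d h (op va vb) s) := by
  refine Runs.seq (c₂ := cb + 5) (ha.mono le_rfl fun s₁ h₁ => ?_) (by omega)
  refine Runs.seq (c₂ := 5) ((hb s₁ h₁).mono le_rfl fun s₂ h₂ => ?_) le_rfl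
  refine (runs_opProg hI h hd s₂).mono le_rfl fun s₃ h₃ => ?_
  obtain ⟨p1, p2, p3⟩ := h₁
  obtain ⟨q1, q2, q3⟩ := h₂
  obtain ⟨r1, r2, r3⟩ := h₃
  have e4 := p2 4 hd
  have f4 := q2 4 hd
  rw [e4] at q1 q3 f4
  rw [f4] at r1 r3
  refine ⟨?_, fun x hx => (r2 x hx).trans ((q2 x hx).trans (p2 x hx)), fun i hi => ?_⟩
  · rw [r1, q1, q3 _ (by omega), p1]
  · rw [r3 i hi, q3 i (by omega), p3 i hi]

/-- The accumulator sits in scratch cell `h` while the body works from `h + 1` on, and the loop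
variable, its bound and the temporaries occupy `x`, `x + 1` and `x + 2` onwards. The value is a
recursion over an arbitrary `op`, so that sums and products share one proof. -/
theorem runs_fold {I : ℕ → ℕ → ℕ → Instr} {op : ℝ → ℝ → ℝ} (hI : IsOp I op) (k : ℤ)
    {a : RExpr} {A : List ℕ} {env : ℕ → ℕ} {mem : ℕ → ℝ} {x h c n B : ℕ} (hx : 4 < x) (h4 : 4 ∈ A)
    (hA : ∀ y ∈ A, y < x) (f : ℕ → ℝ) (hn : n ≤ B)
    (ha : ∀ i < n, ∀ s, Rel (x :: A) (update env x i) mem s →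
      Runs (a.compile (x + 2) (h + 1)) s c (Post (x + 2) (h + 1) (f i) s))
    {s : State} (hs : Rel A env mem s) (hsn : s.nat (x + 1) = n) :
    Runs (foldProg I k x h (a.compile (x + 2) (h + 1))) s (B * (c + 10) + 5)
      (Post x h (Nat.rec (k : ℝ) (fun i v => op v (f i)) n) s) := by
  have hBn : n * (c + 7 + 1) ≤ B * (c + 10) := Nat.mul_le_mul hn (by omega)
  have h4x : (4 : ℕ) ≠ x := by omega
  refine .cons (by omega) (runs_setAddr (by omega) (by omega) (.cons (by omega) ?_))
  have hs4 := hs.1 4 h4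
  refine Runs.mono (Runs.loop (fun i s' => s'.nat x = i ∧ s'.nat (x + 1) = n ∧
    Post x h (Nat.rec (k : ℝ) (fun i v => op v (f i)) i) s s') n (c + 7) ?_ ?_ ?_)
    (by omega) fun _ h => h
  · rintro i hi s₁ ⟨g1, g2, g3⟩
    refine ⟨by simpa [Test.Holds, g1, g2] using hi, ?_⟩
    have hrel : Rel (x :: A) (update env x i) mem s₁ := by
      have := hs.of_post h4 hA g3
      refine ⟨fun y hy => ?_, fun b hb => this.2 b (by simpa [h4x] using hb)⟩
      rcases List.mem_cons.1 hy with rfl | hy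
      · simp [g1]
      · rw [this.1 y hy]; simp [(hA y hy).ne]
    refine Runs.seq (c₂ := 7) ((ha i hi s₁ hrel).mono le_rfl fun s₂ p => ?_) le_rfl
    refine Runs.seq (c₂ := 2) ((runs_opProg hI h (by omega) s₂).mono le_rfl fun s₃ q => ?_) le_rfl
    refine .cons (by omega) (.instr (by omega) ?_)
    obtain ⟨w1, w2, w3⟩ := g3
    obtain ⟨p1, p2, p3⟩ := p
    obtain ⟨q1, q2, q3⟩ := q
    have e1 := w2 4 (by omega)
    have e2 := p2 4 (by omega)
    rw [e1] at p1 p3 e2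
    rw [e2] at q1 q3
    simp only [Instr.apply, State.setNat_nat, State.setNat_real, Post]
    have kx := (q2 x (by omega)).trans (p2 x (by omega))
    have kx1 := (q2 (x + 1) (by omega)).trans (p2 (x + 1) (by omega))
    refine ⟨by simp [kx, g1], by simp [kx1, g2], ?_, fun y hy => ?_, fun b hb => ?_⟩
    · rw [q1, p1, p3 _ (by omega), w1]
    · rw [Function.update_of_ne (by omega), Function.update_of_ne (by omega), q2 y (by omega),
        p2 y (by omega), w2 y hy]
    · rw [q3 b hb, p3 b (by omega), w3 b hb]
  · rintro s₁ ⟨g1, g2, g3⟩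
    exact ⟨by simp [Test.Holds, g1, g2], g3⟩
  · simp only [Instr.apply, State.setNat_nat, State.setNat_real, Post, State.setReal_nat,
      State.setReal_real]
    refine ⟨by simp, by simp [hsn], by simp [h4x], fun y hy => ?_, fun b hb => ?_⟩
    · rw [Function.update_of_ne (by omega), Function.update_of_ne (by omega)]
    · rw [Function.update_of_ne]
      simp only [Function.update_self, Function.update_of_ne h4x]
      omega

theorem isOp_add : IsOp .realAdd (· + ·) := fun _ _ _ _ => rfl
theorem isOp_sub : IsOp .realSub (· - ·) := fun _ _ _ _ => rfl
theorem isOp_mul : IsOp .realMul (· * ·) := fun _ _ _ _ => rfl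
theorem isOp_div : IsOp .realDiv (· / ·) := fun _ _ _ _ => rfl

theorem Post.trans_nat {d h x : ℕ} {v : ℝ} {s s₁ s₂ : State} {w : ℕ} (hx : 4 < x) (hdx : d ≤ x)
    (h₁ : NExpr.Post x w s s₁) (h₂ : Post d h v s₁ s₂) : Post d h v s s₂ := by
  obtain ⟨p1, p2, p3⟩ := h₁
  obtain ⟨q1, q2, q3⟩ := h₂
  rw [p2 4 hx] at q1 q3
  exact ⟨q1, fun y hy => (q2 y hy).trans (p2 y (by omega)), fun b hb => (q3 b hb).trans (by rw [p3])⟩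

theorem Post.mono {d d' h : ℕ} {v : ℝ} {s s₁ : State} (hd : d ≤ d') (h₁ : Post d' h v s s₁) :
    Post d h v s s₁ :=
  ⟨h₁.1, fun y hy => h₁.2.1 y (by omega), h₁.2.2⟩

theorem Rel.of_post_nat {A : List ℕ} {env : ℕ → ℕ} {mem : ℕ → ℝ} {s s' : State} {d w : ℕ}
    (hr : Rel A env mem s) (hA : ∀ x ∈ A, x < d) (hp : NExpr.Post d w s s') :
    Rel A env mem s' :=
  ⟨fun x hx => (hp.2.1 x (hA x hx)).trans (hr.1 x hx), fun a ha => by rw [hp.2.2, hr.2 a ha]⟩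

theorem runs_compile {B : ℕ} {mem : ℕ → ℝ} (e : RExpr) : ∀ {A : List ℕ} {env : ℕ → ℕ} {d h : ℕ}
    {s : State}, e.WF A d → e.Bd B env → 4 ∈ A → (∀ x ∈ A, x < d) → Rel A env mem s →
    Runs (e.compile d h) s (e.cost B) (Post d h (e.eval mem env) s) := by
  induction e with
  | cell e =>
    intro A env d h s hWF hBd h4 hA hs
    have hd := hA 4 h4
    refine Runs.seq (c₂ := 5) ((e.runs_compile hWF hBd.1 hA hs.1).mono le_rfl fun s₁ p => ?_) le_rfl
    refine runs_setAddr (by omega) (by omega) (.cons (by omega) (.instr (by omega) ?_))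
    have e4 := p.2.1 4 hd
    have hs4 := hs.1 4 h4
    have hlt := hBd.2
    simp only [Instr.apply, State.setNat_nat, State.setNat_real, Post, State.setReal_nat,
      State.setReal_real, State.getReal, eval]
    -- A copy is an addition of 0, for which the target cell is first set to 0. The source survives
    -- because memory addresses lie below the scratch space.
    have hne : e.eval env ≠ s.nat 4 + h := by omega
    refine ⟨?_, fun y hy => ?_, fun b hb => ?_⟩
    · simp [e4, p.1, p.2.2, hs.2 _ hlt, hne]
    · rw [Function.update_of_ne (by omega), p.2.1 y hy]
    · simp [e4, p.2.2, show b ≠ s.nat 4 + h by omega]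
  | const k =>
    intro A env d h s hWF hBd h4 hA hs
    have hd := hA 4 h4
    refine runs_setAddr hd (by simp [cost]) (.instr (by simp [cost]) ?_)
    simp only [Instr.apply, State.setNat_nat, State.setNat_real, Post, State.setReal_nat,
      State.setReal_real, eval]
    refine ⟨by simp, fun y hy => by simp [hy.ne], fun b hb => ?_⟩
    simp [show b ≠ s.nat 4 + h by omega]
  | add a b iha ihb =>
    intro A env d h s hWF hBd h4 hA hs
    exact runs_binary isOp_add (hA 4 h4) (iha hWF.1 hBd.1 h4 hA hs)
      fun s' h' => ihb hWF.2 hBd.2 h4 hA (hs.of_post h4 hA h')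
  | sub a b iha ihb =>
    intro A env d h s hWF hBd h4 hA hs
    exact runs_binary isOp_sub (hA 4 h4) (iha hWF.1 hBd.1 h4 hA hs)
      fun s' h' => ihb hWF.2 hBd.2 h4 hA (hs.of_post h4 hA h')
  | mul a b iha ihb =>
    intro A env d h s hWF hBd h4 hA hs
    exact runs_binary isOp_mul (hA 4 h4) (iha hWF.1 hBd.1 h4 hA hs)
      fun s' h' => ihb hWF.2 hBd.2 h4 hA (hs.of_post h4 hA h')
  | div a b iha ihb =>
    intro A env d h s hWF hBd h4 hA hs
    exact runs_binary isOp_div (hA 4 h4) (iha hWF.1 hBd.1 h4 hA hs)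
      fun s' h' => ihb hWF.2 hBd.2 h4 hA (hs.of_post h4 hA h')
  | sqrt a iha =>
    intro A env d h s hWF hBd h4 hA hs
    have hd := hA 4 h4
    refine Runs.seq (c₂ := 5) ((iha hWF hBd h4 hA hs).mono le_rfl fun s₁ p => ?_) le_rfl
    refine runs_setAddr hd (by omega) (.instr (by omega) ?_)
    obtain ⟨p1, p2, p3⟩ := p
    have e4 := p2 4 hd
    simp only [Instr.apply, State.setNat_nat, State.setNat_real, Post, State.setReal_nat,
      State.setReal_real, State.getReal, eval]
    refine ⟨by simp [e4, p1], fun y hy => by simp [hy.ne, p2 y hy], fun b hb => ?_⟩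
    simp [e4, show b ≠ s.nat 4 + h by omega, p3 b hb]
  | ite e f a b iha ihb =>
    intro A env d h s hWF hBd h4 hA hs
    have hd := hA 4 h4
    have hA' : ∀ x ∈ A, x < d + 1 := fun x hx => (hA x hx).trans (by omega)
    refine Runs.seq (c₂ := f.cost B + (a.cost B + b.cost B) + 5)
      ((e.runs_compile hWF.1 hBd.1 hA hs.1).mono le_rfl fun s₁ p => ?_)
      (by simp [cost]; omega)
    have hs₁ := hs.of_post_nat hA p
    refine Runs.seq (c₂ := (a.cost B + b.cost B) + 5)
      ((f.runs_compile hWF.2.1 hBd.2.1 hA' hs₁.1).mono le_rfl fun s₂ q => ?_) (by omega)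
    have hs₂ := hs₁.of_post_nat hA' q
    have k1 := (q.2.1 d (by omega)).trans p.1
    have k2 := q.1
    have key : Post d h (eval mem (ite e f a b) env) s₂ ≤ Post d h (eval mem (ite e f a b) env) s :=
      fun s₃ h₃ => (h₃.trans_nat (x := d + 1) (by omega) (by omega) q).trans_nat (by omega) le_rfl p
    refine (Runs.branch (c := a.cost B + b.cost B) (fun hT => ?_) fun hT => ?_).mono (by omega) key
    · simp only [Test.Holds, k1, k2] at hT
      simp only [eval, if_pos hT]
      exact (iha hWF.2.2.1 hBd.2.2.1 h4 hA hs₂).mono (by omega) fun _ h => h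
    · simp only [Test.Holds, k1, k2] at hT
      simp only [eval, if_neg hT]
      exact (ihb hWF.2.2.2 hBd.2.2.2 h4 hA hs₂).mono (by omega) fun _ h => h
  | sum x e a iha =>
    intro A env d h s hWF hBd h4 hA hs
    obtain ⟨hdx, hWe, hWa⟩ := hWF
    have hd := hA 4 h4
    have hA' : ∀ y ∈ A, y < x + 1 := fun y hy => (hA y hy).trans (by omega)
    refine Runs.seq (c₂ := B * (a.cost B + 10) + 5)
      ((e.runs_compile hWe hBd.1 hA' hs.1).mono le_rfl fun s₁ p => ?_) le_rfl
    refine (runs_fold isOp_add 0 (by omega) h4 (fun y hy => by have := hA y hy; omega)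
      (fun i => a.eval mem (update env x i)) hBd.2.1 (fun i hi s₂ hs₂ => ?_)
      (hs.of_post_nat hA' p) p.1).mono le_rfl fun s₂ h₂ => ?_
    · refine iha hWa (hBd.2.2 i hi) (by simp [h4]) ?_ hs₂
      rintro y hy
      rcases List.mem_cons.1 hy with rfl | hy
      · omega
      · have := hA y hy; omega
    · have := (h₂.mono hdx).trans_nat (by omega) (by omega) p
      convert this using 1
      simp only [eval]
      generalize e.eval env = n
      induction n with
      | zero => simp
      | succ n ih => rw [Finset.sum_range_succ, ih]
  | prod x e a iha =>
    intro A env d h s hWF hBd h4 hA hs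
    obtain ⟨hdx, hWe, hWa⟩ := hWF
    have hd := hA 4 h4
    have hA' : ∀ y ∈ A, y < x + 1 := fun y hy => (hA y hy).trans (by omega)
    refine Runs.seq (c₂ := B * (a.cost B + 10) + 5)
      ((e.runs_compile hWe hBd.1 hA' hs.1).mono le_rfl fun s₁ p => ?_) le_rfl
    refine (runs_fold isOp_mul 1 (by omega) h4 (fun y hy => by have := hA y hy; omega)
      (fun i => a.eval mem (update env x i)) hBd.2.1 (fun i hi s₂ hs₂ => ?_)
      (hs.of_post_nat hA' p) p.1).mono le_rfl fun s₂ h₂ => ?_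
    · refine iha hWa (hBd.2.2 i hi) (by simp [h4]) ?_ hs₂
      rintro y hy
      rcases List.mem_cons.1 hy with rfl | hy
      · omega
      · have := hA y hy; omega
    · have := (h₂.mono hdx).trans_nat (by omega) (by omega) p
      convert this using 1
      simp only [eval]
      generalize e.eval env = n
      induction n with
      | zero => simp
      | succ n ih => rw [Finset.prod_range_succ, ih]

end RExpr

/-! ### Statements -/

/-- Statements: programs that change only the real memory. -/
inductive Stmt where
  | store (e : NExpr) (a : RExpr)
  | seq (S T : Stmt)
  | loop (x : ℕ) (e : NExpr) (S : Stmt)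

namespace Stmt

open Function (update)

/-- The effect of a statement. -/
noncomputable def run : Stmt → (ℕ → ℕ) → (ℕ → ℝ) → ℕ → ℝ
  | store e a, env, mem => update mem (e.eval env) (a.eval mem env)
  | seq S T, env, mem => T.run env (S.run env mem)
  | loop x e S, env, mem => Nat.rec mem (fun i mem' => S.run (update env x i) mem') (e.eval env)

/-- The numbers of iterations are at most `B`, and the addresses are less than the variable `4`. -/
def Bd (B : ℕ) : Stmt → (ℕ → ℕ) → Prop
  | store e a, env => e.Bd B env ∧ e.eval env < env 4 ∧ a.Bd B env
  | seq S T, env => S.Bd B env ∧ T.Bd B env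
  | loop x e S, env => e.Bd B env ∧ e.eval env ≤ B ∧ ∀ k < e.eval env, S.Bd B (update env x k)

/-- The free variables are in `A`, and all bound variables are at least `d` and increasing. -/
def WF : Stmt → List ℕ → ℕ → Prop
  | store e a, A, d => e.WF A ∧ a.WF A d
  | seq S T, A, d => S.WF A d ∧ T.WF A d
  | loop x e S, A, d => d ≤ x ∧ e.WF A ∧ S.WF (x :: A) (x + 2)

/-- A bound for the running time. -/
def cost (B : ℕ) : Stmt → ℕ
  | store e a => a.cost B + (e.cost B + 6)
  | seq S T => S.cost B + T.cost B
  | loop _ e S => e.cost B + (B * (S.cost B + 10) + 5)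

/-- The program of a statement. -/
def compile : Stmt → ℕ → Program
  | store e a, d => .seq (a.compile d 0) <| .seq (e.compile d) <|
      RExpr.setAddr (d + 1) 0 <| RExpr.setAddr (d + 2) 1 <|
      .seq (.instr (.realConst (d + 2) 0)) (.instr (.realAdd d (d + 1) (d + 2)))
  | seq S T, d => .seq (S.compile d) (T.compile d)
  | loop x e S, _ => .seq (e.compile (x + 1)) <| .seq (.instr (.natConst x 0)) <|
      .loop (.natLt x (x + 1)) <| .seq (S.compile (x + 2)) <|
      .seq (.instr (.natConst (x + 2) 1)) (.instr (.natAdd x x (x + 2)))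

/-- The final state `s'` agrees with `s` on the integer cells before `d`, and with the memory. -/
def Post (d : ℕ) (mem : ℕ → ℝ) (s s' : State) : Prop :=
  (∀ x < d, s'.nat x = s.nat x) ∧ ∀ a < s.nat 4, s'.real a = mem a

/-- Between statements everything at or above the address in cell `4` is forgotten, so each
statement may start its scratch space afresh. -/
theorem runs_compile {B : ℕ} (S : Stmt) : ∀ {A : List ℕ} {env : ℕ → ℕ} {mem : ℕ → ℝ} {d : ℕ}
    {s : State}, S.WF A d → S.Bd B env → 4 ∈ A → (∀ x ∈ A, x < d) → RExpr.Rel A env mem s →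
    Runs (S.compile d) s (S.cost B) (Post d (S.run env mem) s) := by
  induction S with
  | store e a =>
    intro A env mem d s hWF hBd h4 hA hs
    have hd := hA 4 h4
    refine Runs.seq (c₂ := e.cost B + 6) ((a.runs_compile hWF.2 hBd.2.2 h4 hA hs).mono le_rfl
      fun s₁ p => ?_) le_rfl
    have hs₁ := hs.of_post h4 hA p
    refine Runs.seq (c₂ := 6) ((e.runs_compile hWF.1 hBd.1 hA hs₁.1).mono le_rfl
      fun s₂ q => ?_) le_rfl
    have hs₂ := hs₁.of_post_nat hA q
    refine RExpr.runs_setAddr (by omega) (by omega) (RExpr.runs_setAddr (by omega) (by omega)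
      (.cons (by omega) (.instr (by omega) ?_)))
    obtain ⟨p1, p2, p3⟩ := p
    obtain ⟨q1, q2, q3⟩ := q
    have k4 := (q2 4 hd).trans (p2 4 hd)
    have k4' := hs.1 4 h4
    have hlt := hBd.2.1
    have h4d : (4 : ℕ) ≠ d + 1 := by omega
    rw [add_zero] at p1
    simp only [Instr.apply, State.setNat_nat, State.setNat_real, Post, State.setReal_nat,
      State.setReal_real, State.getReal, run]
    refine ⟨fun y hy => ?_, fun b hb => ?_⟩
    · rw [Function.update_of_ne (by omega), Function.update_of_ne (by omega), q2 y hy, p2 y hy]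
    · simp only [Function.update_apply]
      have hsb := hs₂.2 b (by omega)
      simp [h4d, q1, k4, q3, p1]
      split_ifs with h1
      · rfl
      · omega
      · rw [← hsb, q3]
  | seq S T ihS ihT =>
    intro A env mem d s hWF hBd h4 hA hs
    have hs4 := hs.1 4 h4
    refine Runs.seq (c₂ := T.cost B) ((ihS hWF.1 hBd.1 h4 hA hs).mono le_rfl fun s₁ p => ?_) le_rfl
    refine (ihT hWF.2 hBd.2 h4 hA ⟨fun x hx => (p.1 x (hA x hx)).trans (hs.1 x hx),
      fun b hb => p.2 b (by omega)⟩).mono le_rfl fun s₂ q => ?_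
    have := p.1 4 (hA 4 h4)
    exact ⟨fun x hx => (q.1 x hx).trans (p.1 x hx), fun b hb => q.2 b (by omega)⟩
  | loop x e S ih =>
    intro A env mem d s hWF hBd h4 hA hs
    obtain ⟨hdx, hWe, hWa⟩ := hWF
    have hd := hA 4 h4
    have h4x : (4 : ℕ) ≠ x := by omega
    have hs4 := hs.1 4 h4
    have hA' : ∀ y ∈ A, y < x + 1 := fun y hy => (hA y hy).trans (by omega)
    refine Runs.seq (c₂ := B * (S.cost B + 10) + 5)
      ((e.runs_compile hWe hBd.1 hA' hs.1).mono le_rfl fun s₁ p => ?_) le_rfl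
    have hBn : e.eval env * (S.cost B + 2 + 1) ≤ B * (S.cost B + 10) :=
      Nat.mul_le_mul hBd.2.1 (by omega)
    refine .cons (by omega) ?_
    refine Runs.mono (Runs.loop (fun i s' => s'.nat x = i ∧ s'.nat (x + 1) = e.eval env ∧
      (∀ y < x, s'.nat y = s.nat y) ∧ ∀ a < s.nat 4, s'.real a =
        (Nat.rec mem (fun i mem' => S.run (update env x i) mem') i : ℕ → ℝ) a)
      (e.eval env) (S.cost B + 2) ?_ ?_ ?_) (by omega) fun _ h => h
    · rintro i hi s₂ ⟨g1, g2, g3, g4⟩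
      refine ⟨by simpa [Test.Holds, g1, g2] using hi, ?_⟩
      refine Runs.seq (c₂ := 2) ((ih (mem := (Nat.rec mem
        (fun i mem' => S.run (update env x i) mem') i : ℕ → ℝ)) hWa (hBd.2.2 i hi) (by simp [h4])
        ?_ ?_).mono le_rfl fun s₃ q => ?_) le_rfl
      · rintro y hy
        rcases List.mem_cons.1 hy with rfl | hy
        · omega
        · have := hA y hy; omega
      · refine ⟨fun y hy => ?_, fun b hb => g4 b ?_⟩
        · rcases List.mem_cons.1 hy with rfl | hy
          · simp [g1]
          · have := hA y hy
            rw [g3 y (by omega), hs.1 y hy, Function.update_of_ne (by omega)]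
        · rw [Function.update_of_ne h4x] at hb; omega
      · refine .cons (by omega) (.instr (by omega) ?_)
        obtain ⟨q1, q2⟩ := q
        have k0 := q1 x (by omega)
        have k1 := q1 (x + 1) (by omega)
        simp only [Instr.apply, State.setNat_nat, State.setNat_real]
        refine ⟨by simp [k0, g1], by simp [k1, g2], fun y hy => ?_, fun b hb => ?_⟩
        · rw [Function.update_of_ne (by omega), Function.update_of_ne (by omega), q1 y (by omega),
            g3 y hy]
        · have := g3 4 (by omega)
          exact q2 b (by omega)
    · rintro s₂ ⟨g1, g2, g3, g4⟩
      exact ⟨by simp [Test.Holds, g1, g2], fun y hy => g3 y (by omega), g4⟩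
    · simp only [Instr.apply, State.setNat_nat, State.setNat_real]
      refine ⟨by simp, by simp [p.1], fun y hy => ?_, fun b hb => ?_⟩
      · rw [Function.update_of_ne (by omega), p.2.1 y (by omega)]
      · rw [p.2.2]; exact hs.2 b (by omega)

end Stmt

end RealRAM


namespace RealRAM

/-! ### Running times are polynomial -/

/-- The function is bounded by a power of `B + 2`. -/
def PolyBdd (f : ℕ → ℕ) : Prop := ∃ k, ∀ B, f B ≤ (B + 2) ^ k

theorem PolyBdd.const (c : ℕ) : PolyBdd fun _ => c :=
  ⟨c, fun B => (Nat.lt_two_pow_self).le.trans (Nat.pow_le_pow_left (by omega) _)⟩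

theorem PolyBdd.id : PolyBdd fun B => B := ⟨1, fun B => by simp⟩

theorem PolyBdd.mul {f g : ℕ → ℕ} : PolyBdd f → PolyBdd g → PolyBdd fun B => f B * g B := by
  rintro ⟨k, hk⟩ ⟨l, hl⟩
  exact ⟨k + l, fun B => by rw [pow_add]; exact Nat.mul_le_mul (hk B) (hl B)⟩

theorem PolyBdd.add {f g : ℕ → ℕ} : PolyBdd f → PolyBdd g → PolyBdd fun B => f B + g B := by
  rintro ⟨k, hk⟩ ⟨l, hl⟩
  refine ⟨k + l + 1, fun B => ?_⟩
  have h1 : (B + 2) ^ k ≤ (B + 2) ^ (k + l) := Nat.pow_le_pow_right (by omega) (by omega)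
  have h2 : (B + 2) ^ l ≤ (B + 2) ^ (k + l) := Nat.pow_le_pow_right (by omega) (by omega)
  have := hk B
  have := hl B
  rw [pow_succ]
  nlinarith [Nat.zero_le ((B + 2) ^ (k + l) * B)]

/-- The exponent depends on the program text alone. For one fixed program it is thus an absolute
number, which is what makes the constant C independent of r. -/
theorem NExpr.polyBdd_cost (e : NExpr) : PolyBdd fun B => e.cost B := by
  induction e with
  | var x => exact .const _
  | const k => exact .const _
  | add a b iha ihb | sub a b iha ihb => exact (iha.add ihb).add (.const _)
  | mul a b iha ihb | div a b iha ihb =>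
    exact (iha.add ihb).add (((PolyBdd.const 3).mul .id).add (.const _))
  | pow a b iha ihb =>
    exact (iha.add ihb).add ((PolyBdd.id.mul (((PolyBdd.const 3).mul .id).add (.const _))).add
      (.const _))

theorem RExpr.polyBdd_cost (e : RExpr) : PolyBdd fun B => e.cost B := by
  induction e with
  | cell e => exact e.polyBdd_cost.add (.const _)
  | const k => exact .const _
  | add a b iha ihb | sub a b iha ihb | mul a b iha ihb | div a b iha ihb =>
    exact (iha.add ihb).add (.const _)
  | sqrt a ih => exact ih.add (.const _)
  | ite e f a b iha ihb =>
    exact ((e.polyBdd_cost.add f.polyBdd_cost).add (iha.add ihb)).add (.const _)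
  | sum x e a ih | prod x e a ih =>
    exact e.polyBdd_cost.add ((PolyBdd.id.mul (ih.add (.const _))).add (.const _))

theorem Stmt.polyBdd_cost (S : Stmt) : PolyBdd fun B => S.cost B := by
  induction S with
  | store e a => exact a.polyBdd_cost.add (e.polyBdd_cost.add (.const _))
  | seq S T ihS ihT => exact ihS.add ihT
  | loop x e S ih => exact e.polyBdd_cost.add ((PolyBdd.id.mul (ih.add (.const _))).add (.const _))

end RealRAM

/-! ### Matrix inversion by principal pivot transforms -/

namespace Matrix

variable {n : ℕ}

/-- The principal pivot transform at the index `t`. -/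
noncomputable def sweep (t : ℕ) (H : ℕ → ℕ → ℝ) (i j : ℕ) : ℝ :=
  if i = t then (if j = t then 1 / H t t else -H t j / H t t)
  else if j = t then H i t / H t t else H i j - H i t * H t j / H t t

/-- The matrix after `t` principal pivot transforms. -/
noncomputable def sweeps (G : ℕ → ℕ → ℝ) : ℕ → ℕ → ℕ → ℝ
  | 0 => G
  | t + 1 => sweep t (sweeps G t)

/-- `H` describes the relation `y = G x`, with the first `t` coordinates of `x` and `y` swapped. -/
def IsSwept (n t : ℕ) (G H : ℕ → ℕ → ℝ) : Prop :=
  ∀ x y : ℕ → ℝ, (∀ i < n, y i = ∑ j ∈ Finset.range n, G i j * x j) ↔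
    ∀ i < n, (if i < t then x i else y i) =
      ∑ j ∈ Finset.range n, H i j * (if j < t then y j else x j)

theorem isSwept_zero (n : ℕ) (G : ℕ → ℕ → ℝ) : IsSwept n 0 G G := by
  intro x y; simp

/-- Since the pivot is nonzero, the t-th equation can be solved for `x t`; substituting the result
into the other equations produces exactly the entries of `sweep t H`. -/
theorem IsSwept.succ {n t : ℕ} {G H : ℕ → ℕ → ℝ} (h : IsSwept n t G H) (ht : t < n)
    (hp : H t t ≠ 0) : IsSwept n (t + 1) G (sweep t H) := by
  intro x y
  rw [h x y]
  have hmem : t ∈ Finset.range n := Finset.mem_range.2 ht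
  have key : ∀ f : ℕ → ℝ, ∑ j ∈ Finset.range n, f j * (if j < t then y j else x j) =
      f t * x t + ∑ j ∈ (Finset.range n).erase t, f j * (if j < t then y j else x j) := by
    intro f
    rw [← Finset.add_sum_erase _ _ hmem]; simp
  have key' : ∀ f : ℕ → ℝ, ∑ j ∈ Finset.range n, f j * (if j < t + 1 then y j else x j) =
      f t * y t + ∑ j ∈ (Finset.range n).erase t, f j * (if j < t then y j else x j) := by
    intro f
    rw [← Finset.add_sum_erase _ _ hmem]
    congr 1
    · simp
    · refine Finset.sum_congr rfl fun j hj => ?_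
      have : j ≠ t := Finset.ne_of_mem_erase hj
      simp only [show j < t + 1 ↔ j < t by omega]
  set w : ℕ → ℝ := fun j => if j < t then y j else x j with hw
  set E := (Finset.range n).erase t
  have e1 : ∀ i, i ≠ t → ∑ j ∈ E, sweep t H i j * w j =
      ∑ j ∈ E, H i j * w j - H i t / H t t * ∑ j ∈ E, H t j * w j := by
    intro i hi
    rw [Finset.mul_sum, ← Finset.sum_sub_distrib]
    refine Finset.sum_congr rfl fun j hj => ?_
    have : j ≠ t := Finset.ne_of_mem_erase hj
    simp only [sweep, if_neg hi, if_neg this]; ring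
  have e2 : ∑ j ∈ E, sweep t H t j * w j = - (1 / H t t) * ∑ j ∈ E, H t j * w j := by
    rw [Finset.mul_sum]
    refine Finset.sum_congr rfl fun j hj => ?_
    have : j ≠ t := Finset.ne_of_mem_erase hj
    simp only [sweep, if_true, if_neg this]; ring
  have s1 : sweep t H t t = 1 / H t t := by simp [sweep]
  have s2 : ∀ i, i ≠ t → sweep t H i t = H i t / H t t := fun i hi => by simp [sweep, hi]
  have tt : (∀ P : ℕ → Prop, (∀ i < n, P i) ↔ P t ∧ ∀ i < n, i ≠ t → P i) := fun P =>
    ⟨fun h => ⟨h t ht, fun i hi _ => h i hi⟩, fun h i hi => by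
      by_cases hit : i = t
      · exact hit ▸ h.1
      · exact h.2 i hi hit⟩
  rw [tt, tt (fun i => (if i < t + 1 then x i else y i) = _)]
  simp only [lt_irrefl, if_false, Nat.lt_succ_self, if_true]
  rw [key, key', e2, s1]
  have hpiv : y t = H t t * x t + ∑ j ∈ E, H t j * w j ↔
      x t = 1 / H t t * y t + -(1 / H t t) * ∑ j ∈ E, H t j * w j := by
    constructor <;> intro h <;> rw [h] <;> field_simp <;> ring
  rw [← hpiv]
  refine and_congr_right fun hy => forall_congr' fun i => imp_congr_right fun hi =>
    imp_congr_right fun hit => ?_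
  rw [key, key', e1 i hit, s2 i hit]
  simp only [show i < t + 1 ↔ i < t by omega]
  have : H i t * x t + ∑ j ∈ E, H i j * w j = H i t / H t t * y t +
      (∑ j ∈ E, H i j * w j - H i t / H t t * ∑ j ∈ E, H t j * w j) := by
    rw [hy]; field_simp; ring
  rw [this]

theorem isSwept_sweeps {n : ℕ} {G : ℕ → ℕ → ℝ} {t : ℕ} (ht : t ≤ n)
    (hp : ∀ s < t, sweeps G s s s ≠ 0) : IsSwept n t G (sweeps G t) := by
  induction t with
  | zero => exact isSwept_zero n G
  | succ t ih =>
    exact (ih (by omega) fun s hs => hp s (by omega)).succ (by omega) (hp t (by omega))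

/-- The pivots of a positive definite matrix are positive. -/
theorem IsSwept.pivot_pos {n t : ℕ} {G H : ℕ → ℕ → ℝ} (h : IsSwept n t G H) (ht : t < n)
    (hG : ∀ x : ℕ → ℝ, x t ≠ 0 →
      0 < ∑ i ∈ Finset.range n, x i * ∑ j ∈ Finset.range n, G i j * x j) : 0 < H t t := by
  -- Feed the t-th unit vector into the swapped relation. The resulting pair satisfies y = Gx, and x
  -- i * y i vanishes except at i = t, so the quadratic form of G at x equals the pivot.
  set x : ℕ → ℝ := fun i => if i < t then H i t else if i = t then 1 else 0 with hx
  set y : ℕ → ℝ := fun i => if i < t then 0 else H i t with hy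
  have hw : ∀ i, ∑ j ∈ Finset.range n, H i j * (if j < t then y j else x j) = H i t := by
    intro i
    rw [Finset.sum_eq_single t]
    · simp [hx]
    · intro j _ hj
      by_cases hjt : j < t <;> simp [hx, hy, hjt, hj]
    · intro h; exact absurd (Finset.mem_range.2 ht) h
  have hxy := (h x y).2 fun i hi => by
    rw [hw i]
    by_cases hit : i < t <;> simp [hx, hy, hit]
  have hpos := hG x (by simp [hx])
  rw [Finset.sum_congr rfl (fun i hi => by rw [← hxy i (Finset.mem_range.1 hi)]),
    Finset.sum_eq_single t] at hpos
  · simpa [hx, hy] using hpos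
  · intro j _ hj
    by_cases hjt : j < t <;> simp [hx, hy, hjt, hj]
  · intro h; exact absurd (Finset.mem_range.2 ht) h

/-- If all pivots are nonzero, the result is a right inverse. -/
theorem sweeps_mul {n : ℕ} {G : ℕ → ℕ → ℝ} (hp : ∀ s < n, sweeps G s s s ≠ 0) :
    ∀ i < n, ∀ k < n, ∑ j ∈ Finset.range n, G i j * sweeps G n j k = if i = k then 1 else 0 := by
  have h := isSwept_sweeps le_rfl hp
  intro i hi k hk
  -- After n swaps the relation reads x = Hy. Taking y to be the k-th unit vector shows that G maps
  -- the k-th column of H to it.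
  have := (h (fun j => sweeps G n j k) (fun j => if j = k then 1 else 0)).2 fun i hi => by
    rw [if_pos hi, Finset.sum_eq_single k]
    · simp [hk]
    · intro j hj hjk
      simp [Finset.mem_range.1 hj, hjk]
    · intro h; exact absurd (Finset.mem_range.2 hk) h
  exact (this i hi).symm

/-- Strong induction: the description of the t-th stage as a swapped relation is available only once
all earlier pivots are known to be nonzero. -/
theorem sweeps_pivot_pos {n : ℕ} {G : ℕ → ℕ → ℝ}
    (hG : ∀ x : ℕ → ℝ, (∃ t < n, x t ≠ 0) →
      0 < ∑ i ∈ Finset.range n, x i * ∑ j ∈ Finset.range n, G i j * x j) :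
    ∀ t < n, 0 < sweeps G t t t := by
  intro t
  induction t using Nat.strong_induction_on with
  | _ t ih =>
    intro ht
    exact (isSwept_sweeps ht.le fun s hs => (ih s hs (hs.trans ht)).ne').pivot_pos ht
      fun x hx => hG x ⟨t, ht, hx⟩

/-! ### The trace of the inverse of a Gram matrix -/

variable {α β : Type*} [Fintype α] [Fintype β] [DecidableEq β]

/-- The inverse H of a Gram matrix is symmetric and satisfies (LH)ᵀ(LH) = H, so its diagonal
consists of the squared column norms of LH. -/
theorem diag_eq_of_gram_mul_eq_one (L : Matrix α β ℝ) (H : Matrix β β ℝ) (h : Lᵀ * L * H = 1)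
    (J : β) : H J J = ∑ s, (L * H) s J ^ 2 := by
  have hH : Hᵀ * (Lᵀ * L) = 1 := by
    have := congrArg transpose h
    simpa [transpose_mul, Matrix.mul_assoc] using this
  have : (L * H)ᵀ * (L * H) = H := by
    have e2 : Hᵀ = H := by
      calc Hᵀ = Hᵀ * (Lᵀ * L * H) := by rw [h, Matrix.mul_one]
        _ = H := by rw [← Matrix.mul_assoc, hH, Matrix.one_mul]
    rw [transpose_mul, Matrix.mul_assoc, ← Matrix.mul_assoc Lᵀ, h, Matrix.mul_one, e2]
  conv_lhs => rw [← this]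
  rw [Matrix.mul_apply]
  exact Finset.sum_congr rfl fun s _ => by rw [transpose_apply, sq]

/-- If `H` is a right inverse of the Gram matrix of `L`, then `‖y‖² ≤ tr H ‖L y‖²`. -/
theorem sum_sq_le_trace_mul (L : Matrix α β ℝ) (H : Matrix β β ℝ) (h : Lᵀ * L * H = 1)
    (y : β → ℝ) : ∑ J, y J ^ 2 ≤ H.trace * ∑ s, (L *ᵥ y) s ^ 2 := by
  rw [trace, Finset.sum_mul]
  refine Finset.sum_le_sum fun J _ => ?_
  have hH : Hᵀ * (Lᵀ * L) = 1 := by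
    have := congrArg transpose h
    simpa [transpose_mul, Matrix.mul_assoc] using this
  -- LH is a dual system to L: pairing its column J with Ly returns y J. Cauchy–Schwarz then costs
  -- the squared norm of that column, which is H J J.
  have h1 : y J = ∑ s, (L * H) s J * (L *ᵥ y) s := by
    have : (L * H)ᵀ *ᵥ (L *ᵥ y) = y := by
      rw [transpose_mul, mulVec_mulVec, Matrix.mul_assoc, hH, one_mulVec]
    conv_lhs => rw [← this]
    rfl
  rw [diag_apply, diag_eq_of_gram_mul_eq_one L H h]
  nth_rw 1 [h1]
  exact Finset.sum_mul_sq_le_sq_mul_sq _ _ _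

variable {G : ℕ → ℕ → ℝ} {L : Matrix α (Fin n) ℝ}

theorem gram_mul_sweeps (hG : ∀ i j : Fin n, G i j = ∑ s, L s i * L s j)
    (hp : ∀ s < n, sweeps G s s s ≠ 0) :
    Lᵀ * L * (Matrix.of fun i j : Fin n => sweeps G n i j) = 1 := by
  ext i k
  have := sweeps_mul hp i i.2 k k.2
  rw [Finset.sum_range] at this
  rw [Matrix.mul_apply, Matrix.one_apply]
  simp only [Fin.ext_iff]
  rw [← this]
  exact Finset.sum_congr rfl fun j _ => by rw [hG]; simp [Matrix.mul_apply]

theorem sum_sq_le_sweeps (hG : ∀ i j : Fin n, G i j = ∑ s, L s i * L s j)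
    (hp : ∀ s < n, sweeps G s s s ≠ 0) (y : Fin n → ℝ) :
    ∑ J, y J ^ 2 ≤ (∑ t ∈ Finset.range n, sweeps G n t t) * ∑ s, (L *ᵥ y) s ^ 2 := by
  have := sum_sq_le_trace_mul L _ (gram_mul_sweeps hG hp) y
  rwa [Finset.sum_range]

theorem sweeps_trace_nonneg (hG : ∀ i j : Fin n, G i j = ∑ s, L s i * L s j)
    (hp : ∀ s < n, sweeps G s s s ≠ 0) : 0 ≤ ∑ t ∈ Finset.range n, sweeps G n t t := by
  rw [Finset.sum_range]
  refine Finset.sum_nonneg fun J _ => ?_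
  have := diag_eq_of_gram_mul_eq_one L _ (gram_mul_sweeps hG hp) J
  rw [of_apply] at this
  rw [this]
  exact Finset.sum_nonneg fun s _ => sq_nonneg _

theorem sweeps_pivot_pos_of_gram (hG : ∀ i j : Fin n, G i j = ∑ s, L s i * L s j) {μ : ℝ}
    (hμ : 0 < μ) (hL : ∀ (y : Fin n → ℝ) J, μ * y J ^ 2 ≤ ∑ s, (L *ᵥ y) s ^ 2) :
    ∀ t < n, 0 < sweeps G t t t := by
  refine sweeps_pivot_pos fun x ⟨t, ht, hx⟩ => ?_
  refine lt_of_lt_of_le (by positivity) ((hL (fun j => x j) ⟨t, ht⟩).trans_eq ?_)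
  rw [Finset.sum_range]
  simp only [mulVec, dotProduct, Finset.sum_range, hG, Finset.mul_sum, Finset.sum_mul, sq]
  rw [Finset.sum_comm]
  refine Finset.sum_congr rfl fun i _ => ?_
  rw [Finset.sum_comm]
  exact Finset.sum_congr rfl fun j _ => Finset.sum_congr rfl fun s _ => by ring

/-- Apply the lower bound to the J-th column of the inverse H: the image of this column has squared
norm H J J, so μ (H J J)² ≤ H J J. A coordinatewise lower bound, as supplied by leave-one-out
distances, is enough here. -/
theorem sweeps_trace_le (hG : ∀ i j : Fin n, G i j = ∑ s, L s i * L s j) {μ : ℝ}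
    (hμ : 0 < μ) (hL : ∀ (y : Fin n → ℝ) J, μ * y J ^ 2 ≤ ∑ s, (L *ᵥ y) s ^ 2) :
    ∑ t ∈ Finset.range n, sweeps G n t t ≤ n / μ := by
  have hp : ∀ s < n, sweeps G s s s ≠ 0 := fun s hs => (sweeps_pivot_pos_of_gram hG hμ hL s hs).ne'
  rw [Finset.sum_range]
  have : ∀ J : Fin n, sweeps G n J J ≤ 1 / μ := fun J => by
    have h1 := diag_eq_of_gram_mul_eq_one L _ (gram_mul_sweeps hG hp) J
    have h2 := hL (fun i => sweeps G n i J) J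
    rw [of_apply] at h1
    have h3 : sweeps G n J J = ∑ s, (L *ᵥ fun i : Fin n => sweeps G n i J) s ^ 2 := h1
    rw [← h3] at h2
    rw [le_div_iff₀ hμ]
    by_contra hc
    push Not at hc
    have : 0 < sweeps G n J J := by
      by_contra h0
      nlinarith
    nlinarith
  calc _ ≤ ∑ J : Fin n, 1 / μ := Finset.sum_le_sum fun J _ => this J
    _ = n / μ := by simp [div_eq_mul_inv]

end Matrix


/-! ### Minors as multilinear forms -/

/-- The sign of a permutation, extended by `0` to all functions. -/
noncomputable def fnSign {d : ℕ} (f : Fin d → Fin d) : ℝ :=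
  ∏ a, ∏ b ∈ Finset.Iio a, if f b < f a then 1 else if f a < f b then -1 else 0

theorem fnSign_perm {d : ℕ} (σ : Equiv.Perm (Fin d)) : fnSign σ = (σ.sign : ℤ) := by
  rw [Equiv.Perm.sign_eq_prod_prod_Iio]
  push_cast
  refine Finset.prod_congr rfl fun a _ => Finset.prod_congr rfl fun b hb => ?_
  have hne : σ b ≠ σ a := fun h => (Finset.mem_Iio.1 hb).ne (σ.injective h)
  rcases hne.lt_or_gt with h | h
  · simp [h]
  · simp [h, h.not_gt]

theorem fnSign_id {d : ℕ} : fnSign (id : Fin d → Fin d) = 1 := by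
  have := fnSign_perm (1 : Equiv.Perm (Fin d))
  simpa using this

/-- With this, determinants become sums over all functions, which a program can enumerate as the
d-digit numbers in base d. -/
theorem fnSign_eq_zero {d : ℕ} {f : Fin d → Fin d} (hf : ¬ Function.Injective f) :
    fnSign f = 0 := by
  simp only [Function.Injective, not_forall] at hf
  obtain ⟨a, b, h, hne⟩ := hf
  wlog hba : b < a generalizing a b
  · exact this b a h.symm (Ne.symm hne) (lt_of_le_of_ne (not_lt.1 hba) hne)
  refine Finset.prod_eq_zero (Finset.mem_univ a) (Finset.prod_eq_zero (Finset.mem_Iio.2 hba) ?_)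
  simp [h]

theorem abs_fnSign_le {d : ℕ} (f : Fin d → Fin d) : |fnSign f| ≤ 1 := by
  simp only [fnSign, Finset.abs_prod]
  refine Finset.prod_le_one (fun _ _ => Finset.prod_nonneg fun _ _ => abs_nonneg _) fun a _ =>
    Finset.prod_le_one (fun _ _ => abs_nonneg _) fun b _ => ?_
  split_ifs <;> simp

/-- The minor with rows `(s a).1` and columns `(s a).2`, as a multilinear form in the rows: its
`a`-th row is taken from the matrix `w a`. -/
noncomputable def mixedMinor {d n₁ n₂ : ℕ} (w : Fin d → MatSpace n₁ n₂)
    (s : Fin d → Fin n₁ × Fin n₂) : ℝ :=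
  ∑ f : Fin d → Fin d, fnSign f * ∏ a, w a ((s a).1, (s (f a)).2)

section

variable {d n₁ n₂ m : ℕ}

/-- When all arguments coincide, the mixed minor is the determinant of a d × d submatrix, with rows
and columns possibly repeated, and the rank of a submatrix is at most r < d. -/
theorem mixedMinor_const_eq_zero {r : ℕ} (hr : r < d) {v : MatSpace n₁ n₂}
    (hv : v ∈ rankVariety n₁ n₂ r) (s : Fin d → Fin n₁ × Fin n₂) :
    mixedMinor (fun _ => v) s = 0 := by
  set M : Matrix (Fin d) (Fin d) ℝ := v.toMatrix.submatrix (fun a => (s a).1) fun a => (s a).2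
  have h1 : mixedMinor (fun _ => v) s = M.det := by
    rw [← Matrix.det_transpose, Matrix.det_apply']
    refine (Fintype.sum_of_injective (fun σ : Equiv.Perm (Fin d) => (σ : Fin d → Fin d))
      DFunLike.coe_injective _ _ (fun f hf => ?_) fun σ => ?_).symm
    · rw [fnSign_eq_zero, zero_mul]
      intro hi
      exact hf ⟨Equiv.ofBijective f (Finite.injective_iff_bijective.1 hi), rfl⟩
    · rw [fnSign_perm]; rfl
  rw [h1]
  by_contra hdet
  have h2 : M.rank = d := by
    have := Matrix.rank_of_isUnit M ((Matrix.isUnit_iff_isUnit_det M).2 (Ne.isUnit hdet))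
    simpa using this
  have h3 : M.rank ≤ v.toMatrix.rank := Matrix.rank_submatrix_le _ _ _
  have h4 : v.toMatrix.rank ≤ r := hv
  omega

/-- Multilinearity. A linear combination or a change of basis thereby acts on the minors through a
tensor product of coefficient vectors. -/
theorem mixedMinor_sum (S : Fin d → Fin m → ℝ) (u : Fin m → MatSpace n₁ n₂)
    (s : Fin d → Fin n₁ × Fin n₂) :
    mixedMinor (fun a => ∑ j, S a j • u j) s =
      ∑ J : Fin d → Fin m, (∏ a, S a (J a)) * mixedMinor (fun a => u (J a)) s := by
  simp only [mixedMinor, Finset.mul_sum]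
  rw [Finset.sum_comm]
  refine Finset.sum_congr rfl fun f _ => ?_
  have : ∏ a, (∑ j, S a j • u j) ((s a).1, (s (f a)).2) =
      ∏ a, ∑ j, S a j * u j ((s a).1, (s (f a)).2) :=
    Finset.prod_congr rfl fun a _ => by simp
  rw [this, Finset.prod_univ_sum, Finset.mul_sum, Fintype.piFinset_univ]
  refine Finset.sum_congr rfl fun J _ => ?_
  rw [Finset.prod_mul_distrib]; ring

theorem abs_prod_sub_prod_le {ι : Type*} (t : Finset ι) (x y : ι → ℝ) {M η : ℝ} (hM : 1 ≤ M)
    (hx : ∀ i, |x i| ≤ M) (hy : ∀ i, |y i| ≤ M) (hxy : ∀ i, |x i - y i| ≤ η) :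
    |∏ i ∈ t, x i - ∏ i ∈ t, y i| ≤ t.card * M ^ t.card * η := by
  classical
  induction t using Finset.induction_on with
  | empty => simp
  | insert i t hi ih =>
    rw [Finset.prod_insert hi, Finset.prod_insert hi, Finset.card_insert_of_notMem hi]
    have hη : 0 ≤ η := (abs_nonneg _).trans (hxy i)
    have h1 : |∏ j ∈ t, x j| ≤ M ^ t.card := by
      rw [Finset.abs_prod]
      exact (Finset.prod_le_prod (fun _ _ => abs_nonneg _) fun j _ => hx j).trans (by simp)
    have e : x i * ∏ j ∈ t, x j - y i * ∏ j ∈ t, y j =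
        (x i - y i) * ∏ j ∈ t, x j + y i * (∏ j ∈ t, x j - ∏ j ∈ t, y j) := by ring
    have hMp : M ^ t.card ≤ M ^ (t.card + 1) := pow_le_pow_right₀ hM (by omega)
    calc _ ≤ |x i - y i| * |∏ j ∈ t, x j| + |y i| * |∏ j ∈ t, x j - ∏ j ∈ t, y j| := by
          rw [e, ← abs_mul, ← abs_mul]; exact abs_add_le _ _
      _ ≤ η * M ^ (t.card + 1) + M * (t.card * M ^ t.card * η) := by
          gcongr
          · exact hxy i
          · exact h1.trans hMp
          · exact hy i
      _ = _ := by push_cast; ring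

/-- There are d^d terms, each a product of d entries bounded by 2, and products are compared by
telescoping. -/
theorem abs_mixedMinor_sub_le {u v : MatSpace n₁ n₂} {η : ℝ} (hu : ‖u‖ ≤ 2) (hv : ‖v‖ ≤ 2)
    (huv : ‖u - v‖ ≤ η) (s : Fin d → Fin n₁ × Fin n₂) :
    |mixedMinor (fun _ => u) s - mixedMinor (fun _ => v) s| ≤ d ^ d * (d * 2 ^ d * η) := by
  rw [mixedMinor, mixedMinor, ← Finset.sum_sub_distrib]
  refine (Finset.abs_sum_le_sum_abs _ _).trans ?_
  refine (Finset.sum_le_sum (g := fun _ => (d * 2 ^ d * η : ℝ)) fun f _ => ?_).trans (by simp)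
  rw [← mul_sub, abs_mul]
  have := abs_prod_sub_prod_le (Finset.univ : Finset (Fin d)) (fun a => u ((s a).1, (s (f a)).2))
    (fun a => v ((s a).1, (s (f a)).2)) (M := 2) (η := η) (by norm_num)
    (fun a => (PiLp.norm_apply_le u _).trans hu) (fun a => (PiLp.norm_apply_le v _).trans hv)
    (fun a => (PiLp.norm_apply_le (u - v) _).trans huv)
  rw [Finset.card_univ, Fintype.card_fin] at this
  calc _ ≤ 1 * _ := mul_le_mul_of_nonneg_right (abs_fnSign_le f) (abs_nonneg _)
    _ ≤ _ := by rw [one_mul]; exact this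

theorem norm_sq_sum_orthonormal {b : Fin m → MatSpace n₁ n₂} (hb : Orthonormal ℝ b)
    (x : Fin m → ℝ) : ‖∑ j, x j • b j‖ ^ 2 = ∑ j, x j ^ 2 := by
  rw [← real_inner_self_eq_norm_sq, hb.inner_sum]
  exact Finset.sum_congr rfl fun j _ => by simp [sq]

/-- This fixes the exponent 3d in the certificate. Squared, it supplies N^{6d}: one N^d pays for the
number of minors, N^{2d} for d^{2(d+1)} and N^{2d} for 16^d. The summand 1 in √(1+p) makes the
inequality strict and covers p = 0. -/
theorem gram_bound_lt {d : ℕ} {N p : ℝ} (hd : 2 ≤ d) (hdN : (d : ℝ) ^ 2 ≤ N) (hp : 0 ≤ p) :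
    p * (N ^ d * (d ^ d * (d * 2 ^ d * (1 / (Real.sqrt (1 + p) * N ^ (3 * d))))) ^ 2) <
      (1 / 4) ^ d := by
  have hd' : (2 : ℝ) ≤ d := by exact_mod_cast hd
  have hN4 : 4 ≤ N := by nlinarith
  have hηsq : (1 / (Real.sqrt (1 + p) * N ^ (3 * d))) ^ 2 = 1 / ((1 + p) * N ^ (6 * d)) := by
    rw [div_pow, mul_pow, Real.sq_sqrt (by linarith), one_pow, ← pow_mul]
    ring_nf
  have e1 : ∀ η : ℝ, ((d : ℝ) ^ d * (d * 2 ^ d * η)) ^ 2 = (d ^ 2) ^ (d + 1) * 4 ^ d * η ^ 2 := by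
    intro η
    rw [show (4 : ℝ) = 2 ^ 2 by norm_num, ← pow_mul, ← pow_mul]; ring
  rw [e1, hηsq]
  have h16 : (16 : ℝ) ^ d ≤ N ^ (2 * d) := by
    rw [pow_mul]; gcongr; nlinarith
  have hdp : ((d : ℝ) ^ 2) ^ (d + 1) ≤ N ^ (2 * d) :=
    (pow_le_pow_left₀ (by positivity) hdN _).trans (pow_le_pow_right₀ (by linarith) (by omega))
  have h6 : N ^ (6 * d) = N ^ d * (N ^ (2 * d) * N ^ (2 * d)) * N ^ d := by ring
  have hNd : 1 ≤ N ^ d := one_le_pow₀ (by linarith)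
  have hNd0 : 0 < N ^ d := by positivity
  generalize N ^ (2 * d) = A at *
  have hA : 0 < A := lt_of_lt_of_le (by positivity) h16
  generalize N ^ (6 * d) = F at *
  generalize N ^ d = E at *
  have hprod : ((d : ℝ) ^ 2) ^ (d + 1) * 16 ^ d ≤ A * A := by gcongr
  have e16 : (16 : ℝ) ^ d = 4 ^ d * 4 ^ d := by rw [← mul_pow]; norm_num
  rw [e16] at hprod
  generalize ((d : ℝ) ^ 2) ^ (d + 1) = X at *
  have h4 : (0 : ℝ) < 4 ^ d := by positivity
  rw [div_pow, one_pow]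
  generalize (4 : ℝ) ^ d = Y at *
  have hF : 0 < F := by rw [h6]; positivity
  rw [lt_div_iff₀ h4, show p * (E * (X * Y * (1 / ((1 + p) * F)))) * Y =
    p * (E * (X * (Y * Y))) / ((1 + p) * F) by field_simp, div_lt_one (by positivity), h6]
  calc p * (E * (X * (Y * Y))) ≤ p * (E * (A * A)) := by gcongr
    _ < (1 + p) * (E * (A * A)) := by
        have : 0 < E * (A * A) := by positivity
        nlinarith
    _ ≤ (1 + p) * (E * (A * A) * E) := by
        refine mul_le_mul_of_nonneg_left ?_ (by linarith)
        exact le_mul_of_one_le_right (by positivity) hNd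

/-- A quantitative injectivity of the polarized minors on a subspace gives robust
entanglement. -/
theorem isRobustlyEntangled_of_gram {r : ℕ} (h₁ : d ≤ n₁) (h₂ : d ≤ n₂) (hr : r < d) (hd : 2 ≤ d)
    {b : Fin m → MatSpace n₁ n₂} (hb : Orthonormal ℝ b) {p : ℝ} (hp : 0 ≤ p)
    (hL : ∀ y : (Fin d → Fin m) → ℝ, ∑ J, y J ^ 2 ≤
      p * ∑ s, (∑ J, y J * mixedMinor (fun a => b (J a)) s) ^ 2) :
    IsRobustlyEntangled r (1 / (Real.sqrt (1 + p) * ((n₁ : ℝ) * n₂) ^ (3 * d)))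
      (Submodule.span ℝ (Set.range b)) := by
  intro v hv hv1 u hu
  by_contra hlt
  push Not at hlt
  have hd1 : (d : ℝ) ≤ n₁ := by exact_mod_cast h₁
  have hd2 : (d : ℝ) ≤ n₂ := by exact_mod_cast h₂
  have hd' : (2 : ℝ) ≤ d := by exact_mod_cast hd
  have hdN : (d : ℝ) ^ 2 ≤ (n₁ : ℝ) * n₂ := by
    rw [sq]; exact mul_le_mul hd1 hd2 (by positivity) (by positivity)
  have hcard : ((n₁ : ℝ) * n₂) ^ d = Fintype.card (Fin d → Fin n₁ × Fin n₂) := by simp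
  have hfin := gram_bound_lt hd hdN hp
  generalize (n₁ : ℝ) * n₂ = N at *
  have hN4 : 4 ≤ N := by nlinarith
  have hsq : 1 ≤ Real.sqrt (1 + p) := Real.one_le_sqrt.2 (by linarith)
  have hN3 : (4 : ℝ) ≤ N ^ (3 * d) :=
    hN4.trans (le_self_pow₀ (by linarith) (by omega))
  -- This keeps the norm of the approximant u between 1/2 and 2.
  have hη2 : 1 / (Real.sqrt (1 + p) * N ^ (3 * d)) ≤ 1 / 2 := by
    gcongr; nlinarith
  generalize 1 / (Real.sqrt (1 + p) * N ^ (3 * d)) = η at *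
  obtain ⟨x, rfl⟩ := (Submodule.mem_span_range_iff_exists_fun ℝ).1 hu
  set u := ∑ j, x j • b j with hudef
  have hu1 : 1 / 2 ≤ ‖u‖ := by
    have := norm_sub_norm_le v u
    linarith
  have hu2 : ‖u‖ ≤ 2 := by
    have := norm_sub_norm_le u v
    rw [norm_sub_rev] at this
    linarith
  have hx : ∑ J : Fin d → Fin m, (∏ a, x (J a)) ^ 2 = (‖u‖ ^ 2) ^ d := by
    rw [hudef, norm_sq_sum_orthonormal hb, Fintype.sum_pow]
    exact Finset.sum_congr rfl fun J _ => by rw [Finset.prod_pow]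
  -- The test tensor is the d-th tensor power of the coordinate vector of u; by multilinearity its
  -- image consists of the ordinary minors of u.
  have hy := hL fun J => ∏ a, x (J a)
  have hmin : ∀ s, (∑ J : Fin d → Fin m, (∏ a, x (J a)) * mixedMinor (fun a => b (J a)) s) ^ 2 ≤
      (d ^ d * (d * 2 ^ d * η)) ^ 2 := fun s => by
    rw [← mixedMinor_sum (fun _ => x) b s, ← hudef]
    have := abs_mixedMinor_sub_le (d := d) (η := η) hu2 (hv1.trans_le one_le_two)
      (by rw [norm_sub_rev]; exact hlt.le) s
    rw [mixedMinor_const_eq_zero hr hv, sub_zero] at this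
    exact sq_le_sq.2 (this.trans (le_abs_self (_ : ℝ)))
  have hsum : ∑ s, (∑ J : Fin d → Fin m, (∏ a, x (J a)) * mixedMinor (fun a => b (J a)) s) ^ 2 ≤
      N ^ d * (d ^ d * (d * 2 ^ d * η)) ^ 2 := by
    refine (Finset.sum_le_sum fun s _ => hmin s).trans ?_
    rw [Finset.sum_const, nsmul_eq_mul, Finset.card_univ, hcard]
  have hlow : (1 / 4 : ℝ) ^ d ≤ (‖u‖ ^ 2) ^ d := by
    gcongr; nlinarith
  have hmain : (1 / 4 : ℝ) ^ d ≤ p * (N ^ d * (d ^ d * (d * 2 ^ d * η)) ^ 2) :=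
    hlow.trans (hx ▸ hy.trans (mul_le_mul_of_nonneg_left hsum hp))
  exact absurd hmain (not_le.2 hfin)

end


/-! ### Conditioning on a part of the coordinates -/

section Conditioning

variable {ι : Type*} [Fintype ι] (μ : Measure ℝ) [IsProbabilityMeasure μ]

open Classical in
-- Drawing the coordinates in S from one copy and the rest from an independent copy does not change
-- the law. Conditioning on the coordinates outside S is then just Fubini for the two copies.
theorem measurePreserving_piecewise (S : Set ι) :
    MeasurePreserving (fun p : (ι → ℝ) × (ι → ℝ) => S.piecewise p.1 p.2)
      ((Measure.pi fun _ => μ).prod (Measure.pi fun _ => μ)) (Measure.pi fun _ => μ) := by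
  have hm : Measurable fun p : (ι → ℝ) × (ι → ℝ) => S.piecewise p.1 p.2 := by
    refine measurable_pi_lambda _ fun i => ?_
    by_cases hi : i ∈ S
    · simp only [Set.piecewise_eq_of_mem _ _ _ hi]; fun_prop
    · simp only [Set.piecewise_eq_of_notMem _ _ _ hi]; fun_prop
  refine ⟨hm, (Measure.pi_eq fun s hs => ?_).symm⟩
  rw [Measure.map_apply hm (MeasurableSet.univ_pi hs)]
  have : (fun p : (ι → ℝ) × (ι → ℝ) => S.piecewise p.1 p.2) ⁻¹' Set.univ.pi s =
      (Set.univ.pi fun i => if i ∈ S then s i else Set.univ) ×ˢ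
        (Set.univ.pi fun i => if i ∈ S then Set.univ else s i) := by
    ext p
    simp only [Set.mem_preimage, Set.mem_univ_pi, Set.mem_prod, ← forall_and]
    refine forall_congr' fun i => ?_
    by_cases hi : i ∈ S <;> simp [hi]
  rw [this, Measure.prod_prod, Measure.pi_pi, Measure.pi_pi, ← Finset.prod_mul_distrib]
  refine Finset.prod_congr rfl fun i _ => ?_
  by_cases hi : i ∈ S <;> simp [hi]

open Classical in
/-- If `B` does not depend on the coordinates in `S`, and the conditional probability of `A` given
the coordinates outside `S` is at most `ε` on `B`, then `A ∩ B` has probability at most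
`ε` times that of `B`. -/
theorem measure_inter_le_of_section (S : Set ι) {A B : Set (ι → ℝ)} (hA : MeasurableSet A)
    (hB : MeasurableSet B) {ε : ENNReal} (hBS : ∀ z y, S.piecewise z y ∈ B ↔ y ∈ B)
    (h : ∀ y ∈ B, Measure.pi (fun _ => μ) {z | S.piecewise z y ∈ A} ≤ ε) :
    Measure.pi (fun _ : ι => μ) (A ∩ B) ≤ ε * Measure.pi (fun _ : ι => μ) B := by
  have hmp := measurePreserving_piecewise μ S
  rw [← hmp.measure_preimage (hA.inter hB).nullMeasurableSet,
    Measure.prod_apply_symm (hmp.measurable (hA.inter hB)), ← lintegral_indicator_const hB]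
  refine lintegral_mono fun y => ?_
  by_cases hy : y ∈ B
  · rw [Set.indicator_of_mem hy]
    refine (measure_mono fun z hz => ?_).trans (h y hy)
    exact hz.1
  · rw [Set.indicator_of_notMem hy]
    have : (fun x => (x, y)) ⁻¹' ((fun p : (ι → ℝ) × (ι → ℝ) => S.piecewise p.1 p.2) ⁻¹' (A ∩ B))
        = ∅ := by
      ext z
      simp only [Set.mem_preimage, Set.mem_inter_iff, hBS, Set.mem_empty_iff_false, hy, and_false]
    rw [this, measure_empty]

open Classical in
theorem measure_le_of_section (S : Set ι) {A : Set (ι → ℝ)} (hA : MeasurableSet A)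
    {ε : ENNReal} (h : ∀ y, Measure.pi (fun _ => μ) {z | S.piecewise z y ∈ A} ≤ ε) :
    Measure.pi (fun _ : ι => μ) A ≤ ε := by
  have := measure_inter_le_of_section μ S hA .univ (by simp) fun y _ => h y
  simpa using this

/-- Small ball probabilities for triangular systems of affine forms. -/
theorem measure_triangular_le {Q : Type*} [Fintype Q] {δ : ℝ} {ε : ENNReal}
    (hμ : ∀ c, μ (Set.Icc (c - δ) (c + δ)) ≤ ε) {e : Q → ι} (he : Function.Injective e)
    (c : Q → ℝ) {k : ℕ} (q : ℕ → Q) (β : ℕ → Q → ℝ) {t : ℝ} (ht : 0 < t)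
    (hβ : ∀ i < k, t < |β i (q i)|) (hβ0 : ∀ i < k, ∀ l < i, β i (q l) = 0) :
    Measure.pi (fun _ : ι => μ)
      {z | ∀ i < k, |∑ x, (c x + z (e x)) * β i x| ≤ t * δ} ≤ ε ^ k := by
  classical
  -- The last j forms are treated first. The forms after the i-th do not involve the variable at `q
  -- i`, so prepending form i contributes one more factor `ε` by conditioning on all other
  -- variables.
  suffices H : ∀ j ≤ k, Measure.pi (fun _ : ι => μ)
      {z | ∀ i < k, k - j ≤ i → |∑ x, (c x + z (e x)) * β i x| ≤ t * δ} ≤ ε ^ j by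
    have := H k le_rfl
    simpa using this
  have hmeas : ∀ i, MeasurableSet {z : ι → ℝ | |∑ x, (c x + z (e x)) * β i x| ≤ t * δ} := by
    intro i
    refine (isClosed_le ?_ continuous_const).measurableSet
    fun_prop
  intro j
  induction j with
  | zero =>
    intro _
    exact prob_le_one.trans (by simp)
  | succ j ih =>
    intro hj
    set i₀ := k - (j + 1) with hi₀
    set B : Set (ι → ℝ) := {z | ∀ i < k, k - j ≤ i → |∑ x, (c x + z (e x)) * β i x| ≤ t * δ}
    set A : Set (ι → ℝ) := {z | |∑ x, (c x + z (e x)) * β i₀ x| ≤ t * δ}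
    have hB : MeasurableSet B := by
      have : B = ⋂ i, ⋂ (_ : i < k), ⋂ (_ : k - j ≤ i),
          {z : ι → ℝ | |∑ x, (c x + z (e x)) * β i x| ≤ t * δ} := by
        ext z; simp [B]
      rw [this]
      exact .iInter fun i => .iInter fun _ => .iInter fun _ => hmeas i
    have hAB : {z : ι → ℝ | ∀ i < k, i₀ ≤ i → |∑ x, (c x + z (e x)) * β i x| ≤ t * δ} ⊆ A ∩ B :=
      fun z hz => ⟨hz i₀ (by omega) le_rfl, fun i hi hji => hz i hi (by omega)⟩
    refine (measure_mono hAB).trans ?_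
    obtain ⟨S, hS⟩ : ∃ S : Set ι, ∀ i, i ∈ S ↔ i = e (q i₀) := ⟨{e (q i₀)}, fun i => by simp⟩
    refine (measure_inter_le_of_section μ S (hmeas i₀) hB (ε := ε) ?_ ?_).trans ?_
    · intro z y
      refine forall_congr' fun i => imp_congr_right fun hi => imp_congr_right fun hji => ?_
      have : ∑ x, (c x + S.piecewise z y (e x)) * β i x =
          ∑ x, (c x + y (e x)) * β i x := by
        refine Finset.sum_congr rfl fun x _ => ?_
        by_cases hx : x = q i₀
        · rw [hx, hβ0 i hi i₀ (by omega)]; simp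
        · rw [Set.piecewise_eq_of_notMem]
          simpa [hS] using fun h => hx (he h)
      rw [this]
    · intro y _
      set b := β i₀ (q i₀) with hb
      have hb0 : t < |b| := hβ i₀ (by omega)
      set R := ∑ x ∈ Finset.univ.erase (q i₀), (c x + y (e x)) * β i₀ x + c (q i₀) * b with hR
      have hbne : b ≠ 0 := by rintro h; rw [h, abs_zero] at hb0; linarith
      have hsub : {z | S.piecewise z y ∈ A} ⊆
          (fun z : ι → ℝ => z (e (q i₀))) ⁻¹' Set.Icc (-R / b - δ) (-R / b + δ) := by
        intro z hz
        have hz' : |∑ x, (c x + S.piecewise z y (e x)) * β i₀ x| ≤ t * δ := hz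
        have h1 : ∑ x, (c x + S.piecewise z y (e x)) * β i₀ x =
            z (e (q i₀)) * b + R := by
          rw [← Finset.add_sum_erase _ _ (Finset.mem_univ (q i₀)), hR,
            Finset.sum_congr rfl fun x hx => ?_]
          · rw [Set.piecewise_eq_of_mem _ _ _ (by simp [hS])]; ring
          · rw [Set.piecewise_eq_of_notMem]
            simpa [hS] using fun h => Finset.ne_of_mem_erase hx (he h)
        rw [h1, show z (e (q i₀)) * b + R = b * (z (e (q i₀)) - -R / b) by field_simp; ring,
          abs_mul] at hz'
        have h2 : |z (e (q i₀)) - -R / b| ≤ δ := by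
          by_contra hc
          push Not at hc
          nlinarith [abs_nonneg (z (e (q i₀)) - -R / b)]
        rw [abs_le] at h2
        constructor <;> linarith [h2.1, h2.2]
      refine (measure_mono hsub).trans ?_
      rw [(measurePreserving_eval (fun _ : ι => μ) (e (q i₀))).measure_preimage
        measurableSet_Icc.nullMeasurableSet]
      exact hμ _
    · rw [pow_succ']
      gcongr
      exact ih (by omega)

end Conditioning

/-- The density is at most 1/(2ρ), because 2π ≥ 4, and the interval has length 2δ. -/
theorem gaussianReal_Icc_le {ρ : ℝ} (hρ : 0 < ρ) (δ c : ℝ) :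
    gaussianReal 0 (ρ ^ 2).toNNReal (Set.Icc (c - δ) (c + δ)) ≤ ENNReal.ofReal (δ / ρ) := by
  have hv : (ρ ^ 2).toNNReal ≠ 0 := by
    simp [Real.toNNReal_eq_zero, hρ.ne']
  rw [gaussianReal_apply _ hv]
  have hpdf : ∀ x, gaussianPDF 0 (ρ ^ 2).toNNReal x ≤ ENNReal.ofReal (1 / (2 * ρ)) := by
    intro x
    refine ENNReal.ofReal_le_ofReal ?_
    rw [gaussianPDFReal]
    have h1 : Real.exp (-(x - 0) ^ 2 / (2 * ((ρ ^ 2).toNNReal : ℝ))) ≤ 1 := by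
      rw [Real.exp_le_one_iff]
      have : 0 ≤ (x - 0) ^ 2 / (2 * ((ρ ^ 2).toNNReal : ℝ)) := by positivity
      rw [neg_div]; linarith
    have h2 : 2 * ρ ≤ Real.sqrt (2 * Real.pi * ((ρ ^ 2).toNNReal : ℝ)) := by
      rw [Real.coe_toNNReal _ (by positivity)]
      refine Real.le_sqrt_of_sq_le ?_
      nlinarith [Real.pi_gt_three, sq_nonneg ρ]
    rw [one_div]
    calc _ ≤ (Real.sqrt (2 * Real.pi * ((ρ ^ 2).toNNReal : ℝ)))⁻¹ * 1 := by gcongr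
      _ ≤ _ := by rw [mul_one]; gcongr
  refine (lintegral_mono hpdf).trans ?_
  rw [setLIntegral_const, Real.volume_Icc, ← ENNReal.ofReal_mul (by positivity)]
  refine ENNReal.ofReal_le_ofReal (le_of_eq ?_)
  field_simp
  ring


/-! ### Echelon trees -/

section EchelonTree

open Function (update)

variable {d : ℕ} {Q : Type*}

/-- The multi-indices that agree with `p` from the position `j` on. -/
def indexFiber (j : ℕ) (p : Fin d → Q) : Set (Fin d → Q) := {f | ∀ a : Fin d, j ≤ a → f a = p a}

/-- The functions that vanish on `F`. -/
def vanishingOn {X : Type*} (F : Set X) : Submodule ℝ (X → ℝ) where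
  carrier := {v | ∀ f ∈ F, v f = 0}
  add_mem' ha hb f hf := by simp [ha f hf, hb f hf]
  zero_mem' _ _ := rfl
  smul_mem' c v hv f hf := by simp [hv f hf]

theorem mem_indexFiber {j : ℕ} {p f : Fin d → Q} :
    f ∈ indexFiber j p ↔ ∀ a : Fin d, j ≤ a → f a = p a := Iff.rfl

theorem vanishingOn_anti {X : Type*} {F F' : Set X} (h : F ⊆ F') :
    vanishingOn F' ≤ vanishingOn F := fun _ hv f hf => hv f (h hf)

/-- An echelon tree of height `j` and branching number `k` above the multi-index `p`, of tensors
in `V`: at each leaf there is a tensor whose largest entry is at this leaf, and which vanishes on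
all subtrees that precede the leaf. -/
def EchelonTree (k : ℕ) : ℕ → Submodule ℝ ((Fin d → Q) → ℝ) → (Fin d → Q) → Prop
  | 0, V, p => ∃ v ∈ V, v p = 1 ∧ ∀ f, |v f| ≤ 1
  | j + 1, V, p => ∃ (hj : j < d) (q : ℕ → Q), ∀ i < k,
      EchelonTree k j (V ⊓ vanishingOn (⋃ l < i, indexFiber j (update p ⟨j, hj⟩ (q l))))
        (update p ⟨j, hj⟩ (q i))

theorem indexFiber_congr {j : ℕ} {p p' : Fin d → Q} (h : ∀ a : Fin d, j ≤ a → p a = p' a) :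
    indexFiber j p = indexFiber j p' := by
  ext f
  exact forall_congr' fun a => imp_congr_right fun ha => by rw [h a ha]

theorem EchelonTree.congr {k j : ℕ} {V : Submodule ℝ ((Fin d → Q) → ℝ)} {p p' : Fin d → Q}
    (h : ∀ a : Fin d, j ≤ a → p a = p' a) (hT : EchelonTree k j V p) : EchelonTree k j V p' := by
  induction j generalizing V p p' with
  | zero => rwa [← funext fun a => h a (Nat.zero_le _)]
  | succ j ih =>
    obtain ⟨hj, q, hq⟩ := hT
    have key : ∀ x : Q, ∀ a : Fin d, j ≤ a → update p ⟨j, hj⟩ x a = update p' ⟨j, hj⟩ x a := by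
      intro x a ha
      by_cases hja : a = ⟨j, hj⟩
      · subst hja; simp
      · rw [Function.update_of_ne hja, Function.update_of_ne hja]
        exact h a (Nat.lt_of_le_of_ne ha fun h => hja (Fin.ext h.symm))
    refine ⟨hj, q, fun i hi => ?_⟩
    have := ih (key (q i)) (hq i hi)
    simp only [indexFiber_congr (key _)] at this
    exact this

theorem EchelonTree.mono {k j : ℕ} {V V' : Submodule ℝ ((Fin d → Q) → ℝ)} {p : Fin d → Q}
    (h : V ≤ V') (hT : EchelonTree k j V p) : EchelonTree k j V' p := by
  induction j generalizing V V' p with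
  | zero =>
    obtain ⟨v, hv, h1⟩ := hT
    exact ⟨v, h hv, h1⟩
  | succ j ih =>
    obtain ⟨hj, q, hq⟩ := hT
    exact ⟨hj, q, fun i hi => ih (inf_le_inf_right _ h) (hq i hi)⟩

/-- Restriction to F has rank at most |F|, and its kernel on V is the subspace of functions
vanishing on F. -/
theorem finrank_le_inf_vanishingOn {X : Type*} [Fintype X] (V : Submodule ℝ (X → ℝ))
    (F : Finset X) :
    Module.finrank ℝ V ≤ Module.finrank ℝ (V ⊓ vanishingOn (F : Set X) : Submodule ℝ (X → ℝ)) +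
      F.card := by
  classical
  let φ : V →ₗ[ℝ] (F → ℝ) := (LinearMap.funLeft ℝ ℝ (fun x : F => (x : X))).comp V.subtype
  have h1 := LinearMap.finrank_range_add_finrank_ker φ
  have h2 : Module.finrank ℝ (LinearMap.range φ) ≤ F.card := by
    refine (Submodule.finrank_le _).trans ?_
    simp
  have h3 : Module.finrank ℝ (LinearMap.ker φ) ≤
      Module.finrank ℝ (V ⊓ vanishingOn (F : Set X) : Submodule ℝ (X → ℝ)) := by
    let ψ : LinearMap.ker φ →ₗ[ℝ] (V ⊓ vanishingOn (F : Set X) : Submodule ℝ (X → ℝ)) :=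
      LinearMap.codRestrict _ (V.subtype.comp (LinearMap.ker φ).subtype) fun v =>
        ⟨v.1.2, fun f hf => congrFun (LinearMap.mem_ker.1 v.2) ⟨f, hf⟩⟩
    refine LinearMap.finrank_le_finrank_of_injective (f := ψ) fun v w h => ?_
    have h' := congrArg (fun x : (V ⊓ vanishingOn (F : Set X) : Submodule ℝ (X → ℝ)) => (x : X → ℝ)) h
    exact Subtype.ext (Subtype.ext h')
  omega

variable [Fintype Q]

theorem ncard_indexFiber_le (j : ℕ) (hj : j ≤ d) (p : Fin d → Q) :
    (indexFiber j p).ncard ≤ Fintype.card Q ^ j := by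
  have : Fintype.card Q ^ j = (Set.univ : Set (Fin j → Q)).ncard := by
    simp [Set.ncard_univ]
  rw [this]
  refine Set.ncard_le_ncard_of_injOn (fun f a => f (Fin.castLE hj a)) (fun _ _ => Set.mem_univ _) ?_
  intro f hf g hg h
  funext a
  by_cases ha : j ≤ a
  · rw [hf a ha, hg a ha]
  · exact congrFun h ⟨a, not_le.1 ha⟩

theorem finrank_le_inf_vanishingOn_iUnion (V : Submodule ℝ ((Fin d → Q) → ℝ)) {j : ℕ} (hj : j ≤ d)
    (p : ℕ → Fin d → Q) (t : ℕ) :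
    Module.finrank ℝ V ≤ Module.finrank ℝ
      (V ⊓ vanishingOn (⋃ l < t, indexFiber j (p l)) : Submodule ℝ ((Fin d → Q) → ℝ)) +
      t * Fintype.card Q ^ j := by
  classical
  set F : Finset (Fin d → Q) := (Finset.range t).biUnion fun l => (indexFiber j (p l)).toFinset
  have hF : (F : Set (Fin d → Q)) = ⋃ l < t, indexFiber j (p l) := by
    ext f; simp [F]
  have hc : F.card ≤ t * Fintype.card Q ^ j := by
    refine Finset.card_biUnion_le.trans ((Finset.sum_le_card_nsmul _ _ (Fintype.card Q ^ j)
      fun l _ => ?_).trans (by simp))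
    rw [← Set.ncard_eq_toFinset_card']
    exact ncard_indexFiber_le j hj _
  have := finrank_le_inf_vanishingOn V F
  rw [hF] at this
  omega

/-- A subspace of large dimension contains an echelon tree. -/
theorem exists_echelonTree (k : ℕ) {j : ℕ} (hj : j ≤ d) :
    ∀ V : Submodule ℝ ((Fin d → Q) → ℝ),
      1 + j * (k * Fintype.card Q ^ (d - 1)) ≤ Module.finrank ℝ V →
      ∃ p, EchelonTree k j V p := by
  induction j with
  | zero =>
    intro V hV
    have : Nontrivial V := Module.nontrivial_of_finrank_pos (R := ℝ) (by omega)
    obtain ⟨⟨v, hv⟩, hne⟩ := exists_ne (0 : V)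
    have hv0 : v ≠ 0 := fun h => hne (Subtype.ext h)
    obtain ⟨f₀, hf₀⟩ := Function.ne_iff.1 hv0
    have : Nonempty (Fin d → Q) := ⟨f₀⟩
    obtain ⟨p, hp⟩ := Finite.exists_max fun f => |v f|
    have hpos : 0 < |v p| := (abs_pos.2 hf₀).trans_le (hp f₀)
    have hpne : v p ≠ 0 := abs_pos.1 hpos
    refine ⟨p, (v p)⁻¹ • v, V.smul_mem _ hv, by simp [hpne], fun f => ?_⟩
    rw [Pi.smul_apply, smul_eq_mul, abs_mul, abs_inv, inv_mul_le_iff₀ hpos, mul_one]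
    exact hp f
  | succ j ih =>
    intro V hV
    have ih := ih (by omega)
    set n := Fintype.card Q with hn
    have hjd : j < d := hj
    obtain ⟨p₀, hp₀⟩ := ih V (by rw [add_mul] at hV; omega)
    -- Greedy choice of many trees of height j, each of whose tensors vanish on the fibres of all
    -- earlier trees. A fibre costs at most n^j dimensions, so the total loss stays within the
    -- k·n^{d-1} dimensions set aside for this level.
    have hseq : ∀ t ≤ k * n ^ (d - j - 1), ∃ p : ℕ → Fin d → Q, ∀ i < t,
        EchelonTree k j (V ⊓ vanishingOn (⋃ l < i, indexFiber j (p l))) (p i) := by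
      intro t
      induction t with
      | zero => exact fun _ => ⟨fun _ => p₀, fun i hi => by omega⟩
      | succ t iht =>
        intro ht
        obtain ⟨p, hp⟩ := iht (by omega)
        have h1 := finrank_le_inf_vanishingOn_iUnion V hjd.le p t
        rw [← hn] at h1
        have h2 : t * n ^ j ≤ k * n ^ (d - 1) := by
          rw [show d - 1 = (d - j - 1) + j by omega, pow_add, ← mul_assoc]
          exact Nat.mul_le_mul_right _ (by omega)
        obtain ⟨p', hp'⟩ := ih (V ⊓ vanishingOn (⋃ l < t, indexFiber j (p l))) (by
          rw [add_mul, one_mul] at hV; omega)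
        have hlt : ∀ i ≤ t, (⋃ l < i, indexFiber j (update p t p' l)) =
            ⋃ l < i, indexFiber j (p l) := fun i hi =>
          Set.iUnion₂_congr fun l hl => by rw [Function.update_of_ne (by omega)]
        refine ⟨update p t p', fun i hi => ?_⟩
        rw [hlt i (by omega)]
        by_cases hit : i = t
        · subst hit; simpa using hp'
        · rw [Function.update_of_ne hit]
          exact hp i (by omega)
    obtain ⟨p, hp⟩ := hseq _ le_rfl
    rcases Nat.eq_zero_or_pos k with rfl | hk
    · exact ⟨p₀, hjd, fun _ => p₀ ⟨j, hjd⟩, fun i hi => by omega⟩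
    classical
    let cls : (Fin d → Q) → (Fin (d - j - 1) → Q) := fun f a => f ⟨a + (j + 1), by omega⟩
    -- Pigeonhole on the coordinates after j: some k of these trees agree there and become the
    -- children of one node. Passing to a subsequence only drops vanishing conditions.
    obtain ⟨y, -, hy⟩ := Finset.exists_le_card_fiber_of_mul_le_card_of_maps_to
      (s := Finset.range (k * n ^ (d - j - 1))) (t := Finset.univ) (f := fun t => cls (p t)) (n := k)
      (fun _ _ => Finset.mem_univ _) ⟨cls p₀, Finset.mem_univ _⟩ (by simp [← hn, mul_comm])
    set s := (Finset.range (k * n ^ (d - j - 1))).filter fun t => cls (p t) = y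
    let g := s.orderEmbOfCardLe hy
    have hg : ∀ i, g i < k * n ^ (d - j - 1) ∧ cls (p (g i)) = y := fun i => by
      have := Finset.mem_filter.1 (s.orderEmbOfCardLe_mem hy i)
      exact ⟨Finset.mem_range.1 this.1, this.2⟩
    let idx : ℕ → ℕ := fun i => if h : i < k then g ⟨i, h⟩ else 0
    have hidx : ∀ i (h : i < k), idx i = g ⟨i, h⟩ := fun i h => dif_pos h
    set P := p (idx 0) with hP
    have hag : ∀ i < k, ∀ a : Fin d, j ≤ a →
        p (idx i) a = update P ⟨j, hjd⟩ (p (idx i) ⟨j, hjd⟩) a := by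
      intro i hi a ha
      by_cases haj : a = ⟨j, hjd⟩
      · subst haj; simp
      · rw [Function.update_of_ne haj, hP, hidx i hi, hidx 0 hk]
        have hja : j + 1 ≤ a := Nat.lt_of_le_of_ne ha fun h => haj (Fin.ext h.symm)
        have h1 := congrFun ((hg ⟨i, hi⟩).2.trans (hg ⟨0, hk⟩).2.symm)
          ⟨a - (j + 1), by have := a.2; omega⟩
        simp only [cls] at h1
        have h2 : (⟨(a : ℕ) - (j + 1) + (j + 1), by have := a.2; omega⟩ : Fin d) = a :=
          Fin.ext (by simp; omega)
        rwa [h2] at h1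
    refine ⟨P, hjd, fun i => p (idx i) ⟨j, hjd⟩, fun i hi => ?_⟩
    refine ((hp (idx i) ?_).mono ?_).congr (hag i hi)
    · rw [hidx i hi]; exact (hg _).1
    · refine inf_le_inf_left _ (vanishingOn_anti ?_)
      refine Set.iUnion₂_subset fun l hl => ?_
      rw [← indexFiber_congr (hag l (by omega))]
      refine Set.subset_biUnion_of_mem (u := fun l => indexFiber j (p l)) ?_
      show idx l < idx i
      rw [hidx i hi, hidx l (by omega)]
      exact g.strictMono hl

/-! ### Small ball probabilities for tensor products -/

variable {ι : Type*}

/-- The contraction of the part of the tensor `v` above `p` with the first `j` of the vectors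
`c a + z (e a)`. -/
noncomputable def contraction (c : Fin d → Q → ℝ) (e : Fin d → Q → ι) (j : ℕ) (p : Fin d → Q)
    (v : (Fin d → Q) → ℝ) (z : ι → ℝ) : ℝ :=
  open Classical in
  ∑ f ∈ Finset.univ.filter (· ∈ indexFiber j p),
    v f * ∏ a ∈ Finset.univ.filter (fun a : Fin d => (a : ℕ) < j), (c a (f a) + z (e a (f a)))

theorem contraction_zero (c : Fin d → Q → ℝ) (e : Fin d → Q → ι) (p : Fin d → Q)
    (v : (Fin d → Q) → ℝ) (z : ι → ℝ) : contraction c e 0 p v z = v p := by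
  classical
  rw [contraction, Finset.sum_eq_single p]
  · simp
  · intro f hf hne
    exact absurd (funext fun a => (Finset.mem_filter.1 hf).2 a (Nat.zero_le _)) hne
  · intro h
    exact absurd (Finset.mem_filter.2 ⟨Finset.mem_univ _, fun a _ => rfl⟩) h

theorem contraction_last (c : Fin d → Q → ℝ) (e : Fin d → Q → ι) (p : Fin d → Q)
    (v : (Fin d → Q) → ℝ) (z : ι → ℝ) : contraction c e d p v z =
      ∑ f, v f * ∏ a, (c a (f a) + z (e a (f a))) := by
  classical
  rw [contraction]
  have h1 : Finset.univ.filter (fun f => f ∈ indexFiber d p) = Finset.univ :=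
    Finset.filter_true_of_mem fun f _ a ha => absurd a.2 (not_lt.2 ha)
  have h2 : Finset.univ.filter (fun a : Fin d => (a : ℕ) < d) = Finset.univ :=
    Finset.filter_true_of_mem fun a _ => a.2
  rw [h1, h2]

theorem contraction_succ (c : Fin d → Q → ℝ) (e : Fin d → Q → ι) {j : ℕ} (hj : j < d)
    (p : Fin d → Q) (v : (Fin d → Q) → ℝ) (z : ι → ℝ) : contraction c e (j + 1) p v z =
      ∑ x, (c ⟨j, hj⟩ x + z (e ⟨j, hj⟩ x)) * contraction c e j (update p ⟨j, hj⟩ x) v z := by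
  classical
  rw [contraction, ← Finset.sum_fiberwise _ (fun f => f ⟨j, hj⟩)]
  refine Finset.sum_congr rfl fun x _ => ?_
  rw [contraction, Finset.mul_sum]
  have hset : (Finset.univ.filter (fun f => f ∈ indexFiber (j + 1) p)).filter
      (fun f => f ⟨j, hj⟩ = x) =
      Finset.univ.filter (fun f => f ∈ indexFiber j (update p ⟨j, hj⟩ x)) := by
    ext f
    simp only [Finset.mem_filter, Finset.mem_univ, true_and, mem_indexFiber]
    constructor
    · rintro ⟨h1, h2⟩ a ha
      by_cases haj : a = ⟨j, hj⟩
      · subst haj; simpa using h2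
      · rw [Function.update_of_ne haj]
        exact h1 a (Nat.lt_of_le_of_ne ha fun h => haj (Fin.ext h.symm))
    · intro h
      refine ⟨fun a ha => ?_, by simpa using h ⟨j, hj⟩ le_rfl⟩
      have := h a (by omega)
      rwa [Function.update_of_ne] at this
      rintro rfl
      simp at ha
  rw [hset]
  refine Finset.sum_congr rfl fun f hf => ?_
  have hfx : f ⟨j, hj⟩ = x := by
    simpa using (Finset.mem_filter.1 hf).2 ⟨j, hj⟩ le_rfl
  have hprod : Finset.univ.filter (fun a : Fin d => (a : ℕ) < j + 1) =
      insert ⟨j, hj⟩ (Finset.univ.filter fun a : Fin d => (a : ℕ) < j) := by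
    ext a
    simp [Fin.ext_iff]
    omega
  rw [hprod, Finset.prod_insert (by simp), hfx]
  ring

theorem continuous_contraction (c : Fin d → Q → ℝ) (e : Fin d → Q → ι) (j : ℕ)
    (p : Fin d → Q) (v : (Fin d → Q) → ℝ) : Continuous fun z => contraction c e j p v z := by
  unfold contraction
  fun_prop

/-- The event that all contractions of tensors in `V` with entries at most `1` are small. -/
def smallContraction (c : Fin d → Q → ℝ) (e : Fin d → Q → ι) (t : ℝ) (j : ℕ)
    (V : Submodule ℝ ((Fin d → Q) → ℝ)) (p : Fin d → Q) : Set (ι → ℝ) :=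
  {z | ∀ v ∈ V, (∀ f, |v f| ≤ 1) → |contraction c e j p v z| ≤ t}

theorem measurableSet_smallContraction [Finite ι] (c : Fin d → Q → ℝ) (e : Fin d → Q → ι) (t : ℝ)
    (j : ℕ) (V : Submodule ℝ ((Fin d → Q) → ℝ)) (p : Fin d → Q) :
    MeasurableSet (smallContraction c e t j V p) := by
  have : smallContraction c e t j V p = ⋂ v ∈ V, ⋂ (_ : ∀ f, |v f| ≤ 1),
      {z | |contraction c e j p v z| ≤ t} := by
    ext z; simp [smallContraction]
  rw [this]
  have : IsClosed (⋂ v ∈ V, ⋂ (_ : ∀ f, |v f| ≤ 1), {z | |contraction c e j p v z| ≤ t}) :=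
    isClosed_iInter fun v => isClosed_iInter fun _ => isClosed_iInter fun _ =>
      isClosed_le (continuous_contraction c e j p v).abs continuous_const
  have := Fintype.ofFinite ι
  exact IsClosed.measurableSet ‹_›

open Classical in
theorem contraction_piecewise {e : Fin d → Q → ι} {S : Set ι} {j : ℕ}
    (hS : ∀ a : Fin d, a < j → ∀ x, e a x ∉ S) (c : Fin d → Q → ℝ) (p : Fin d → Q)
    (v : (Fin d → Q) → ℝ) (z y : ι → ℝ) :
    contraction c e j p v (S.piecewise z y) = contraction c e j p v y := by
  unfold contraction
  refine Finset.sum_congr rfl fun f _ => ?_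
  congr 1
  refine Finset.prod_congr rfl fun a ha => ?_
  rw [Set.piecewise_eq_of_notMem _ _ _ (hS a (Finset.mem_filter.1 ha).2 _)]

/-- At a leaf the contraction is 1, above the threshold 1/2. At a node of height j + 1, unless one
of the k subtrees fails, each subtree i provides a tensor whose contraction over the coordinates
below j is large at the i-th child and zero at the earlier children. The contractions of these k
tensors at the node are then triangular affine forms in the j-th random vector, all small with
conditional probability at most ε^k. So the failure probabilities obey P_{j+1} ≤ k P_j + ε^k. -/
theorem measure_smallContraction_le [Fintype ι] (μ : Measure ℝ) [IsProbabilityMeasure μ] {δ : ℝ}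
    (hδ : 0 < δ) {ε : ENNReal} (hμ : ∀ c, μ (Set.Icc (c - δ) (c + δ)) ≤ ε) {e : Fin d → Q → ι}
    (he : Function.Injective (Function.uncurry e)) (c : Fin d → Q → ℝ) {k j : ℕ}
    {V : Submodule ℝ ((Fin d → Q) → ℝ)} {p : Fin d → Q} (hT : EchelonTree k j V p) :
    Measure.pi (fun _ : ι => μ) (smallContraction c e (δ ^ j / 2) j V p) ≤
      (j * (k + 1) ^ j : ℕ) * ε ^ k := by
  classical
  induction j generalizing V p with
  | zero =>
    obtain ⟨v, hv, h1, h2⟩ := hT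
    have : smallContraction c e (δ ^ 0 / 2) 0 V p = ∅ := by
      ext z
      simp only [Set.mem_empty_iff_false, iff_false]
      intro h
      have := h v hv h2
      rw [contraction_zero, h1] at this
      norm_num at this
    rw [this]; simp
  | succ j ih =>
    obtain ⟨hj, q, hq⟩ := hT
    set W : ℕ → Submodule ℝ ((Fin d → Q) → ℝ) := fun i =>
      V ⊓ vanishingOn (⋃ l < i, indexFiber j (update p ⟨j, hj⟩ (q l))) with hW
    set U : Set (ι → ℝ) := ⋃ i ∈ Finset.range k,
      smallContraction c e (δ ^ j / 2) j (W i) (update p ⟨j, hj⟩ (q i)) with hU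
    have hUm : MeasurableSet U := Finset.measurableSet_biUnion _ fun i _ =>
      measurableSet_smallContraction _ _ _ _ _ _
    set A := smallContraction c e (δ ^ (j + 1) / 2) (j + 1) V p
    -- Only the j-th vector is resampled. The contractions of height j, and with them the event U
    -- and the tensors chosen outside U, depend on the other coordinates alone.
    obtain ⟨S, hSdef⟩ : ∃ S : Set ι, S = Set.range (e ⟨j, hj⟩) := ⟨_, rfl⟩
    have hS : ∀ a : Fin d, a < j → ∀ x, e a x ∉ S := by
      rw [hSdef]
      rintro a ha x ⟨x', hx'⟩
      have := (Prod.ext_iff.1 (he (a₁ := (⟨j, hj⟩, x')) (a₂ := (a, x)) hx')).1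
      simp only at this
      subst this
      exact lt_irrefl _ ha
    have h1 : Measure.pi (fun _ : ι => μ) U ≤ k * ((j * (k + 1) ^ j : ℕ) * ε ^ k) := by
      refine (measure_biUnion_finset_le _ _).trans ?_
      refine (Finset.sum_le_card_nsmul _ _ _ fun i hi => ih (hq i (Finset.mem_range.1 hi))).trans ?_
      simp
    have h2 : Measure.pi (fun _ : ι => μ) (A ∩ Uᶜ) ≤ ε ^ k := by
      refine (measure_inter_le_of_section μ S
        (measurableSet_smallContraction _ _ _ _ _ _) hUm.compl (ε := ε ^ k) ?_ ?_).trans ?_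
      · intro z y
        simp only [hU, Set.mem_compl_iff, Set.mem_iUnion, smallContraction, Set.mem_ofPred_eq,
          contraction_piecewise hS]
      · intro y hy
        have hch : ∀ i : ℕ, ∃ v, i < k → v ∈ W i ∧ (∀ f, |v f| ≤ 1) ∧
            δ ^ j / 2 < |contraction c e j (update p ⟨j, hj⟩ (q i)) v y| := by
          intro i
          by_cases hi : i < k
          · simp only [hU, Set.mem_compl_iff, Set.mem_iUnion, not_exists, Finset.mem_range,
              smallContraction, Set.mem_ofPred_eq, not_forall, not_le] at hy
            obtain ⟨v, h1, h2, h3⟩ := hy i hi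
            exact ⟨v, fun _ => ⟨h1, h2, h3⟩⟩
          · exact ⟨0, fun h => absurd h hi⟩
        choose v hv using hch
        refine (measure_mono fun z hz => ?_).trans (measure_triangular_le μ hμ
          (e := e ⟨j, hj⟩) (fun x x' h => (Prod.ext_iff.1 (he (a₁ := (_, x)) (a₂ := (_, x')) h)).2)
          (c ⟨j, hj⟩) (k := k) q
          (fun i x => contraction c e j (update p ⟨j, hj⟩ x) (v i) y) (t := δ ^ j / 2)
          (by positivity) (fun i hi => (hv i hi).2.2) ?_)
        · intro i hi
          have := hz (v i) ((hv i hi).1.1) (hv i hi).2.1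
          rw [contraction_succ c e hj] at this
          simp only [contraction_piecewise hS] at this
          rw [show δ ^ j / 2 * δ = δ ^ (j + 1) / 2 by ring]
          refine le_of_eq_of_le (congrArg _ (Finset.sum_congr rfl fun x _ => ?_)) this
          rw [Set.piecewise_eq_of_mem _ _ _ (hSdef ▸ Set.mem_range_self x)]
        · intro i hi l hl
          refine Finset.sum_eq_zero fun f hf => ?_
          rw [(hv i hi).1.2 f (Set.mem_biUnion hl (Finset.mem_filter.1 hf).2), zero_mul]
      · calc _ ≤ ε ^ k * 1 := by gcongr; exact prob_le_one
          _ = _ := mul_one _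
    have hsub : A ⊆ U ∪ (A ∩ Uᶜ) := fun z hz => by
      by_cases h : z ∈ U
      · exact Or.inl h
      · exact Or.inr ⟨hz, h⟩
    have hnat : k * (j * (k + 1) ^ j) + 1 ≤ (j + 1) * (k + 1) ^ (j + 1) := by
      have : 1 ≤ (k + 1) ^ j := Nat.one_le_pow _ _ (by omega)
      have e : (j + 1) * (k + 1) ^ (j + 1) =
        k * (j * (k + 1) ^ j) + (j * (k + 1) ^ j + (k + 1) ^ (j + 1)) := by ring
      have h1 : 1 ≤ (k + 1) ^ (j + 1) := Nat.one_le_pow _ _ (by omega)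
      omega
    calc _ ≤ Measure.pi (fun _ : ι => μ) U + Measure.pi (fun _ : ι => μ) (A ∩ Uᶜ) :=
          (measure_mono hsub).trans (measure_union_le _ _)
      _ ≤ k * ((j * (k + 1) ^ j : ℕ) * ε ^ k) + ε ^ k := add_le_add h1 h2
      _ = (k * (j * (k + 1) ^ j) + 1 : ℕ) * ε ^ k := by push_cast; ring
      _ ≤ _ := by gcongr

end EchelonTree


/-! ### Leave-one-out distances of polarized minors -/

/-- The perturbed matrices. -/
noncomputable def perturbed {m n₁ n₂ : ℕ} (u : Fin m → MatSpace n₁ n₂)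
    (z : Fin m × (Fin n₁ × Fin n₂) → ℝ) (j : Fin m) : MatSpace n₁ n₂ :=
  u j + WithLp.toLp 2 fun p => z (j, p)

theorem perturbed_apply {m n₁ n₂ : ℕ} (u : Fin m → MatSpace n₁ n₂)
    (z : Fin m × (Fin n₁ × Fin n₂) → ℝ) (j : Fin m) (p : Fin n₁ × Fin n₂) :
    perturbed u z j p = u j p + z (j, p) := rfl

section LeaveOneOut

variable {d n₁ n₂ m h₁ h₂ : ℕ}

/-- The positions at which the term `f` of the minor for `J` contains the same random entry as the
diagonal term for `I`. -/
def agreeSet (I J : Fin d → Fin m) (f : Fin d → Fin d) : Finset (Fin d) :=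
  Finset.univ.filter fun a => J a = I a ∧ f a = a

theorem mem_agreeSet {I J : Fin d → Fin m} {f : Fin d → Fin d} {a : Fin d} :
    a ∈ agreeSet I J f ↔ J a = I a ∧ f a = a := by simp [agreeSet]

/-- Every pair other than (I, id) has a position a₀ outside its `agreeSet`. For fixed a₀ and f, the
sum over J factorizes into m for the position a₀ and at most n + m for each other position. -/
theorem sum_pow_card_agreeSet_le (I : Fin d → Fin m) {n : ℕ} (hn : 1 ≤ n) :
    ∑ P : {P : (Fin d → Fin m) × (Fin d → Fin d) // P ≠ (I, id)},
      n ^ (agreeSet I P.1.1 P.1.2).card ≤ d * d ^ d * (m * (n + m) ^ (d - 1)) := by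
  have h1 : ∀ P : {P : (Fin d → Fin m) × (Fin d → Fin d) // P ≠ (I, id)},
      n ^ (agreeSet I P.1.1 P.1.2).card ≤
        ∑ a₀, if a₀ ∉ agreeSet I P.1.1 P.1.2 then n ^ (agreeSet I P.1.1 P.1.2).card else 0 := by
    rintro ⟨⟨J, f⟩, hP⟩
    obtain ⟨a₀, ha₀⟩ : ∃ a₀, a₀ ∉ agreeSet I J f := by
      by_contra hcon
      push Not at hcon
      simp only [mem_agreeSet] at hcon
      exact hP (Prod.ext (funext fun a => (hcon a).1) (funext fun a => (hcon a).2))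
    refine le_trans ?_ (Finset.single_le_sum (f := fun a₀ =>
      if a₀ ∉ agreeSet I J f then n ^ (agreeSet I J f).card else 0)
      (fun _ _ => Nat.zero_le _) (Finset.mem_univ a₀))
    simp [ha₀]
  have h2 : ∀ (a₀ : Fin d) (f : Fin d → Fin d),
      (∑ J, if a₀ ∉ agreeSet I J f then n ^ (agreeSet I J f).card else 0) ≤
        m * (n + m) ^ (d - 1) := by
    intro a₀ f
    -- A product weight that dominates n to the power of the number of agreements, since a₀ is not
    -- one of them.
    let c : Fin d → Fin m → ℕ := fun a j => if a = a₀ then 1 else if j = I a then n else 1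
    have hc : ∀ J, (if a₀ ∉ agreeSet I J f then n ^ (agreeSet I J f).card else 0) ≤
        ∏ a, c a (J a) := by
      intro J
      split_ifs with h
      · exact Nat.zero_le _
      · calc n ^ (agreeSet I J f).card = ∏ a, if a ∈ agreeSet I J f then n else 1 := by
              rw [Finset.prod_ite_mem, Finset.univ_inter, Finset.prod_const]
          _ ≤ _ := Finset.prod_le_prod' fun a _ => by
              by_cases ha : a = a₀
              · subst ha; simp [c, h]
              · by_cases ha' : a ∈ agreeSet I J f
                · simp [c, ha, ha', (mem_agreeSet.1 ha').1]
                · simp only [c, ha, ha', if_false]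
                  split_ifs <;> omega
    calc _ ≤ ∑ J : Fin d → Fin m, ∏ a, c a (J a) := Finset.sum_le_sum fun J _ => hc J
      _ = ∏ a, ∑ j, c a j := by rw [Finset.prod_univ_sum, Fintype.piFinset_univ]
      _ = (∑ j, c a₀ j) * ∏ a ∈ Finset.univ.erase a₀, ∑ j, c a j :=
          (Finset.mul_prod_erase _ _ (Finset.mem_univ a₀)).symm
      _ ≤ m * ∏ a ∈ Finset.univ.erase a₀, (n + m) := by
          refine Nat.mul_le_mul (by simp [c]) (Finset.prod_le_prod' fun a ha => ?_)
          have : ∀ j, c a j ≤ (if j = I a then n else 0) + 1 := fun j => by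
            simp only [c, Finset.ne_of_mem_erase ha, if_false]
            split_ifs <;> omega
          refine (Finset.sum_le_sum fun j _ => this j).trans ?_
          simp [Finset.sum_add_distrib]
      _ = _ := by simp [Finset.card_erase_of_mem]
  calc _ ≤ ∑ P : {P : (Fin d → Fin m) × (Fin d → Fin d) // P ≠ (I, id)}, ∑ a₀,
        if a₀ ∉ agreeSet I P.1.1 P.1.2 then n ^ (agreeSet I P.1.1 P.1.2).card else 0 :=
        Finset.sum_le_sum fun P _ => h1 P
    _ ≤ ∑ P : (Fin d → Fin m) × (Fin d → Fin d), ∑ a₀,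
        if a₀ ∉ agreeSet I P.1 P.2 then n ^ (agreeSet I P.1 P.2).card else 0 := by
        rw [← Finset.sum_subtype (Finset.univ.filter (· ≠ (I, id))) (by simp)
          (fun P : (Fin d → Fin m) × (Fin d → Fin d) => ∑ a₀,
            if a₀ ∉ agreeSet I P.1 P.2 then n ^ (agreeSet I P.1 P.2).card else 0)]
        exact Finset.sum_le_sum_of_subset (Finset.filter_subset _ _)
    _ = ∑ a₀, ∑ f, ∑ J, if a₀ ∉ agreeSet I J f then n ^ (agreeSet I J f).card else 0 := by
        rw [Finset.sum_comm]
        refine Finset.sum_congr rfl fun a₀ _ => ?_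
        rw [Fintype.sum_prod_type, Finset.sum_comm]
    _ ≤ ∑ _a₀ : Fin d, ∑ _f : Fin d → Fin d, m * (n + m) ^ (d - 1) :=
        Finset.sum_le_sum fun a₀ _ => Finset.sum_le_sum fun f _ => h2 a₀ f
    _ = _ := by simp [mul_assoc]

/-- The product of the entries of the term `f` of a mixed minor that are not in `agreeSet I J f`. -/
noncomputable def offProd (row : Fin d → Fin h₁ → Fin n₁) (col : Fin d → Fin h₂ → Fin n₂)
    (w : Fin m → MatSpace n₁ n₂) (I J : Fin d → Fin m) (f : Fin d → Fin d)
    (g : Fin d → Fin h₁ × Fin h₂) : ℝ :=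
  ∏ a ∈ (agreeSet I J f)ᶜ, w (J a) (row a (g a).1, col (f a) (g (f a)).2)

/-- The linear conditions on a tensor to annihilate all terms but the diagonal term for `I`,
for all values of the entries of the latter. -/
noncomputable def annihilatorMatrix (row : Fin d → Fin h₁ → Fin n₁) (col : Fin d → Fin h₂ → Fin n₂)
    (w : Fin m → MatSpace n₁ n₂) (I : Fin d → Fin m) :
    Matrix (Σ P : {P : (Fin d → Fin m) × (Fin d → Fin d) // P ≠ (I, id)},
      ({a // a ∈ agreeSet I P.1.1 P.1.2} → Fin h₁ × Fin h₂)) (Fin d → Fin h₁ × Fin h₂) ℝ :=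
  fun k g => if (fun a : {a // a ∈ agreeSet I k.1.1.1 k.1.1.2} => g a) = k.2 then
    offProd row col w I k.1.1.1 k.1.1.2 g else 0

/-- Rank–nullity. A pair (J, f) contributes one condition for each choice of the indices at its
agreement positions, hence n^{|agreeSet|} conditions with n = h₁h₂. -/
theorem finrank_annihilator (row : Fin d → Fin h₁ → Fin n₁) (col : Fin d → Fin h₂ → Fin n₂)
    (w : Fin m → MatSpace n₁ n₂) (I : Fin d → Fin m) (hn : 1 ≤ h₁ * h₂) :
    (h₁ * h₂) ^ d ≤ Module.finrank ℝ (LinearMap.ker (annihilatorMatrix row col w I).mulVecLin) +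
      d * d ^ d * (m * (h₁ * h₂ + m) ^ (d - 1)) := by
  have h := LinearMap.finrank_range_add_finrank_ker (annihilatorMatrix row col w I).mulVecLin
  have hr : Module.finrank ℝ (LinearMap.range (annihilatorMatrix row col w I).mulVecLin) ≤
      d * d ^ d * (m * (h₁ * h₂ + m) ^ (d - 1)) := by
    refine (Submodule.finrank_le _).trans ((le_of_eq ?_).trans (sum_pow_card_agreeSet_le I hn))
    rw [Module.finrank_fintype_fun_eq_card, Fintype.card_sigma]
    simp
  rw [Module.finrank_fintype_fun_eq_card] at h
  simp only [Fintype.card_fun, Fintype.card_prod, Fintype.card_fin] at h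
  omega

/-- Group the sum by the indices at the agreement positions. Within a group the shared factors are
constant and come out, and what remains is a condition defining the annihilator. Thus v kills the
term for all values of the shared entries, and only the other entries of w and w' must match. -/
theorem sum_mul_term_eq_zero {row : Fin d → Fin h₁ → Fin n₁} {col : Fin d → Fin h₂ → Fin n₂}
    {w w' : Fin m → MatSpace n₁ n₂} {I J : Fin d → Fin m} {f : Fin d → Fin d}
    (hP : (J, f) ≠ (I, id)) {v : (Fin d → Fin h₁ × Fin h₂) → ℝ}
    (hv : v ∈ LinearMap.ker (annihilatorMatrix row col w' I).mulVecLin)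
    (hw : ∀ g, offProd row col w I J f g = offProd row col w' I J f g) :
    ∑ g, v g * ∏ a, w (J a) (row a (g a).1, col (f a) (g (f a)).2) = 0 := by
  set S := agreeSet I J f with hS
  rw [← Finset.sum_fiberwise _ fun (g : Fin d → Fin h₁ × Fin h₂) (a : {a // a ∈ S}) => g a]
  refine Finset.sum_eq_zero fun h _ => ?_
  have h0 := congrFun (LinearMap.mem_ker.1 hv) ⟨⟨(J, f), hP⟩, h⟩
  simp only [Matrix.mulVecLin_apply, Matrix.mulVec, dotProduct, annihilatorMatrix,
    Pi.zero_apply, ite_mul, zero_mul] at h0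
  rw [← Finset.sum_filter] at h0
  have : ∀ g ∈ Finset.univ.filter (fun g : Fin d → Fin h₁ × Fin h₂ =>
      (fun a : {a // a ∈ S} => g a) = h),
      v g * ∏ a, w (J a) (row a (g a).1, col (f a) (g (f a)).2) =
      (∏ a : {a // a ∈ S}, w (J a) (row a (h a).1, col a (h a).2)) *
        (offProd row col w' I J f g * v g) := by
    intro g hg
    rw [← Finset.prod_mul_prod_compl S, ← hw, offProd, ← Finset.prod_coe_sort S]
    have : ∏ i : {a // a ∈ S}, w (J i) (row i (g i).1, col (f i) (g (f i)).2) =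
        ∏ a : {a // a ∈ S}, w (J a) (row a (h a).1, col a (h a).2) := by
      refine Finset.prod_congr rfl fun a _ => ?_
      rw [(mem_agreeSet.1 a.2).2, ← congrFun (Finset.mem_filter.1 hg).2 a]
    rw [this]; ring
  rw [Finset.sum_congr rfl this, ← Finset.mul_sum, h0, mul_zero]

/-- The event that the polarized minors for `I`, at the positions given by `row` and `col`, are
close to a linear combination of those for the other multi-indices. -/
def nearDependent (row : Fin d → Fin h₁ → Fin n₁) (col : Fin d → Fin h₂ → Fin n₂)
    (u : Fin m → MatSpace n₁ n₂) (τ : ℝ) (I : Fin d → Fin m) :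
    Set (Fin m × (Fin n₁ × Fin n₂) → ℝ) :=
  {z | ∃ y : (Fin d → Fin m) → ℝ, y I = 1 ∧ ∀ g : Fin d → Fin h₁ × Fin h₂,
    |∑ J, y J * mixedMinor (fun a => perturbed u z (J a))
      (fun a => (row a (g a).1, col a (g a).2))| < τ}

/-- The strict inequality makes the event open, so the uncountable union over y causes no trouble.
-/
theorem measurableSet_nearDependent (row : Fin d → Fin h₁ → Fin n₁)
    (col : Fin d → Fin h₂ → Fin n₂) (u : Fin m → MatSpace n₁ n₂) (τ : ℝ) (I : Fin d → Fin m) :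
    MeasurableSet (nearDependent row col u τ I) := by
  have : nearDependent row col u τ I = ⋃ (y : (Fin d → Fin m) → ℝ) (_ : y I = 1),
      ⋂ g : Fin d → Fin h₁ × Fin h₂, {z | |∑ J, y J * mixedMinor (fun a => perturbed u z (J a))
        (fun a => (row a (g a).1, col a (g a).2))| < τ} := by
    ext z; simp [nearDependent]
  rw [this]
  refine IsOpen.measurableSet (isOpen_iUnion fun y => isOpen_iUnion fun _ =>
    isOpen_iInter_of_finite fun g => isOpen_lt ?_ continuous_const)
  simp only [mixedMinor, perturbed_apply]
  fun_prop

/-- Fix all entries that do not occur in the diagonal term for I. The annihilator V is then fixed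
and large, and pairing v ∈ V with any near dependency leaves the contraction of v with the diagonal
pure tensor, whatever the coefficients y. A near dependency thus makes all these contractions at
most h₁^d h₂^d τ ≤ δ^d/2, which an echelon tree in V makes improbable. -/
theorem measure_nearDependent_le (μ : Measure ℝ) [IsProbabilityMeasure μ] {δ : ℝ}
    (hδ : 0 < δ) {ε : ENNReal} (hμ : ∀ c, μ (Set.Icc (c - δ) (c + δ)) ≤ ε)
    {row : Fin d → Fin h₁ → Fin n₁} {col : Fin d → Fin h₂ → Fin n₂}
    (hrow : Function.Injective (Function.uncurry row))
    (hcol : Function.Injective (Function.uncurry col)) (u : Fin m → MatSpace n₁ n₂) {τ : ℝ}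
    (hτ : ((h₁ : ℝ) * h₂) ^ d * τ ≤ δ ^ d / 2) (I : Fin d → Fin m) {k : ℕ} (hn : 1 ≤ h₁ * h₂)
    (hdim : 1 + d * (k * (h₁ * h₂) ^ (d - 1)) + d * d ^ d * (m * (h₁ * h₂ + m) ^ (d - 1)) ≤
      (h₁ * h₂) ^ d) :
    Measure.pi (fun _ => μ) (nearDependent row col u τ I) ≤ (d * (k + 1) ^ d : ℕ) * ε ^ k := by
  classical
  set e : Fin d → Fin h₁ × Fin h₂ → Fin m × (Fin n₁ × Fin n₂) :=
    fun a q => (I a, (row a q.1, col a q.2)) with he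
  have hinj : Function.Injective (Function.uncurry e) := by
    rintro ⟨a, q⟩ ⟨a', q'⟩ h
    simp only [Function.uncurry_apply_pair, he, Prod.mk.injEq] at h
    have h1 := hrow (a₁ := (a, q.1)) (a₂ := (a', q'.1)) h.2.1
    have h2 := hcol (a₁ := (a, q.2)) (a₂ := (a', q'.2)) h.2.2
    simp only [Prod.mk.injEq] at h1 h2
    exact Prod.ext h1.1 (Prod.ext h1.2 h2.2)
  set c : Fin d → Fin h₁ × Fin h₂ → ℝ := fun a q => u (I a) (row a q.1, col a q.2) with hc
  obtain ⟨S, hS⟩ : ∃ S : Set (Fin m × (Fin n₁ × Fin n₂)), S = Set.range (Function.uncurry e) :=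
    ⟨_, rfl⟩
  refine measure_le_of_section μ S (measurableSet_nearDependent _ _ _ _ _) fun y₀ => ?_
  set V := LinearMap.ker (annihilatorMatrix row col (perturbed u y₀) I).mulVecLin with hV
  have hfin := finrank_annihilator row col (perturbed u y₀) I hn
  rw [← hV] at hfin
  obtain ⟨p, hp⟩ := exists_echelonTree k le_rfl V (by
    simp only [Fintype.card_prod, Fintype.card_fin]; omega)
  refine (measure_mono fun z hz => ?_).trans (measure_smallContraction_le μ hδ hμ hinj c hp)
  obtain ⟨y, hyI, hy⟩ := hz
  intro v hv hv1
  rw [contraction_last]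
  -- Blocks are disjoint, so an entry of the term (J, f) at position a can be a resampled one only
  -- if J a = I a and f a = a, that is, at an agreement position.
  have hoff : ∀ J f g, offProd row col (perturbed u (S.piecewise z y₀)) I J f g =
      offProd row col (perturbed u y₀) I J f g := by
    intro J f g
    refine Finset.prod_congr rfl fun a ha => ?_
    rw [perturbed_apply, perturbed_apply, Set.piecewise_eq_of_notMem]
    rw [hS]
    rintro ⟨⟨a', q⟩, h⟩
    simp only [Function.uncurry_apply_pair, he, Prod.mk.injEq] at h
    have h1 := hrow (a₁ := (a', q.1)) (a₂ := (a, (g a).1)) h.2.1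
    have h2 := hcol (a₁ := (a', q.2)) (a₂ := (f a, (g (f a)).2)) h.2.2
    simp only [Prod.mk.injEq] at h1 h2
    obtain ⟨rfl, -⟩ := h1
    exact (Finset.mem_compl.1 ha) (mem_agreeSet.2 ⟨h.1.symm, h2.1.symm⟩)
  have key : ∑ g, v g * ∑ J, y J * mixedMinor (fun a => perturbed u (S.piecewise z y₀) (J a))
      (fun a => (row a (g a).1, col a (g a).2)) =
      ∑ g, v g * ∏ a, (c a (g a) + z (e a (g a))) := by
    have e1 : ∀ g, v g * ∑ J, y J * mixedMinor (fun a => perturbed u (S.piecewise z y₀) (J a))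
        (fun a => (row a (g a).1, col a (g a).2)) =
        ∑ P : (Fin d → Fin m) × (Fin d → Fin d), y P.1 * fnSign P.2 * (v g * ∏ a,
          perturbed u (S.piecewise z y₀) (P.1 a) (row a (g a).1, col (P.2 a) (g (P.2 a)).2)) := by
      intro g
      rw [Fintype.sum_prod_type, Finset.mul_sum]
      refine Finset.sum_congr rfl fun J _ => ?_
      rw [mixedMinor, Finset.mul_sum, Finset.mul_sum]
      exact Finset.sum_congr rfl fun f _ => by ring
    rw [Finset.sum_congr rfl fun g _ => e1 g, Finset.sum_comm, Finset.sum_eq_single (I, id)]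
    · refine Finset.sum_congr rfl fun g _ => ?_
      simp only [hyI, fnSign_id, one_mul, id]
      congr 1
      refine Finset.prod_congr rfl fun a _ => ?_
      rw [perturbed_apply, Set.piecewise_eq_of_mem]
      rw [hS]
      exact ⟨(a, g a), rfl⟩
    · rintro ⟨J, f⟩ - hP
      rw [← Finset.mul_sum, sum_mul_term_eq_zero hP hv (hoff J f), mul_zero]
    · intro h; exact absurd (Finset.mem_univ _) h
  rw [← key]
  refine (Finset.abs_sum_le_sum_abs _ _).trans (le_trans ?_ hτ)
  calc _ ≤ ∑ _g : Fin d → Fin h₁ × Fin h₂, τ := Finset.sum_le_sum fun g _ => by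
        rw [abs_mul]
        calc _ ≤ 1 * τ := mul_le_mul (hv1 g) (hy g).le (abs_nonneg _) zero_le_one
          _ = τ := one_mul _
    _ = _ := by simp

end LeaveOneOut


/-! ### Quantitative independence of polarized minors -/

section Independence

variable {d n₁ n₂ m : ℕ}

theorem mixedMinor_zero (hd : 0 < d) (s : Fin d → Fin n₁ × Fin n₂) :
    mixedMinor (fun _ => 0) s = 0 := by
  refine Finset.sum_eq_zero fun f _ => ?_
  rw [Finset.prod_eq_zero (Finset.mem_univ ⟨0, hd⟩) (by simp), mul_zero]

/-- A relation with coefficients c gives a tensor power of c that all minors annihilate. Its entry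
at (i, …, i) is the d-th power of c i. -/
theorem linearIndependent_of_minors (hd : 0 < d) {w : Fin m → MatSpace n₁ n₂} {τ : ℝ} (hτ : 0 < τ)
    (hw : ∀ (I : Fin d → Fin m) (y : (Fin d → Fin m) → ℝ),
      τ ^ 2 * y I ^ 2 ≤ ∑ s, (∑ J, y J * mixedMinor (fun a => w (J a)) s) ^ 2) :
    LinearIndependent ℝ w := by
  rw [Fintype.linearIndependent_iff]
  intro c hc i
  have h := hw (fun _ => i) fun J => ∏ a, c (J a)
  simp only [← mixedMinor_sum (fun _ => c) w, hc, mixedMinor_zero hd] at h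
  simp only [Finset.prod_const, Finset.card_univ, Fintype.card_fin, ne_eq, OfNat.ofNat_ne_zero,
    not_false_eq_true, zero_pow] at h
  have h2 : (c i ^ d) ^ 2 ≤ 0 := by
    by_contra hcon
    push Not at hcon
    have : 0 < τ ^ 2 * (c i ^ d) ^ 2 := by positivity
    exact absurd (this.trans_le h) (by simp)
  have h3 : (c i ^ d) ^ 2 = 0 := le_antisymm h2 (sq_nonneg _)
  exact pow_eq_zero_iff hd.ne' |>.1 (pow_eq_zero_iff two_ne_zero |>.1 h3)

/-- Write b = Sw and w = Tb. Orthonormality makes the entries of T inner products, hence at most A,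
and T inverts S. A tensor y in the basis b becomes y' in w with the same minors, and y I is a sum of
m^d entries of y' with weights at most A^d. -/
theorem minors_of_orthonormal {w b : Fin m → MatSpace n₁ n₂} (hb : Orthonormal ℝ b)
    (hspan : Submodule.span ℝ (Set.range b) = Submodule.span ℝ (Set.range w)) {τ A : ℝ}
    (hτ : 0 < τ) (hA : ∀ j, ‖w j‖ ≤ A) (hA0 : 0 < A)
    (hw : ∀ (I : Fin d → Fin m) (y : (Fin d → Fin m) → ℝ),
      τ ^ 2 * y I ^ 2 ≤ ∑ s, (∑ J, y J * mixedMinor (fun a => w (J a)) s) ^ 2)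
    (I : Fin d → Fin m) (y : (Fin d → Fin m) → ℝ) :
    (τ / (m * A) ^ d) ^ 2 * y I ^ 2 ≤
      ∑ s, (∑ J, y J * mixedMinor (fun a => b (J a)) s) ^ 2 := by
  have hS : ∀ i, ∃ S : Fin m → ℝ, ∑ j, S j • w j = b i := fun i =>
    (Submodule.mem_span_range_iff_exists_fun ℝ).1 (hspan ▸ Submodule.subset_span ⟨i, rfl⟩)
  have hT : ∀ j, ∃ T : Fin m → ℝ, ∑ i, T i • b i = w j := fun j =>
    (Submodule.mem_span_range_iff_exists_fun ℝ).1 (hspan ▸ Submodule.subset_span ⟨j, rfl⟩)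
  choose S hS using hS
  choose T hT using hT
  have hTle : ∀ j i, |T j i| ≤ A := by
    intro j i
    have h1 : inner ℝ (b i) (w j) = T j i := by
      rw [← hT j]; exact hb.inner_right_fintype _ _
    rw [← h1]
    refine (abs_real_inner_le_norm _ _).trans ?_
    rw [hb.1 i, one_mul]; exact hA j
  have hST : ∀ k i, ∑ j, S k j * T j i = if k = i then 1 else 0 := by
    intro k i
    have h1 : ∑ l, (∑ j, S k j * T j l) • b l = b k := by
      rw [← hS k]
      simp_rw [← hT, Finset.smul_sum, Finset.sum_smul, smul_smul]
      exact Finset.sum_comm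
    have h2 : inner ℝ (b i) (∑ l, (∑ j, S k j * T j l) • b l) = ∑ j, S k j * T j i :=
      hb.inner_right_fintype _ _
    rw [← h2, h1, orthonormal_iff_ite.1 hb i k]
    simp [eq_comm]
  set X := ∑ s, (∑ J, y J * mixedMinor (fun a => b (J a)) s) ^ 2 with hX
  have hX0 : 0 ≤ X := Finset.sum_nonneg fun _ _ => sq_nonneg _
  set y' : (Fin d → Fin m) → ℝ := fun J' => ∑ J, y J * ∏ a, S (J a) (J' a) with hy'
  have e1 : ∀ s, ∑ J', y' J' * mixedMinor (fun a => w (J' a)) s =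
      ∑ J, y J * mixedMinor (fun a => b (J a)) s := by
    intro s
    simp only [hy', Finset.sum_mul, ← hS]
    rw [Finset.sum_comm]
    refine Finset.sum_congr rfl fun J _ => ?_
    rw [mixedMinor_sum (fun a => S (J a)), Finset.mul_sum]
    exact Finset.sum_congr rfl fun J' _ => by ring
  have e2 : y I = ∑ J', y' J' * ∏ a, T (J' a) (I a) := by
    simp only [hy', Finset.sum_mul]
    rw [Finset.sum_comm]
    have : ∀ J : Fin d → Fin m, ∑ J' : Fin d → Fin m, y J * (∏ a, S (J a) (J' a)) * ∏ a, T (J' a) (I a) =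
        if J = I then y J else 0 := by
      intro J
      calc _ = y J * ∑ J' : Fin d → Fin m, ∏ a, S (J a) (J' a) * T (J' a) (I a) := by
            rw [Finset.mul_sum]
            exact Finset.sum_congr rfl fun J' _ => by rw [Finset.prod_mul_distrib]; ring
        _ = y J * ∏ a, ∑ j, S (J a) j * T j (I a) := by
            rw [Finset.prod_univ_sum, Fintype.piFinset_univ]
        _ = _ := by
            simp only [hST]
            split_ifs with h
            · simp [h]
            · obtain ⟨a, ha⟩ := Function.ne_iff.1 h
              rw [Finset.prod_eq_zero (Finset.mem_univ a) (by simp [ha]), mul_zero]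
    rw [Finset.sum_congr rfl fun J _ => this J]
    simp
  have h3 : ∀ J', |y' J'| ≤ Real.sqrt X / τ := by
    intro J'
    rw [le_div_iff₀ hτ]
    refine Real.le_sqrt_of_sq_le ?_
    have := hw J' y'
    simp only [e1] at this
    calc _ = τ ^ 2 * y' J' ^ 2 := by rw [mul_pow, sq_abs]; ring
      _ ≤ X := this
  have h4 : |y I| ≤ (m * A) ^ d * (Real.sqrt X / τ) := by
    rw [e2]
    refine (Finset.abs_sum_le_sum_abs _ _).trans ?_
    calc _ ≤ ∑ _J' : Fin d → Fin m, Real.sqrt X / τ * A ^ d := by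
          refine Finset.sum_le_sum fun J' _ => ?_
          rw [abs_mul, Finset.abs_prod]
          refine mul_le_mul (h3 J') ?_ (Finset.prod_nonneg fun _ _ => abs_nonneg _)
            ((abs_nonneg _).trans (h3 J'))
          refine (Finset.prod_le_prod (fun _ _ => abs_nonneg _) fun a _ => hTle _ _).trans ?_
          simp
      _ = _ := by simp [mul_pow]; ring
  -- For m = 0 the factor (m A)^d cannot be divided out: the left side is then zero if d > 0, and
  -- for d = 0 the power equals 1.
  rcases Nat.eq_zero_or_pos m with hm | hm
  · subst hm
    have : (τ / ((0 : ℕ) * A) ^ d) ^ 2 * y I ^ 2 ≤ X := by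
      rcases Nat.eq_zero_or_pos d with hd | hd
      · subst hd
        have := sq_le_sq' (by have := abs_nonneg (y I); linarith [h4, this]) h4
        rw [sq_abs, pow_zero, one_mul, div_pow, Real.sq_sqrt hX0, le_div_iff₀ (by positivity)] at this
        simp only [pow_zero, div_one]; linarith
      · simp [zero_pow hd.ne', hX0]
    exact this
  · have hmA : 0 < ((m : ℝ) * A) ^ d := by positivity
    have := pow_le_pow_left₀ (abs_nonneg _) h4 2
    rw [sq_abs, mul_pow, div_pow, Real.sq_sqrt hX0] at this
    rw [div_pow, div_mul_eq_mul_div, div_le_iff₀ (by positivity)]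
    calc _ ≤ τ ^ 2 * ((((m : ℝ) * A) ^ d) ^ 2 * (X / τ ^ 2)) := by gcongr
      _ = _ := by field_simp

end Independence

/-! ### Gaussian tails -/

/-- The Chernoff bound on each side, with the optimal parameter t/ρ. -/
theorem gaussianReal_abs_ge_le {ρ : ℝ} (hρ : 0 < ρ) {t : ℝ} (ht : 0 ≤ t) :
    gaussianReal 0 (ρ ^ 2).toNNReal {x | ρ * t ≤ |x|} ≤
      ENNReal.ofReal (2 * Real.exp (-t ^ 2 / 2)) := by
  set μ := gaussianReal 0 (ρ ^ 2).toNNReal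
  have hv : (((ρ ^ 2).toNNReal : NNReal) : ℝ) = ρ ^ 2 := Real.coe_toNNReal _ (by positivity)
  have h1 : μ.real {x | ρ * t ≤ x} ≤ Real.exp (-t ^ 2 / 2) := by
    refine (measure_ge_le_exp_mul_mgf (X := fun x => x) (ρ * t) (t := t / ρ) (by positivity)
      (integrable_exp_mul_gaussianReal _)).trans (le_of_eq ?_)
    rw [mgf_gaussianReal (μ := 0) (v := (ρ ^ 2).toNNReal) (by simp), hv, ← Real.exp_add]
    congr 1
    field_simp
    ring
  have h2 : μ.real {x | x ≤ -(ρ * t)} ≤ Real.exp (-t ^ 2 / 2) := by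
    refine (measure_le_le_exp_mul_mgf (X := fun x => x) (-(ρ * t)) (t := -(t / ρ))
      (by rw [neg_nonpos]; positivity) (integrable_exp_mul_gaussianReal _)).trans (le_of_eq ?_)
    rw [mgf_gaussianReal (μ := 0) (v := (ρ ^ 2).toNNReal) (by simp), hv, ← Real.exp_add]
    congr 1
    field_simp
    ring
  have hsub : {x : ℝ | ρ * t ≤ |x|} ⊆ {x | ρ * t ≤ x} ∪ {x | x ≤ -(ρ * t)} := by
    intro x hx
    rcases le_abs.1 (show ρ * t ≤ |x| from hx) with h | h
    · exact Or.inl h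
    · exact Or.inr (by simp only [Set.mem_ofPred_eq]; linarith)
  calc _ ≤ μ ({x | ρ * t ≤ x} ∪ {x | x ≤ -(ρ * t)}) := measure_mono hsub
    _ ≤ μ {x | ρ * t ≤ x} + μ {x | x ≤ -(ρ * t)} := measure_union_le _ _
    _ = ENNReal.ofReal (μ.real {x | ρ * t ≤ x}) + ENNReal.ofReal (μ.real {x | x ≤ -(ρ * t)}) := by
        simp
    _ ≤ ENNReal.ofReal (Real.exp (-t ^ 2 / 2)) + ENNReal.ofReal (Real.exp (-t ^ 2 / 2)) := by
        gcongr
    _ = _ := by rw [← ENNReal.ofReal_add (by positivity) (by positivity), two_mul]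

theorem gaussianNoise_exists_abs_ge_le {m n₁ n₂ : ℕ} {ρ : ℝ} (hρ : 0 < ρ) {t : ℝ} (ht : 0 ≤ t) :
    gaussianNoise m n₁ n₂ ρ {z | ∃ i, ρ * t ≤ |z i|} ≤
      ENNReal.ofReal (m * (n₁ * n₂) * (2 * Real.exp (-t ^ 2 / 2))) := by
  have : {z : Fin m × (Fin n₁ × Fin n₂) → ℝ | ∃ i, ρ * t ≤ |z i|} =
      ⋃ i, Function.eval i ⁻¹' {x | ρ * t ≤ |x|} := by ext; simp
  rw [this, gaussianNoise]
  refine (measure_iUnion_fintype_le _ _).trans ?_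
  have h1 : ∀ i : Fin m × (Fin n₁ × Fin n₂),
      (Measure.pi fun _ : Fin m × (Fin n₁ × Fin n₂) => gaussianReal 0 (ρ ^ 2).toNNReal)
        (Function.eval i ⁻¹' {x | ρ * t ≤ |x|}) ≤ ENNReal.ofReal (2 * Real.exp (-t ^ 2 / 2)) := by
    intro i
    rw [(measurePreserving_eval (fun _ : Fin m × (Fin n₁ × Fin n₂) =>
      gaussianReal 0 (ρ ^ 2).toNNReal) i).measure_preimage
        (measurableSet_le measurable_const (by fun_prop)).nullMeasurableSet]
    exact gaussianReal_abs_ge_le hρ ht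
  refine (Finset.sum_le_card_nsmul _ _ _ fun i _ => h1 i).trans (le_of_eq ?_)
  rw [nsmul_eq_mul, ← ENNReal.ofReal_natCast, ← ENNReal.ofReal_mul (by positivity)]
  simp

theorem norm_perturbed_le {m n₁ n₂ : ℕ} {u : Fin m → MatSpace n₁ n₂} {j : Fin m}
    (hu : ‖u j‖ ≤ 1) {z : Fin m × (Fin n₁ × Fin n₂) → ℝ} {t : ℝ} (ht : 0 ≤ t)
    (hz : ∀ i, |z i| ≤ t) : ‖perturbed u z j‖ ≤ 1 + n₁ * n₂ * t := by
  refine (norm_add_le _ _).trans (add_le_add hu ?_)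
  rw [EuclideanSpace.norm_eq]
  refine Real.sqrt_le_iff.2 ⟨by positivity, ?_⟩
  calc _ ≤ ∑ _p : Fin n₁ × Fin n₂, t ^ 2 := Finset.sum_le_sum fun p _ => by
        simpa using sq_le_sq.2 ((hz (j, p)).trans (le_abs_self _))
    _ = ((n₁ * n₂ : ℕ) : ℝ) * t ^ 2 := by simp
    _ ≤ ((n₁ * n₂ : ℕ) : ℝ) ^ 2 * t ^ 2 := by
        gcongr
        exact_mod_cast Nat.le_self_pow two_ne_zero _
    _ = _ := by push_cast; ring

theorem finrank_perturbedSpan {m n₁ n₂ : ℕ} {u : Fin m → MatSpace n₁ n₂}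
    {z : Fin m × (Fin n₁ × Fin n₂) → ℝ} (h : LinearIndependent ℝ (perturbed u z)) :
    Module.finrank ℝ (perturbedSpan u z) = m := by
  have := finrank_span_eq_card h
  rwa [Fintype.card_fin] at this

/-- Normalize the coefficient at I to 1. A single large minor then already bounds the sum of squares
from below. -/
theorem sq_le_of_notMem_nearDependent {d n₁ n₂ m h₁ h₂ : ℕ} {row : Fin d → Fin h₁ → Fin n₁}
    {col : Fin d → Fin h₂ → Fin n₂} {u : Fin m → MatSpace n₁ n₂} {τ : ℝ} (hτ : 0 ≤ τ)
    {I : Fin d → Fin m} {z : Fin m × (Fin n₁ × Fin n₂) → ℝ}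
    (hz : z ∉ nearDependent row col u τ I) (y : (Fin d → Fin m) → ℝ) :
    τ ^ 2 * y I ^ 2 ≤ ∑ s, (∑ J, y J * mixedMinor (fun a => perturbed u z (J a)) s) ^ 2 := by
  by_cases hy : y I = 0
  · rw [hy]; simpa using Finset.sum_nonneg fun _ _ => sq_nonneg _
  have : ∃ g : Fin d → Fin h₁ × Fin h₂, τ ≤ |∑ J, (y J / y I) * mixedMinor
      (fun a => perturbed u z (J a)) (fun a => (row a (g a).1, col a (g a).2))| := by
    by_contra hcon
    push Not at hcon
    exact hz ⟨fun J => y J / y I, div_self hy, hcon⟩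
  obtain ⟨g, hg⟩ := this
  refine le_trans ?_ (Finset.single_le_sum (f := fun s =>
    (∑ J, y J * mixedMinor (fun a => perturbed u z (J a)) s) ^ 2) (fun _ _ => sq_nonneg _)
    (Finset.mem_univ fun a => (row a (g a).1, col a (g a).2)))
  simp only [div_mul_eq_mul_div, ← Finset.sum_div] at hg
  have h2 := pow_le_pow_left₀ hτ hg 2
  rw [sq_abs, div_pow, le_div_iff₀ (by positivity)] at h2
  exact h2


/-! ### The Gram matrix of the minors, on a real RAM -/

/-- The digit `a` of `x` in base `b`. -/
def natDigit (x b a : ℕ) : ℕ := x / b ^ a % b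

/-- The sign of the function with the digits of `t` as its values. -/
noncomputable def natSign (d t : ℕ) : ℝ :=
  ∏ a ∈ Finset.range d, ∏ b ∈ Finset.range a,
    if natDigit t d b < natDigit t d a then 1 else if natDigit t d a < natDigit t d b then -1 else 0

/-- The address of an entry of a minor. -/
def minorAddr (n₁ n₂ m d J s t a : ℕ) : ℕ :=
  natDigit J m a * (n₁ * n₂) + (natDigit s (n₁ * n₂) a / n₂ * n₂ +
    natDigit (natDigit s (n₁ * n₂) (natDigit t d a)) n₂ 0)

/-- A mixed minor, computed from the memory. -/
noncomputable def memMinor (mem : ℕ → ℝ) (n₁ n₂ m d J s : ℕ) : ℝ :=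
  ∑ t ∈ Finset.range (d ^ d), natSign d t * ∏ a ∈ Finset.range d,
    mem (minorAddr n₁ n₂ m d J s t a)

/-- An entry of the Gram matrix, computed from the memory. -/
noncomputable def memGram (mem : ℕ → ℝ) (n₁ n₂ m d i j : ℕ) : ℝ :=
  ∑ s ∈ Finset.range ((n₁ * n₂) ^ d), memMinor mem n₁ n₂ m d i s * memMinor mem n₁ n₂ m d j s

theorem natSign_eq {d : ℕ} (t : Fin (d ^ d)) : natSign d t = fnSign (finFunctionFinEquiv.symm t) := by
  rw [natSign, fnSign, Finset.prod_range]
  refine Finset.prod_congr rfl fun a _ => ?_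
  refine Finset.prod_bij' (fun b hb => (⟨b, (Finset.mem_range.1 hb).trans a.2⟩ : Fin d))
    (fun b _ => (b : ℕ)) (fun b hb => ?_) (fun b hb => ?_) (fun _ _ => rfl) (fun _ _ => rfl)
    fun b hb => ?_
  · exact Finset.mem_Iio.2 (Fin.lt_def.2 (Finset.mem_range.1 hb))
  · exact Finset.mem_range.2 (Fin.lt_def.1 (Finset.mem_Iio.1 hb))
  · simp only [Fin.lt_def, finFunctionFinEquiv_symm_apply_val]
    rfl

/-- Digits decode multi-indices in the same way as `finFunctionFinEquiv`, and quotient and remainder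
by n₂ as `finProdFinEquiv`. This turns the numerical loops into sums over function types. -/
theorem minorAddr_eq {n₁ n₂ m d : ℕ} (J : Fin (m ^ d)) (s : Fin ((n₁ * n₂) ^ d)) (t : Fin (d ^ d))
    (a : Fin d) : minorAddr n₁ n₂ m d J s t a = finProdFinEquiv (finFunctionFinEquiv.symm J a,
      finProdFinEquiv ((finProdFinEquiv.symm (finFunctionFinEquiv.symm s a)).1,
        (finProdFinEquiv.symm (finFunctionFinEquiv.symm s (finFunctionFinEquiv.symm t a))).2)) := by
  simp only [finProdFinEquiv_symm_apply, finProdFinEquiv_apply_val, Fin.coe_divNat, Fin.coe_modNat,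
    finFunctionFinEquiv_symm_apply_val, minorAddr, natDigit, pow_zero, Nat.div_one]
  ring

theorem minorAddr_lt {n₁ n₂ m d J s t a : ℕ} (hJ : J < m ^ d) (hs : s < (n₁ * n₂) ^ d)
    (ht : t < d ^ d) (ha : a < d) : minorAddr n₁ n₂ m d J s t a < m * (n₁ * n₂) := by
  rw [minorAddr_eq ⟨J, hJ⟩ ⟨s, hs⟩ ⟨t, ht⟩ ⟨a, ha⟩]
  exact Fin.is_lt _

/-- The input vectors in the memory. -/
theorem inputState_real {n₁ n₂ r m : ℕ} (b : Fin m → MatSpace n₁ n₂) (j : Fin m)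
    (p : Fin n₁ × Fin n₂) :
    (inputState n₁ n₂ r m b).real (finProdFinEquiv (j, finProdFinEquiv p)) = b j p := by
  simp only [inputState, dif_pos (Fin.is_lt _), Fin.eta, Equiv.symm_apply_apply]

theorem memMinor_input {n₁ n₂ r m d : ℕ} (b : Fin m → MatSpace n₁ n₂) (J : Fin (m ^ d))
    (s : Fin ((n₁ * n₂) ^ d)) :
    memMinor (inputState n₁ n₂ r m b).real n₁ n₂ m d J s =
      mixedMinor (fun a => b (finFunctionFinEquiv.symm J a))
        (fun a => finProdFinEquiv.symm (finFunctionFinEquiv.symm s a)) := by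
  rw [memMinor, mixedMinor, Finset.sum_range]
  refine Fintype.sum_equiv finFunctionFinEquiv.symm _ _ fun t => ?_
  rw [natSign_eq, Finset.prod_range]
  congr 1
  refine Finset.prod_congr rfl fun a _ => ?_
  rw [minorAddr_eq, inputState_real]

theorem memGram_input {n₁ n₂ r m d : ℕ} (b : Fin m → MatSpace n₁ n₂) (i j : Fin (m ^ d)) :
    memGram (inputState n₁ n₂ r m b).real n₁ n₂ m d i j =
      ∑ s : Fin d → Fin n₁ × Fin n₂, mixedMinor (fun a => b (finFunctionFinEquiv.symm i a)) s *
        mixedMinor (fun a => b (finFunctionFinEquiv.symm j a)) s := by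
  rw [memGram, Finset.sum_range]
  refine Fintype.sum_equiv (finFunctionFinEquiv.symm.trans
    (Equiv.arrowCongr (Equiv.refl _) finProdFinEquiv.symm)) _ _ fun s => ?_
  rw [memMinor_input, memMinor_input]
  rfl

/-! ### Expressions for the Gram matrix and their size bounds -/

namespace RealRAM

open Function (update)

/-- The constants `n₁, n₂, r, m` and the numbers computed from them, as integer variables. -/
structure Layout (n₁ n₂ d m : ℕ) (env : ℕ → ℕ) : Prop where
  v1 : env 1 = n₂
  v3 : env 3 = m
  v4 : env 4 = m * (n₁ * n₂) + ((m ^ d + 1) * m ^ d * m ^ d + 3)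
  v5 : env 5 = n₁ * n₂
  v6 : env 6 = d
  v7 : env 7 = m ^ d
  v8 : env 8 = (n₁ * n₂) ^ d
  v9 : env 9 = d ^ d
  v10 : env 10 = m * (n₁ * n₂)

theorem Layout.update {n₁ n₂ d m : ℕ} {env : ℕ → ℕ} (h : Layout n₁ n₂ d m env) {x : ℕ}
    (hx : 10 < x) (k : ℕ) : Layout n₁ n₂ d m (update env x k) := by
  constructor <;> rw [Function.update_of_ne (by omega)]
  exacts [h.v1, h.v3, h.v4, h.v5, h.v6, h.v7, h.v8, h.v9, h.v10]

/-- All numbers that occur in the computation are at most `B`. -/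
structure SizeBound (n₁ n₂ d m B : ℕ) : Prop where
  bn₂ : n₂ ≤ B
  bm : m ≤ B
  bd : d ≤ B
  bn : n₁ * n₂ ≤ B
  bmd : (m ^ d + 1) * m ^ d ≤ B
  bnd : (n₁ * n₂) ^ d ≤ B
  bdd : d ^ d ≤ B
  bd3 : 3 * d ≤ B

namespace NExpr

/-- The expression for `natDigit`. -/
def digit (x b a : NExpr) : NExpr :=
  sub (div x (pow b a)) (mul b (div (div x (pow b a)) b))

theorem digit_eval (x b a : NExpr) (env : ℕ → ℕ) :
    (digit x b a).eval env = natDigit (x.eval env) (b.eval env) (a.eval env) := by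
  simp only [digit, eval, natDigit, Nat.mod_def]

theorem natDigit_le (x b a : ℕ) : natDigit x b a ≤ x :=
  (Nat.mod_le _ _).trans (Nat.div_le_self _ _)

theorem digit_bd {x b a : NExpr} {B : ℕ} {env : ℕ → ℕ} (hx : x.Bd B env) (hb : b.Bd B env)
    (ha : a.Bd B env) (hx' : x.eval env ≤ B) (hb' : b.eval env ≤ B) (ha' : a.eval env ≤ B) :
    (digit x b a).Bd B env :=
  ⟨⟨hx, ⟨hb, ha, hb', ha'⟩, hx'⟩, hb, ⟨⟨hx, ⟨hb, ha, hb', ha'⟩, hx'⟩, hb,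
    (Nat.div_le_self _ _).trans hx'⟩, (Nat.div_le_self _ _).trans ((Nat.div_le_self _ _).trans hx')⟩

/-- The expression for `minorAddr`. The minor has the variables `v` and `15` as its indices, and
`17` and `19` for the function and the row. -/
def minorAddr (v : ℕ) : NExpr :=
  add (mul (digit (var v) (var 3) (var 19)) (var 5))
    (add (mul (div (digit (var 15) (var 5) (var 19)) (var 1)) (var 1))
      (digit (digit (var 15) (var 5) (digit (var 17) (var 6) (var 19))) (var 1) (const 0)))

/-- The address of an entry of the layer `t`. -/
def layerAddr (t i j : NExpr) : NExpr :=
  add (var 10) (add (mul (add (mul t (var 7)) i) (var 7)) j)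

end NExpr

namespace RExpr

open NExpr (var digit)

/-- The expression for `memMinor`. -/
def minor (v : ℕ) : RExpr :=
  sum 17 (var 9) (mul
    (prod 19 (var 6) (prod 21 (var 19)
      (ite (digit (var 17) (var 6) (var 21)) (digit (var 17) (var 6) (var 19)) (const 1)
        (ite (digit (var 17) (var 6) (var 19)) (digit (var 17) (var 6) (var 21))
          (const (-1)) (const 0)))))
    (prod 19 (var 6) (cell (NExpr.minorAddr v))))

/-- The expression for `memGram`. -/
def gram : RExpr := sum 15 (var 8) (mul (minor 11) (minor 13))

variable {n₁ n₂ m d B : ℕ} {env : ℕ → ℕ}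

theorem minor_eval (h : Layout n₁ n₂ d m env) {v : ℕ} (hv : v = 11 ∨ v = 13) (mem : ℕ → ℝ) :
    (minor v).eval mem env = memMinor mem n₁ n₂ m d (env v) (env 15) := by
  have e1 : v ≠ 17 := by omega
  have e2 : v ≠ 19 := by omega
  simp [minor, eval, NExpr.minorAddr, NExpr.eval, NExpr.digit_eval, memMinor, natSign,
    _root_.minorAddr, h.v1, h.v3, h.v5, h.v6, h.v9, e1, e2]

theorem gram_eval (h : Layout n₁ n₂ d m env) (mem : ℕ → ℝ) :
    gram.eval mem env = memGram mem n₁ n₂ m d (env 11) (env 13) := by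
  simp only [gram, eval, NExpr.eval, h.v8, memGram]
  refine Finset.sum_congr rfl fun s _ => ?_
  rw [minor_eval (h.update (by omega) s) (by simp), minor_eval (h.update (by omega) s) (by simp)]
  simp

theorem minor_bd (h : Layout n₁ n₂ d m env) (hB : SizeBound n₁ n₂ d m B) {v : ℕ}
    (hv : v = 11 ∨ v = 13) (hJ : env v < m ^ d) (hs : env 15 < (n₁ * n₂) ^ d) :
    (minor v).Bd B env := by
  have e1 : v ≠ 17 := by omega
  have e2 : v ≠ 19 := by omega
  have hJB : env v ≤ B := by have := hB.bmd; nlinarith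
  refine ⟨trivial, by simpa [NExpr.eval, h.v9] using hB.bdd, fun t ht => ?_⟩
  simp only [NExpr.eval, h.v9] at ht
  have htB := ht.le.trans hB.bdd
  refine ⟨⟨trivial, by simpa [NExpr.eval, Function.update_apply, h.v6] using hB.bd, fun a ha => ?_⟩,
    ⟨trivial, by simpa [NExpr.eval, Function.update_apply, h.v6] using hB.bd, fun a ha => ?_⟩⟩
  · simp [NExpr.eval, h.v6] at ha
    have haB := ha.le.trans hB.bd
    refine ⟨trivial, by simpa [NExpr.eval, Function.update_apply] using haB, fun b hb => ?_⟩
    simp [NExpr.eval] at hb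
    have hbB := hb.le.trans haB
    have hb : (digit (var 17) (var 6) (var 21)).Bd B (update (update (update env 17 t) 19 a) 21 b) :=
      NExpr.digit_bd trivial trivial trivial (by simpa [NExpr.eval, Function.update_apply])
        (by simpa [NExpr.eval, Function.update_apply, h.v6] using hB.bd)
        (by simpa [NExpr.eval, Function.update_apply])
    have ha : (digit (var 17) (var 6) (var 19)).Bd B (update (update (update env 17 t) 19 a) 21 b) :=
      NExpr.digit_bd trivial trivial trivial (by simpa [NExpr.eval, Function.update_apply])
        (by simpa [NExpr.eval, Function.update_apply, h.v6] using hB.bd)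
        (by simpa [NExpr.eval, Function.update_apply])
    exact ⟨hb, ha, trivial, ha, hb, trivial, trivial⟩
  · simp [NExpr.eval, h.v6] at ha
    have haB := ha.le.trans hB.bd
    have hsB := hs.le.trans hB.bnd
    have g1 : (digit (var v) (var 3) (var 19)).Bd B (update (update env 17 t) 19 a) :=
      NExpr.digit_bd trivial trivial trivial (by simpa [NExpr.eval, Function.update_apply, e1, e2])
        (by simpa [NExpr.eval, Function.update_apply, h.v3] using hB.bm)
        (by simpa [NExpr.eval, Function.update_apply])
    have g2 : (digit (var 15) (var 5) (var 19)).Bd B (update (update env 17 t) 19 a) :=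
      NExpr.digit_bd trivial trivial trivial (by simpa [NExpr.eval, Function.update_apply])
        (by simpa [NExpr.eval, Function.update_apply, h.v5] using hB.bn)
        (by simpa [NExpr.eval, Function.update_apply])
    have g3 : (digit (var 17) (var 6) (var 19)).Bd B (update (update env 17 t) 19 a) :=
      NExpr.digit_bd trivial trivial trivial (by simpa [NExpr.eval, Function.update_apply])
        (by simpa [NExpr.eval, Function.update_apply, h.v6] using hB.bd)
        (by simpa [NExpr.eval, Function.update_apply])
    have g4 : (digit (var 15) (var 5) (digit (var 17) (var 6) (var 19))).Bd B
        (update (update env 17 t) 19 a) :=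
      NExpr.digit_bd trivial trivial g3 (by simpa [NExpr.eval, Function.update_apply])
        (by simpa [NExpr.eval, Function.update_apply, h.v5] using hB.bn)
        (by rw [NExpr.digit_eval]
            refine (NExpr.natDigit_le _ _ _).trans ?_
            simpa [NExpr.eval, Function.update_apply])
    refine ⟨⟨⟨g1, trivial, by simpa [NExpr.eval, Function.update_apply, h.v5] using hB.bn⟩,
      ⟨⟨g2, trivial, ?_⟩, trivial, by simpa [NExpr.eval, Function.update_apply, h.v1] using hB.bn₂⟩,
      NExpr.digit_bd g4 trivial trivial ?_
        (by simpa [NExpr.eval, Function.update_apply, h.v1] using hB.bn₂) (Nat.zero_le _)⟩, ?_⟩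
    · rw [NExpr.digit_eval]
      refine (NExpr.natDigit_le _ _ _).trans ?_
      simpa [NExpr.eval, Function.update_apply]
    · rw [NExpr.digit_eval]
      refine (NExpr.natDigit_le _ _ _).trans ?_
      simpa [NExpr.eval, Function.update_apply]
    · have := minorAddr_lt hJ hs ht ha
      have e : (NExpr.minorAddr v).eval (update (update env 17 t) 19 a) =
          _root_.minorAddr n₁ n₂ m d (env v) (env 15) t a := by
        simp [NExpr.minorAddr, NExpr.eval, NExpr.digit_eval,
          _root_.minorAddr, h.v1, h.v3, h.v5, h.v6, e1, e2]
      rw [e, ((h.update (x := 17) (by omega) t).update (x := 19) (by omega) a).v4]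
      omega

theorem gram_bd (h : Layout n₁ n₂ d m env) (hB : SizeBound n₁ n₂ d m B)
    (hi : env 11 < m ^ d) (hj : env 13 < m ^ d) : gram.Bd B env := by
  refine ⟨trivial, by simpa [NExpr.eval, h.v8] using hB.bnd, fun s hs => ?_⟩
  simp only [NExpr.eval, h.v8] at hs
  have h' := h.update (x := 15) (by omega) s
  exact ⟨minor_bd h' hB (by simp) (by simpa [Function.update_apply])
    (by simpa [Function.update_apply]), minor_bd h' hB (by simp) (by simpa [Function.update_apply])
    (by simpa [Function.update_apply])⟩

/-- The Gram matrix reads input cells only, so it may be written entry by entry elsewhere in the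
memory while being computed. -/
theorem memGram_congr {mem mem' : ℕ → ℝ} (h : ∀ a < m * (n₁ * n₂), mem' a = mem a) {i j : ℕ}
    (hi : i < m ^ d) (hj : j < m ^ d) :
    memGram mem' n₁ n₂ m d i j = memGram mem n₁ n₂ m d i j := by
  simp only [memGram, memMinor]
  refine Finset.sum_congr rfl fun s hs => ?_
  have H : ∀ J < m ^ d, ∀ t ∈ Finset.range (d ^ d), natSign d t * ∏ a ∈ Finset.range d,
      mem' (_root_.minorAddr n₁ n₂ m d J s t a) = natSign d t * ∏ a ∈ Finset.range d,
      mem (_root_.minorAddr n₁ n₂ m d J s t a) := fun J hJ t ht => by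
    congr 1
    exact Finset.prod_congr rfl fun a ha => h _ (minorAddr_lt hJ (Finset.mem_range.1 hs)
      (Finset.mem_range.1 ht) (Finset.mem_range.1 ha))
  rw [Finset.sum_congr rfl (H i hi), Finset.sum_congr rfl (H j hj)]

end RExpr

end RealRAM


/-! ### The successive pivot transforms as layers of the memory -/

namespace RealRAM

open Function (update)
open NExpr (var)

theorem Stmt.run_loop_induction {x : ℕ} {e : NExpr} {S : Stmt} {env : ℕ → ℕ} {mem : ℕ → ℝ}
    (Inv : ℕ → (ℕ → ℝ) → Prop) (h0 : Inv 0 mem)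
    (hs : ∀ i < e.eval env, ∀ mem', Inv i mem' → Inv (i + 1) (S.run (update env x i) mem')) :
    Inv (e.eval env) ((Stmt.loop x e S).run env mem) := by
  suffices H : ∀ k ≤ e.eval env,
      Inv k (Nat.rec mem (fun i mem' => S.run (update env x i) mem') k : ℕ → ℝ) from H _ le_rfl
  intro k hk
  induction k with
  | zero => exact h0
  | succ k ih => exact hs k hk _ (ih (by omega))

/-- The address of the entry `i, j` of the layer `t`. -/
def layerPos (c D t i j : ℕ) : ℕ := c + ((t * D + i) * D + j)

theorem layerAddr_eval {n₁ n₂ m d : ℕ} {env : ℕ → ℕ} (h : Layout n₁ n₂ d m env) (t i j : NExpr) :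
    (NExpr.layerAddr t i j).eval env =
      layerPos (m * (n₁ * n₂)) (m ^ d) (t.eval env) (i.eval env) (j.eval env) := by
  simp [NExpr.layerAddr, NExpr.eval, layerPos, h.v7, h.v10]

theorem layerAddr_bd {n₁ n₂ m d B : ℕ} {env : ℕ → ℕ} (h : Layout n₁ n₂ d m env)
    (hB : SizeBound n₁ n₂ d m B) {t i j : NExpr} (ht : t.Bd B env) (hi : i.Bd B env)
    (hj : j.Bd B env) : (NExpr.layerAddr t i j).Bd B env := by
  have : m ^ d ≤ B := by have := hB.bmd; nlinarith
  exact ⟨trivial, ⟨⟨⟨ht, trivial, by simpa [NExpr.eval, h.v7]⟩, hi⟩, trivial,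
    by simpa [NExpr.eval, h.v7]⟩, hj⟩

theorem layerPos_lt {c D t i j i' j' : ℕ} (hj' : j' < D) (h : i' < i ∨ i' = i ∧ j' < j) :
    layerPos c D t i' j' < layerPos c D t i j := by
  unfold layerPos
  rcases h with h | ⟨rfl, h⟩
  · have : (t * D + i' + 1) * D ≤ (t * D + i) * D := Nat.mul_le_mul_right _ (by omega)
    rw [add_mul, one_mul] at this
    omega
  · omega

theorem layerPos_lt_succ {c D t i j : ℕ} (hi : i < D) (hj : j < D) :
    layerPos c D t i j < layerPos c D (t + 1) 0 0 := by
  unfold layerPos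
  have : (t * D + i + 1) * D ≤ ((t + 1) * D + 0) * D := Nat.mul_le_mul_right _ (by
    rw [add_mul]; omega)
  rw [add_mul (t * D + i), one_mul] at this
  omega

theorem layerPos_zero_le {c D t i j : ℕ} : layerPos c D t 0 0 ≤ layerPos c D t i j := by
  unfold layerPos
  have : (t * D + 0) * D ≤ (t * D + i) * D := Nat.mul_le_mul_right _ (by omega)
  omega

theorem layerPos_mono {c D t t' : ℕ} (h : t ≤ t') : layerPos c D t 0 0 ≤ layerPos c D t' 0 0 := by
  unfold layerPos
  have : t * D * D ≤ t' * D * D := Nat.mul_le_mul_right _ (Nat.mul_le_mul_right _ h)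
  simpa

theorem layerPos_lt_scratch {c D t i j : ℕ} (ht : t ≤ D) (hi : i < D) (hj : j < D) :
    layerPos c D t i j < c + (D + 1) * D * D := by
  have h1 := (layerPos_lt_succ (c := c) (t := t) hi hj).trans_le
    (layerPos_mono (Nat.add_le_add_right ht 1))
  simpa [layerPos] using h1

/-- Fill the layer `t` with the values of `a`. -/
def fillStmt (x : ℕ) (t : NExpr) (a : RExpr) : Stmt :=
  .loop x (var 7) (.loop (x + 2) (var 7)
    (.store (NExpr.layerAddr t (var x) (var (x + 2))) a))

/-- The invariant follows the lexicographic order of the entries. The values may depend only on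
memory before the layer being filled; hence each transform gets a fresh layer, and no value needed
later is overwritten. -/
theorem fillStmt_run {n₁ n₂ m d : ℕ} {env : ℕ → ℕ} (h : Layout n₁ n₂ d m env) {x : ℕ}
    (hx : 10 < x) {t : NExpr} {T : ℕ} (ht : ∀ i j, t.eval (update (update env x i) (x + 2) j) = T)
    {a : RExpr} {v : ℕ → ℕ → ℝ} {mem : ℕ → ℝ}
    (ha : ∀ i < m ^ d, ∀ j < m ^ d, ∀ mem' : ℕ → ℝ,
      (∀ p < layerPos (m * (n₁ * n₂)) (m ^ d) T 0 0, mem' p = mem p) →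
      a.eval mem' (update (update env x i) (x + 2) j) = v i j) :
    (∀ p, p < layerPos (m * (n₁ * n₂)) (m ^ d) T 0 0 ∨
        layerPos (m * (n₁ * n₂)) (m ^ d) (T + 1) 0 0 ≤ p →
      (fillStmt x t a).run env mem p = mem p) ∧
    ∀ i < m ^ d, ∀ j < m ^ d,
      (fillStmt x t a).run env mem (layerPos (m * (n₁ * n₂)) (m ^ d) T i j) = v i j := by
  set c := m * (n₁ * n₂)
  set D := m ^ d with hD
  let Inv : ℕ → ℕ → (ℕ → ℝ) → Prop := fun i j mem' =>
    (∀ p, p < layerPos c D T 0 0 ∨ layerPos c D (T + 1) 0 0 ≤ p → mem' p = mem p) ∧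
    ∀ i' < D, ∀ j' < D, (i' < i ∨ i' = i ∧ j' < j) → mem' (layerPos c D T i' j') = v i' j'
  have hev : ∀ env', Layout n₁ n₂ d m env' → (var 7).eval env' = D := fun env' h' => h'.v7
  have main : Inv D 0 ((fillStmt x t a).run env mem) := by
    have := Stmt.run_loop_induction (x := x) (e := var 7) (S := .loop (x + 2) (var 7)
      (.store (NExpr.layerAddr t (var x) (var (x + 2))) a)) (env := env) (mem := mem)
      (fun i mem' => Inv i 0 mem') ⟨fun _ _ => rfl, fun i' _ j' _ h => by omega⟩ ?_
    · rwa [hev env h] at this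
    intro i hi mem₁ h₁
    rw [hev env h] at hi
    have h' := h.update hx i
    have := Stmt.run_loop_induction (x := x + 2) (e := var 7)
      (S := (.store (NExpr.layerAddr t (var x) (var (x + 2))) a)) (env := update env x i)
      (mem := mem₁) (fun j mem' => Inv i j mem') h₁ ?_
    · rw [hev _ h'] at this
      refine ⟨this.1, fun i' hi' j' hj' hlt => this.2 i' hi' j' hj' ?_⟩
      omega
    intro j hj mem₂ h₂
    rw [hev _ h'] at hj
    have h'' := h'.update (x := x + 2) (by omega) j
    have hpos : (NExpr.layerAddr t (var x) (var (x + 2))).eval (update (update env x i) (x + 2) j) =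
        layerPos c D T i j := by
      rw [layerAddr_eval h'', ht]
      simp [NExpr.eval, c, D]
    have hval : a.eval mem₂ (update (update env x i) (x + 2) j) = v i j :=
      ha i hi j hj mem₂ fun p hp => h₂.1 p (Or.inl hp)
    have hlt := layerPos_lt_succ (c := c) (t := T) hi hj
    have hle := layerPos_zero_le (c := c) (D := D) (t := T) (i := i) (j := j)
    simp only [Stmt.run, hpos, hval]
    refine ⟨fun p hp => ?_, fun i' hi' j' hj' hl => ?_⟩
    · rw [Function.update_of_ne (by omega)]
      exact h₂.1 p hp
    · by_cases hij : i' < i ∨ i' = i ∧ j' < j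
      · rw [Function.update_of_ne (layerPos_lt hj' hij).ne]
        exact h₂.2 i' hi' j' hj' hij
      · obtain ⟨rfl, rfl⟩ : i' = i ∧ j' = j := by omega
        rw [Function.update_self]
  exact ⟨main.1, fun i hi j hj => main.2 i hi j hj (Or.inl hi)⟩

theorem fillStmt_bd {n₁ n₂ m d B : ℕ} {env : ℕ → ℕ} (h : Layout n₁ n₂ d m env)
    (hB : SizeBound n₁ n₂ d m B) {x : ℕ}
    (hx : 10 < x) {t : NExpr} {T : ℕ} (hT : T ≤ m ^ d)
    (ht : ∀ i j, t.eval (update (update env x i) (x + 2) j) = T)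
    (htB : ∀ i j, t.Bd B (update (update env x i) (x + 2) j)) {a : RExpr}
    (ha : ∀ i < m ^ d, ∀ j < m ^ d, a.Bd B (update (update env x i) (x + 2) j)) :
    (fillStmt x t a).Bd B env := by
  have hD : m ^ d ≤ B := by have := hB.bmd; nlinarith
  refine ⟨trivial, by simpa [NExpr.eval, h.v7], fun i hi => ?_⟩
  simp only [NExpr.eval, h.v7] at hi
  have h' := h.update hx i
  refine ⟨trivial, by simpa [NExpr.eval, h'.v7], fun j hj => ?_⟩
  simp only [NExpr.eval, h'.v7] at hj
  have h'' := h'.update (x := x + 2) (by omega) j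
  refine ⟨layerAddr_bd h'' hB (htB i j) trivial trivial, ?_, ha i hi j hj⟩
  rw [layerAddr_eval h'', ht, h''.v4]
  have h1 := layerPos_lt_scratch (c := m * (n₁ * n₂)) hT hi hj
  simp only [NExpr.eval, Function.update_self, ne_eq, show x ≠ x + 2 by omega,
    not_false_eq_true, Function.update_of_ne]
  omega

namespace RExpr

/-- The entry `i, j` of the layer `11`. -/
def layer (i j : NExpr) : RExpr := cell (NExpr.layerAddr (var 11) i j)

/-- The expression for `Matrix.sweep`. -/
def sweep : RExpr :=
  let t := var 11
  let i := var 13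
  let j := var 15
  let offRow := sub (layer i j) (div (mul (layer i t) (layer t j)) (layer t t))
  let offRow' := ite j t offRow (ite t j offRow (div (layer i t) (layer t t)))
  let onRow := sub (const 0) (div (layer t j) (layer t t))
  let onRow' := ite j t onRow (ite t j onRow (div (const 1) (layer t t)))
  ite i t offRow' (ite t i offRow' onRow')

variable {n₁ n₂ m d B : ℕ} {env : ℕ → ℕ}

theorem sweep_eval (h : Layout n₁ n₂ d m env) {mem : ℕ → ℝ} {H : ℕ → ℕ → ℝ}
    (hH : ∀ i < m ^ d, ∀ j < m ^ d,
      mem (layerPos (m * (n₁ * n₂)) (m ^ d) (env 11) i j) = H i j)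
    (ht : env 11 < m ^ d) (hi : env 13 < m ^ d) (hj : env 15 < m ^ d) :
    sweep.eval mem env = Matrix.sweep (env 11) H (env 13) (env 15) := by
  simp only [sweep, eval, layer, layerAddr_eval h, NExpr.eval, hH _ ht _ ht, hH _ ht _ hj,
    hH _ hi _ ht, hH _ hi _ hj, Matrix.sweep]
  -- Programs can only test `<`, so equality of indices appears as the failure of both strict
  -- comparisons.
  have cases : ∀ a b : ℕ, (a < b ∧ ¬ b < a ∧ a ≠ b) ∨ (b < a ∧ ¬ a < b ∧ a ≠ b) ∨ a = b := by
    intro a b; omega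
  rcases cases (env 13) (env 11) with ⟨h1, h2, h3⟩ | ⟨h1, h2, h3⟩ | h1 <;>
    rcases cases (env 15) (env 11) with ⟨k1, k2, k3⟩ | ⟨k1, k2, k3⟩ | k1 <;>
    simp [*, neg_div]

theorem layer_bd (h : Layout n₁ n₂ d m env) (hB : SizeBound n₁ n₂ d m B) (ht : env 11 < m ^ d)
    {i j : ℕ} (hi : env i < m ^ d) (hj : env j < m ^ d) : (layer (var i) (var j)).Bd B env := by
  refine ⟨layerAddr_bd h hB trivial trivial trivial, ?_⟩
  rw [layerAddr_eval h, h.v4]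
  have h1 := layerPos_lt_scratch (c := m * (n₁ * n₂)) ht.le hi hj
  simp only [NExpr.eval]
  omega

theorem sweep_bd (h : Layout n₁ n₂ d m env) (hB : SizeBound n₁ n₂ d m B)
    (ht : env 11 < m ^ d) (hi : env 13 < m ^ d) (hj : env 15 < m ^ d) : sweep.Bd B env := by
  have tt := layer_bd h hB ht ht ht
  have tj := layer_bd h hB ht ht hj
  have it := layer_bd h hB ht hi ht
  have ij := layer_bd h hB ht hi hj
  simp only [sweep, Bd, NExpr.Bd, tt, tj, it, ij, and_self]

end RExpr

/-- Compute the Gram matrix, invert it by successive principal pivot transforms, and store the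
product of the pivots (two cells before the scratch space) and the certified distance (in the
cell `0`). -/
def certifyStmt : Stmt :=
  .seq (fillStmt 11 (.const 0) RExpr.gram) <|
  .seq (.loop 11 (var 7) (fillStmt 13 (.add (var 11) (.const 1)) RExpr.sweep)) <|
  .seq (.store (.sub (var 4) (.const 2)) (.prod 11 (var 7) (RExpr.layer (var 11) (var 11)))) <|
  .store (.const 0) (.div (.const 1) (.mul
    (.sqrt (.add (.const 1) (.sum 11 (var 7)
      (.cell (NExpr.layerAddr (var 7) (var 11) (var 11))))))
    (.prod 11 (.mul (.const 3) (var 6)) (.sum 13 (var 5) (.const 1)))))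


variable {n₁ n₂ m d B : ℕ} {env : ℕ → ℕ}

theorem certifyStmt_run (h : Layout n₁ n₂ d m env) (mem : ℕ → ℝ) :
    certifyStmt.run env mem (env 4 - 2) = ∏ t ∈ Finset.range (m ^ d),
        Matrix.sweeps (memGram mem n₁ n₂ m d) t t t ∧
      certifyStmt.run env mem (env 4 - 1) = mem (env 4 - 1) ∧
      certifyStmt.run env mem 0 = 1 / (Real.sqrt (1 + ∑ t ∈ Finset.range (m ^ d),
        Matrix.sweeps (memGram mem n₁ n₂ m d) (m ^ d) t t) * ((n₁ : ℝ) * n₂) ^ (3 * d)) := by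
  set c := m * (n₁ * n₂) with hc
  set D := m ^ d with hD
  set G := memGram mem n₁ n₂ m d with hG
  -- Three spare cells follow the layers. Even when m = 0 and there are no layers, the output cell 0
  -- thus differs from the cells used for the product and for the constant zero.
  have hτ : env 4 = layerPos c D (D + 1) 0 0 + 3 := by simp [h.v4, layerPos, c, D, add_assoc]
  obtain ⟨a1, a2⟩ := fillStmt_run h (x := 11) (by omega) (t := .const 0) (T := 0)
    (fun _ _ => rfl) (a := RExpr.gram) (v := G) (mem := mem) (by
      intro i hi j hj mem' hmem
      have h' := (h.update (x := 11) (by omega) i).update (x := 13) (by omega) j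
      rw [RExpr.gram_eval h']
      simp only [Function.update_self, ne_eq, show (11 : ℕ) ≠ 13 by omega,
        not_false_eq_true, Function.update_of_ne]
      exact RExpr.memGram_congr (fun a ha => hmem a (by simpa [layerPos] using ha)) hi hj)
  set mem₁ := (fillStmt 11 (.const 0) RExpr.gram).run env mem with hmem₁
  -- All earlier layers stay in the invariant, because the t-th pivot is read from layer t after the
  -- loop has ended.
  have H := Stmt.run_loop_induction (x := 11) (e := var 7)
    (S := fillStmt 13 (.add (var 11) (.const 1)) RExpr.sweep) (env := env) (mem := mem₁)
    (fun T mem' => (∀ p ≥ layerPos c D (D + 1) 0 0, mem' p = mem p) ∧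
      ∀ t ≤ T, ∀ i < D, ∀ j < D, mem' (layerPos c D t i j) = Matrix.sweeps G t i j) ?_ ?_
  swap
  · refine ⟨fun p hp => a1 p (Or.inr ((layerPos_mono (by omega)).trans hp)), ?_⟩
    intro t ht i hi j hj
    obtain rfl : t = 0 := by omega
    exact a2 i hi j hj
  swap
  · rintro T hT mem' ⟨g1, g2⟩
    rw [show (var 7).eval env = D from h.v7] at hT
    have hT' := h.update (x := 11) (by omega) T
    obtain ⟨b1, b2⟩ := fillStmt_run hT' (x := 13) (by omega) (t := .add (var 11) (.const 1))
      (T := T + 1) (fun _ _ => by simp [NExpr.eval]) (a := RExpr.sweep)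
      (v := Matrix.sweeps G (T + 1)) (mem := mem') (by
        intro i hi j hj mem'' hmem
        have h' := (hT'.update (x := 13) (by omega) i).update (x := 15) (by omega) j
        rw [RExpr.sweep_eval h' (H := Matrix.sweeps G T)]
        · simp [Matrix.sweeps]
        · intro i' hi' j' hj'
          have e : (update (update (update env 11 T) 13 i) 15 j) 11 = T := by simp
          rw [e, hmem _ (layerPos_lt_succ hi' hj')]
          exact g2 T le_rfl i' hi' j' hj'
        · simpa using hT
        · simpa using hi
        · simpa using hj)
    refine ⟨fun p hp => ?_, fun t ht i hi j hj => ?_⟩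
    · rw [b1 p (Or.inr ((layerPos_mono (by omega)).trans hp)), g1 p hp]
    · rcases Nat.lt_or_ge T t with h1 | h1
      · obtain rfl : t = T + 1 := by omega
        exact b2 i hi j hj
      · rw [b1 _ (Or.inl ((layerPos_lt_succ hi hj).trans_le (layerPos_mono (by omega)))),
          g2 t h1 i hi j hj]
  rw [show (var 7).eval env = D from h.v7] at H
  set mem₂ := (Stmt.loop 11 (var 7) (fillStmt 13 (.add (var 11) (.const 1)) RExpr.sweep)).run env
    mem₁ with hmem₂
  obtain ⟨H1, H2⟩ := H
  have hrun : certifyStmt.run env mem = (Stmt.store (.const 0) _).run env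
    ((Stmt.store (.sub (var 4) (.const 2)) _).run env mem₂) := rfl
  have e1 : (RExpr.prod 11 (var 7) (RExpr.layer (var 11) (var 11))).eval mem₂ env =
      ∏ t ∈ Finset.range D, Matrix.sweeps G t t t := by
    simp only [RExpr.eval, RExpr.layer, show (var 7).eval env = D from h.v7]
    refine Finset.prod_congr rfl fun t ht => ?_
    have ht := Finset.mem_range.1 ht
    rw [layerAddr_eval (h.update (by omega) t)]
    simpa [NExpr.eval] using H2 t ht.le t ht t ht
  rw [hrun]
  simp only [Stmt.run, e1, NExpr.eval]
  refine ⟨?_, ?_, ?_⟩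
  · rw [Function.update_of_ne (by omega), Function.update_self]
  · rw [Function.update_of_ne (by omega), Function.update_of_ne (by omega)]
    exact H1 _ (by omega)
  · rw [Function.update_self]
    simp only [RExpr.eval, NExpr.eval, h.v7, h.v6]
    have e2 : ∀ t ∈ Finset.range D, update mem₂ (env 4 - 2) (∏ t ∈ Finset.range D,
        Matrix.sweeps G t t t) ((NExpr.layerAddr (var 7) (var 11) (var 11)).eval
          (update env 11 t)) = Matrix.sweeps G D t t := by
      intro t ht
      have ht := Finset.mem_range.1 ht
      have h' := h.update (x := 11) (by omega) t
      rw [layerAddr_eval h']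
      simp only [NExpr.eval, h'.v7, Function.update_self]
      have h1 := layerPos_lt_succ (c := c) (t := D) ht ht
      rw [Function.update_of_ne (show layerPos c D D t t ≠ env 4 - 2 by omega)]
      exact H2 D le_rfl t ht t ht
    rw [Finset.sum_congr rfl e2]
    simp [h.v5]

theorem certifyStmt_bd (h : Layout n₁ n₂ d m env) (hB : SizeBound n₁ n₂ d m B) :
    certifyStmt.Bd B env := by
  have hD : m ^ d ≤ B := by have := hB.bmd; nlinarith
  have hτ := h.v4
  refine ⟨fillStmt_bd h hB (by omega) (T := 0) (by omega) (fun _ _ => rfl)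
    (fun _ _ => by trivial) fun i hi j hj => ?_, ⟨trivial, by simpa [NExpr.eval, h.v7], ?_⟩,
    ⟨⟨trivial, trivial⟩, by simp only [NExpr.eval]; omega, trivial,
      by simpa [NExpr.eval, h.v7], ?_⟩,
    trivial, by simp only [NExpr.eval]; omega, trivial,
    ⟨trivial, trivial, by simpa [NExpr.eval, h.v7], ?_⟩,
    ⟨trivial, trivial, by simpa [NExpr.eval, h.v6] using hB.bd⟩,
    by simpa [NExpr.eval, h.v6] using hB.bd3, fun k hk =>
      ⟨trivial, by simpa [NExpr.eval, h.v5] using hB.bn, fun _ _ => trivial⟩⟩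
  · exact RExpr.gram_bd ((h.update (by omega) i).update (by omega) j) hB (by simpa) (by simpa)
  · intro t ht
    simp only [NExpr.eval, h.v7] at ht
    have h' := h.update (x := 11) (by omega) t
    refine fillStmt_bd h' hB (by omega) (T := t + 1) (by omega) (fun _ _ => by simp [NExpr.eval])
      (fun _ _ => by exact ⟨trivial, trivial⟩) fun i hi j hj => ?_
    exact RExpr.sweep_bd ((h'.update (by omega) i).update (by omega) j) hB (by simpa) (by simpa)
      (by simpa)
  · intro t ht
    simp only [NExpr.eval, h.v7] at ht
    have h' := h.update (x := 11) (by omega) t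
    exact RExpr.layer_bd h' hB (by simpa) (by simpa) (by simpa)
  · intro t ht
    simp only [NExpr.eval, h.v7] at ht
    have h' := h.update (x := 11) (by omega) t
    refine ⟨layerAddr_bd h' hB trivial trivial trivial, ?_⟩
    rw [layerAddr_eval h', h'.v4]
    have := layerPos_lt_scratch (c := m * (n₁ * n₂)) le_rfl ht ht
    simp only [NExpr.eval, h'.v7, Function.update_self]
    omega

theorem certifyStmt_wf : certifyStmt.WF [0, 1, 2, 3, 4, 5, 6, 7, 8, 9, 10] 11 := by
  simp [certifyStmt, fillStmt, Stmt.WF, RExpr.WF, NExpr.WF, RExpr.gram, RExpr.minor, RExpr.sweep,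
    RExpr.layer, NExpr.layerAddr, NExpr.minorAddr, NExpr.digit]

end RealRAM


/-! ### The certification program and its output -/

namespace RealRAM

open NExpr (var)

theorem NExpr.runs_seq {e : NExpr} {k B c c' : ℕ} {s : State} {R : Program} {Q : State → Prop}
    (A : List ℕ) (hWF : e.WF A) (hA : ∀ x ∈ A, x < k) (hBd : e.Bd B s.nat)
    (h : ∀ s', NExpr.Post k (e.eval s.nat) s s' → Runs R s' c' Q) (hc : e.cost B + c' = c) :
    Runs (.seq (e.compile k) R) s c Q :=
  Runs.seq ((e.runs_compile hWF hBd hA fun _ _ => rfl).mono le_rfl h) hc.le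

/-- The address of the scratch space. -/
def scratchExpr : NExpr :=
  let d := .add (var 2) (.const 1)
  let D := .pow (var 3) d
  .add (.mul (var 3) (.mul (var 0) (var 1))) (.add (.mul (.mul (.add D (.const 1)) D) D) (.const 3))

/-- The certification program. -/
def certifier : Program :=
  .seq (scratchExpr.compile 4) <|
  .seq ((NExpr.mul (var 0) (var 1)).compile 5) <|
  .seq ((NExpr.add (var 2) (.const 1)).compile 6) <|
  .seq ((NExpr.pow (var 3) (var 6)).compile 7) <|
  .seq ((NExpr.pow (var 5) (var 6)).compile 8) <|
  .seq ((NExpr.pow (var 6) (var 6)).compile 9) <|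
  .seq ((NExpr.mul (var 3) (var 5)).compile 10) <|
  .seq (certifyStmt.compile 11) <|
  .seq ((NExpr.sub (var 4) (.const 2)).compile 5) <|
  .seq ((NExpr.sub (var 4) (.const 1)).compile 6) <|
  .branch (.realLt 6 5) (.instr (.natConst 0 1)) (.instr (.natConst 0 0))

/-- A bound for the running time of `certifier`. -/
def certifierCost (B : ℕ) : ℕ :=
  scratchExpr.cost B + ((NExpr.mul (var 0) (var 1)).cost B + ((NExpr.add (var 2) (.const 1)).cost B +
  ((NExpr.pow (var 3) (var 6)).cost B + ((NExpr.pow (var 5) (var 6)).cost B +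
  ((NExpr.pow (var 6) (var 6)).cost B + ((NExpr.mul (var 3) (var 5)).cost B +
  (certifyStmt.cost B + ((NExpr.sub (var 4) (.const 2)).cost B +
  ((NExpr.sub (var 4) (.const 1)).cost B + 2)))))))))

theorem polyBdd_certifierCost : PolyBdd certifierCost :=
  (NExpr.polyBdd_cost _).add <| (NExpr.polyBdd_cost _).add <| (NExpr.polyBdd_cost _).add <|
  (NExpr.polyBdd_cost _).add <| (NExpr.polyBdd_cost _).add <| (NExpr.polyBdd_cost _).add <|
  (NExpr.polyBdd_cost _).add <| (Stmt.polyBdd_cost _).add <| (NExpr.polyBdd_cost _).add <|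
  (NExpr.polyBdd_cost _).add <| .const 2

open Classical in
/-- The output of `certifier`, in terms of the pivots of the Gram matrix of the minors. -/
noncomputable def certifierOutput (n₁ n₂ d m : ℕ) (G : ℕ → ℕ → ℝ) : Option ℝ :=
  if 0 < ∏ t ∈ Finset.range (m ^ d), Matrix.sweeps G t t t then
    some (1 / (Real.sqrt (1 + ∑ t ∈ Finset.range (m ^ d), Matrix.sweeps G (m ^ d) t t) *
      ((n₁ : ℝ) * n₂) ^ (3 * d)))
  else none

theorem runs_certifier {n₁ n₂ r m B : ℕ} (hB : SizeBound n₁ n₂ (r + 1) m B)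
    (b : Fin m → MatSpace n₁ n₂) :
    Runs certifier (inputState n₁ n₂ r m b) (certifierCost B) fun s => outputOf s =
      certifierOutput n₁ n₂ (r + 1) m
        (memGram (inputState n₁ n₂ r m b).real n₁ n₂ m (r + 1)) := by
  set s₀ := inputState n₁ n₂ r m b with hs₀
  have i0 : s₀.nat 0 = n₁ := rfl
  have i1 : s₀.nat 1 = n₂ := rfl
  have i2 : s₀.nat 2 = r := rfl
  have i3 : s₀.nat 3 = m := rfl
  have hD : m ^ (r + 1) ≤ B := by have := hB.bmd; nlinarith
  have hpow : (NExpr.pow (var 3) (.add (var 2) (.const 1))).Bd B s₀.nat :=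
    ⟨trivial, ⟨trivial, trivial⟩, by simpa [NExpr.eval, i3] using hB.bm,
      by simpa [NExpr.eval, i2] using hB.bd⟩
  have hpow' : (NExpr.pow (var 3) (.add (var 2) (.const 1))).eval s₀.nat ≤ B := by
    simpa [NExpr.eval, i2, i3] using hD
  refine NExpr.runs_seq (B := B) [0, 1, 2, 3] (by simp [scratchExpr, NExpr.WF]) (by simp)
    ⟨⟨trivial, ⟨trivial, trivial, by simpa [NExpr.eval, i1] using hB.bn₂⟩,
      by simpa [NExpr.eval, i0, i1] using hB.bn⟩,
      ⟨⟨⟨hpow, trivial⟩, hpow, hpow'⟩, hpow, hpow'⟩, trivial⟩ (fun s₁ p₁ => ?_) rfl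
  have j0 := (p₁.2.1 0 (by omega)).trans i0
  have j1 := (p₁.2.1 1 (by omega)).trans i1
  have j2 := (p₁.2.1 2 (by omega)).trans i2
  have j3 := (p₁.2.1 3 (by omega)).trans i3
  have j4 := p₁.1
  simp only [scratchExpr, NExpr.eval, i0, i1, i2, i3] at j4
  refine NExpr.runs_seq (B := B) [0, 1] (by simp [NExpr.WF]) (by simp)
    ⟨trivial, trivial, by simpa [NExpr.eval, j1] using hB.bn₂⟩ (fun s₂ p₂ => ?_) rfl
  have k2 := (p₂.2.1 2 (by omega)).trans j2
  have k3 := (p₂.2.1 3 (by omega)).trans j3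
  have k5 := p₂.1
  simp only [NExpr.eval, j0, j1] at k5
  refine NExpr.runs_seq (B := B) [2] (by simp [NExpr.WF]) (by simp)
    ⟨trivial, trivial⟩ (fun s₃ p₃ => ?_) rfl
  have l3 := (p₃.2.1 3 (by omega)).trans k3
  have l5 := (p₃.2.1 5 (by omega)).trans k5
  have l6 := p₃.1
  simp only [NExpr.eval, k2] at l6
  refine NExpr.runs_seq (B := B) [3, 6] (by simp [NExpr.WF]) (by simp)
    ⟨trivial, trivial, by simpa [NExpr.eval, l3] using hB.bm,
      by simpa [NExpr.eval, l6] using hB.bd⟩ (fun s₄ p₄ => ?_) rfl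
  have m3 := (p₄.2.1 3 (by omega)).trans l3
  have m5 := (p₄.2.1 5 (by omega)).trans l5
  have m6 := (p₄.2.1 6 (by omega)).trans l6
  have m7 := p₄.1
  simp only [NExpr.eval, l3, l6] at m7
  refine NExpr.runs_seq (B := B) [5, 6] (by simp [NExpr.WF]) (by simp)
    ⟨trivial, trivial, by simpa [NExpr.eval, m5] using hB.bn,
      by simpa [NExpr.eval, m6] using hB.bd⟩ (fun s₅ p₅ => ?_) rfl
  have n3 := (p₅.2.1 3 (by omega)).trans m3
  have n5 := (p₅.2.1 5 (by omega)).trans m5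
  have n6 := (p₅.2.1 6 (by omega)).trans m6
  have n8 := p₅.1
  simp only [NExpr.eval, m5, m6] at n8
  refine NExpr.runs_seq (B := B) [6] (by simp [NExpr.WF]) (by simp)
    ⟨trivial, trivial, by simpa [NExpr.eval, n6] using hB.bd,
      by simpa [NExpr.eval, n6] using hB.bd⟩ (fun s₆ p₆ => ?_) rfl
  have o3 := (p₆.2.1 3 (by omega)).trans n3
  have o5 := (p₆.2.1 5 (by omega)).trans n5
  have o9 := p₆.1
  simp only [NExpr.eval, n6] at o9
  refine NExpr.runs_seq (B := B) [3, 5] (by simp [NExpr.WF]) (by simp)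
    ⟨trivial, trivial, by simpa [NExpr.eval, o5] using hB.bn⟩ (fun s₇ p₇ => ?_) rfl
  have q10 := p₇.1
  simp only [NExpr.eval, o3, o5] at q10
  have hreal : s₇.real = s₀.real := by
    rw [p₇.2.2, p₆.2.2, p₅.2.2, p₄.2.2, p₃.2.2, p₂.2.2, p₁.2.2]
  have q8 : s₇.nat 8 = _ := (p₇.2.1 8 (by omega)).trans ((p₆.2.1 8 (by omega)).trans n8)
  have q7 : s₇.nat 7 = _ := (p₇.2.1 7 (by omega)).trans ((p₆.2.1 7 (by omega)).trans
    ((p₅.2.1 7 (by omega)).trans m7))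
  have q6 : s₇.nat 6 = _ := (p₇.2.1 6 (by omega)).trans ((p₆.2.1 6 (by omega)).trans n6)
  have q4 : s₇.nat 4 = _ := (p₇.2.1 4 (by omega)).trans <| (p₆.2.1 4 (by omega)).trans <|
    (p₅.2.1 4 (by omega)).trans <| (p₄.2.1 4 (by omega)).trans <| (p₃.2.1 4 (by omega)).trans <|
    (p₂.2.1 4 (by omega)).trans j4
  have q1 : s₇.nat 1 = _ := (p₇.2.1 1 (by omega)).trans <| (p₆.2.1 1 (by omega)).trans <|
    (p₅.2.1 1 (by omega)).trans <| (p₄.2.1 1 (by omega)).trans <| (p₃.2.1 1 (by omega)).trans <|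
    (p₂.2.1 1 (by omega)).trans j1
  have hL : Layout n₁ n₂ (r + 1) m s₇.nat :=
    ⟨q1, (p₇.2.1 3 (by omega)).trans o3, q4, (p₇.2.1 5 (by omega)).trans o5, q6, q7, q8,
      (p₇.2.1 9 (by omega)).trans o9, q10⟩
  obtain ⟨f1, f2, f3⟩ := certifyStmt_run hL s₀.real
  set mem := certifyStmt.run s₇.nat s₀.real
  refine Runs.seq ((Stmt.runs_compile (B := B) certifyStmt (env := s₇.nat) (mem := s₀.real)
    certifyStmt_wf (certifyStmt_bd hL hB) (by simp) (by simp)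
    ⟨fun _ _ => rfl, fun a _ => by rw [hreal]⟩).mono le_rfl fun s₈ p₈ => ?_) le_rfl
  have r4 := p₈.1 4 (by omega)
  refine NExpr.runs_seq (B := B) [4] (by simp [NExpr.WF]) (by simp)
    ⟨trivial, trivial⟩ (fun s₉ p₉ => ?_) rfl
  have t4 := (p₉.2.1 4 (by omega)).trans r4
  have t5 := p₉.1
  simp only [NExpr.eval, r4] at t5
  refine NExpr.runs_seq (B := B) [4] (by simp [NExpr.WF]) (by simp)
    ⟨trivial, trivial⟩ (fun s₁₀ p₁₀ => ?_) rfl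
  have u5 := (p₁₀.2.1 5 (by omega)).trans t5
  have u6 := p₁₀.1
  simp only [NExpr.eval, t4] at u6
  have hτ : 3 ≤ s₇.nat 4 := by omega
  have hr : ∀ a < s₇.nat 4, s₁₀.real a = mem a := fun a ha => by
    rw [p₁₀.2.2, p₉.2.2]; exact p₈.2 a ha
  have g5 : s₁₀.getReal 5 = mem (s₇.nat 4 - 2) := by
    rw [State.getReal, u5]; exact hr _ (by omega)
  -- The last cell before the scratch space lies beyond the input and is never written, so it serves
  -- as the zero to compare with.
  have g6 : s₁₀.getReal 6 = 0 := by
    rw [State.getReal, u6, hr _ (by omega), f2, hs₀]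
    exact dif_neg (by omega)
  rw [f1] at g5
  refine Runs.branch (c := 1) (fun hT => .instr le_rfl ?_) fun hT => .instr le_rfl ?_
  · simp only [Test.Holds, g5, g6] at hT
    rw [certifierOutput, if_pos hT, ← f3]
    simp [outputOf, Instr.apply, hr 0 (by omega)]
  · simp only [Test.Holds, g5, g6] at hT
    rw [certifierOutput, if_neg hT]
    simp [outputOf, Instr.apply]

end RealRAM


/-! ### Correctness of the certification program -/

section Certification

open RealRAM

variable {n₁ n₂ r m : ℕ}

theorem Orthonormal.card_le_mul {b : Fin m → MatSpace n₁ n₂} (hb : Orthonormal ℝ b) :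
    m ≤ n₁ * n₂ := by
  simpa using hb.linearIndependent.fintype_card_le_finrank

/-- An orthonormal family has m ≤ N, and 4 ≤ d² ≤ N, so all loop bounds fit under one power of N
with exponent linear in r. -/
theorem sizeBound_of_le {d : ℕ} (hd : 2 ≤ d) (h₁ : d ≤ n₁) (h₂ : d ≤ n₂) (hm : m ≤ n₁ * n₂) :
    SizeBound n₁ n₂ d m ((n₁ * n₂) ^ (3 * d)) := by
  have hdd : d * d ≤ n₁ * n₂ := Nat.mul_le_mul h₁ h₂
  have hn₂ : n₂ ≤ n₁ * n₂ := Nat.le_mul_of_pos_left _ (by omega)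
  obtain ⟨N, hNdef⟩ : ∃ N, N = n₁ * n₂ := ⟨_, rfl⟩
  rw [← hNdef] at hm hdd hn₂ ⊢
  have hd4 : 2 * d ≤ d * d := Nat.mul_le_mul_right _ hd
  have hN : 4 ≤ N := by omega
  have hK : ∀ j, j ≤ 3 * d → N ^ j ≤ N ^ (3 * d) := fun j hj => Nat.pow_le_pow_right (by omega) hj
  have h1 : N ≤ N ^ (3 * d) := Nat.le_self_pow (by omega) _
  have hmd : m ^ d ≤ N ^ d := Nat.pow_le_pow_left hm d
  have hd' : N ^ 1 ≤ N ^ d := Nat.pow_le_pow_right (by omega) (by omega)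
  refine ⟨hn₂.trans h1, hm.trans h1, by omega, hNdef ▸ h1, ?_, hNdef ▸ hK d (by omega),
    (Nat.pow_le_pow_left (by omega) d).trans (hK d (by omega)), ?_⟩
  · calc _ ≤ (N ^ d + 1) * N ^ d := Nat.mul_le_mul (by omega) hmd
      _ ≤ (N ^ d * N ^ d) * N ^ d := Nat.mul_le_mul_right _ (by nlinarith)
      _ = N ^ (3 * d) := by ring
  · refine le_trans ?_ (hK 2 (by omega))
    nlinarith

open Classical in
theorem exists_outputs (hr : r + 1 ≤ min n₁ n₂) (hr1 : 1 ≤ r) {b : Fin m → MatSpace n₁ n₂}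
    (hb : Orthonormal ℝ b) :
    ∃ t ≤ certifierCost ((n₁ * n₂) ^ (3 * (r + 1))), Outputs certifier r b
      (certifierOutput n₁ n₂ (r + 1) m
        (memGram (inputState n₁ n₂ r m b).real n₁ n₂ m (r + 1))) t := by
  obtain ⟨h₁, h₂⟩ := le_min_iff.1 hr
  obtain ⟨s, t, h, ht, ho⟩ := runs_certifier
    (sizeBound_of_le (d := r + 1) (by omega) h₁ h₂ hb.card_le_mul) b
  exact ⟨t, ht, s, h, ho⟩

/-- The matrix of the minors of the tensor products of the vectors `b i`. -/
noncomputable def minorMatrix (d : ℕ) (b : Fin m → MatSpace n₁ n₂) :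
    Matrix (Fin d → Fin n₁ × Fin n₂) (Fin (m ^ d)) ℝ :=
  fun s J => mixedMinor (fun a => b (finFunctionFinEquiv.symm J a)) s

theorem minorMatrix_mulVec {d : ℕ} (b : Fin m → MatSpace n₁ n₂) (y : Fin (m ^ d) → ℝ)
    (s : Fin d → Fin n₁ × Fin n₂) : (minorMatrix d b).mulVec y s =
      ∑ J, y (finFunctionFinEquiv J) * mixedMinor (fun a => b (J a)) s := by
  rw [Matrix.mulVec, dotProduct]
  refine Fintype.sum_equiv finFunctionFinEquiv.symm _ _ fun J => ?_
  simp [minorMatrix, mul_comm]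

theorem memGram_input_eq {d : ℕ} (b : Fin m → MatSpace n₁ n₂) (i j : Fin (m ^ d)) :
    memGram (inputState n₁ n₂ r m b).real n₁ n₂ m d i j =
      ∑ s, minorMatrix d b s i * minorMatrix d b s j := memGram_input b i j

/-- A positive product only shows that no pivot is zero, but this suffices: the computed matrix is
then an exact inverse of a Gram matrix, so its trace is nonnegative and an admissible p. -/
theorem certifierOutput_sound (hr : r + 1 ≤ min n₁ n₂) (hr1 : 1 ≤ r) {b : Fin m → MatSpace n₁ n₂}
    (hb : Orthonormal ℝ b) {η : ℝ} (h : certifierOutput n₁ n₂ (r + 1) m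
      (memGram (inputState n₁ n₂ r m b).real n₁ n₂ m (r + 1)) = some η) :
    0 < η ∧ IsRobustlyEntangled r η (Submodule.span ℝ (Set.range b)) := by
  obtain ⟨h₁, h₂⟩ := le_min_iff.1 hr
  have hG := memGram_input_eq (r := r) (d := r + 1) b
  generalize memGram (inputState n₁ n₂ r m b).real n₁ n₂ m (r + 1) = G at h hG
  rw [certifierOutput] at h
  split_ifs at h with hpos
  obtain rfl := Option.some.inj h
  have hp : ∀ s < m ^ (r + 1), Matrix.sweeps G s s s ≠ 0 := fun s hs h0 =>
    hpos.ne' (Finset.prod_eq_zero (Finset.mem_range.2 hs) h0)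
  have hp0 := Matrix.sweeps_trace_nonneg hG hp
  have hn₁ : (0 : ℝ) < n₁ := by exact_mod_cast (by omega : 0 < n₁)
  have hn₂ : (0 : ℝ) < n₂ := by exact_mod_cast (by omega : 0 < n₂)
  refine ⟨by positivity, isRobustlyEntangled_of_gram h₁ h₂ (by omega) (by omega) hb hp0 fun y => ?_⟩
  have := Matrix.sum_sq_le_sweeps hG hp fun J => y (finFunctionFinEquiv.symm J)
  simp only [minorMatrix_mulVec, Equiv.symm_apply_apply] at this
  rwa [Equiv.sum_comp finFunctionFinEquiv.symm fun J => y J ^ 2] at this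

/-- A lower bound μ for L makes the Gram matrix positive definite, so all pivots are positive and
the trace of the inverse is at most m^d/μ. -/
theorem certifierOutput_complete {b : Fin m → MatSpace n₁ n₂} {μ : ℝ} (hμ : 0 < μ)
    (hN : 0 < n₁ * n₂)
    (hL : ∀ (I : Fin (r + 1) → Fin m) (y : (Fin (r + 1) → Fin m) → ℝ), μ * y I ^ 2 ≤
      ∑ s, (∑ J, y J * mixedMinor (fun a => b (J a)) s) ^ 2) :
    ∃ η, certifierOutput n₁ n₂ (r + 1) m
        (memGram (inputState n₁ n₂ r m b).real n₁ n₂ m (r + 1)) = some η ∧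
      1 / (Real.sqrt (1 + m ^ (r + 1) / μ) * ((n₁ : ℝ) * n₂) ^ (3 * (r + 1))) ≤ η := by
  have hG := memGram_input_eq (r := r) (d := r + 1) b
  generalize memGram (inputState n₁ n₂ r m b).real n₁ n₂ m (r + 1) = G at hG
  have hL' : ∀ (y : Fin (m ^ (r + 1)) → ℝ) J,
      μ * y J ^ 2 ≤ ∑ s, (minorMatrix (r + 1) b).mulVec y s ^ 2 := fun y J => by
    have := hL (finFunctionFinEquiv.symm J) fun I => y (finFunctionFinEquiv I)
    simpa only [Equiv.apply_symm_apply, minorMatrix_mulVec] using this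
  have hpos := Matrix.sweeps_pivot_pos_of_gram hG hμ hL'
  have hle := Matrix.sweeps_trace_le hG hμ hL'
  have h0 := Matrix.sweeps_trace_nonneg hG fun s hs => (hpos s hs).ne'
  have hN' : (0 : ℝ) < n₁ * n₂ := by exact_mod_cast hN
  refine ⟨_, if_pos (Finset.prod_pos fun t ht => hpos t (Finset.mem_range.1 ht)), ?_⟩
  push_cast at hle
  refine one_div_le_one_div_of_le (by positivity) ?_
  gcongr

end Certification

/-- The parameters of a certificate, up to constants. -/
theorem certificate_bound {d : ℕ} {N n m ρ : ℝ} (hN : 1 ≤ N) (hn : 1 ≤ n) (hnN : n ≤ N)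
    (hm0 : 0 ≤ m) (hm : m ≤ N) (hρ : 0 < ρ) :
    min ρ 1 ^ d / (3 * 9 ^ d) / N ^ (8 * d) ≤
      1 / (Real.sqrt (1 + m ^ d / ((ρ * Real.exp (-1)) ^ d / (2 * n ^ d) /
        (N * (1 + N * (ρ * (2 * N)))) ^ d) ^ 2) * N ^ (3 * d)) := by
  set q := min ρ 1 with hq
  have hq0 : 0 < q := lt_min hρ one_pos
  have hq1 : q ≤ 1 := min_le_right _ _
  have hqρ : q ≤ ρ := min_le_left _ _
  set A := 1 + N * (ρ * (2 * N)) with hA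
  have hA0 : 0 < A := by positivity
  set τ := (ρ * Real.exp (-1)) ^ d / (2 * n ^ d) with hτ
  have hτ0 : 0 < τ := by positivity
  have he : Real.exp 1 ≤ 3 := Real.exp_one_lt_d9.le.trans (by norm_num)
  -- The norm bound A grows with ρ, while τ scales like ρ^d. Comparing A/ρ with 1/min(ρ, 1) cancels
  -- this growth, and only the factor min(ρ, 1)^d is lost for every ρ.
  have hAq : A * q ≤ 3 * N ^ 2 * ρ := by
    have : q * ρ ≤ ρ := by nlinarith
    have h2 : N ^ 2 * (q * ρ) ≤ N ^ 2 * ρ := by gcongr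
    have h3 : q ≤ N ^ 2 * ρ := hqρ.trans (le_mul_of_one_le_left hρ.le (one_le_pow₀ hN))
    rw [hA]; nlinarith
  have h1 : (N * A) ^ d / τ ≤ 2 * (9 * N ^ 4 / q) ^ d := by
    have e1 : (N * A) ^ d / τ = 2 * (N * A * n * Real.exp 1 / ρ) ^ d := by
      rw [hτ, Real.exp_neg]
      simp only [mul_pow, div_pow, inv_pow]
      field_simp
    rw [e1]
    gcongr 2 * ?_ ^ d
    rw [div_le_div_iff₀ hρ hq0]
    calc _ = N * n * Real.exp 1 * (A * q) := by ring
      _ ≤ N * N * 3 * (3 * N ^ 2 * ρ) := by gcongr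
      _ = _ := by ring
  have h2 : Real.sqrt (1 + m ^ d / (τ / (N * A) ^ d) ^ 2) ≤ 1 + N ^ d * (2 * (9 * N ^ 4 / q) ^ d) := by
    refine Real.sqrt_le_iff.2 ⟨by positivity, ?_⟩
    have hmd : m ^ d ≤ (N ^ d) ^ 2 := by
      calc m ^ d ≤ N ^ d := by gcongr
        _ ≤ (N ^ d) ^ 2 := le_self_pow₀ (one_le_pow₀ hN) two_ne_zero
    have e2 : m ^ d / (τ / (N * A) ^ d) ^ 2 = m ^ d * ((N * A) ^ d / τ) ^ 2 := by
      field_simp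
    rw [e2]
    set X := (N * A) ^ d / τ with hX
    have hX0 : 0 ≤ X := by positivity
    have : m ^ d * X ^ 2 ≤ (N ^ d * (2 * (9 * N ^ 4 / q) ^ d)) ^ 2 := by
      rw [mul_pow]; gcongr
    have h0 : 0 ≤ N ^ d * (2 * (9 * N ^ 4 / q) ^ d) := by positivity
    nlinarith
  have hqd : q ^ d ≤ 1 := pow_le_one₀ hq0.le hq1
  have h3 : 1 + N ^ d * (2 * (9 * N ^ 4 / q) ^ d) ≤ 3 * 9 ^ d * N ^ (5 * d) / q ^ d := by
    rw [le_div_iff₀ (by positivity), div_pow, add_mul]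
    have h4 : 1 * q ^ d ≤ 9 ^ d * N ^ (5 * d) := by
      calc 1 * q ^ d ≤ 1 * 1 := by linarith
        _ ≤ 9 ^ d * N ^ (5 * d) := mul_le_mul (one_le_pow₀ (by norm_num)) (one_le_pow₀ hN)
          zero_le_one (by positivity)
    have h5 : N ^ d * (2 * ((9 * N ^ 4) ^ d / q ^ d)) * q ^ d = 2 * (9 ^ d * N ^ (5 * d)) := by
      field_simp
      ring
    rw [h5]; linarith
  rw [div_div, div_le_div_iff₀ (by positivity) (by positivity), one_mul]
  calc _ ≤ q ^ d * ((3 * 9 ^ d * N ^ (5 * d) / q ^ d) * N ^ (3 * d)) := by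
        gcongr; exact h2.trans h3
    _ = _ := by field_simp; ring


/-! ### Smoothed subspaces -/

section Smoothed

/-- Disjoint blocks of `h` indices. -/
def blockIndex {d h n : ℕ} (hle : d * h ≤ n) (a : Fin d) (i : Fin h) : Fin n :=
  Fin.castLE hle (finProdFinEquiv (a, i))

theorem blockIndex_injective {d h n : ℕ} (hle : d * h ≤ n) :
    Function.Injective (Function.uncurry (blockIndex hle)) :=
  (Fin.castLE_injective hle).comp finProdFinEquiv.injective

/-- The event of an exceptional perturbation. -/
def exceptional {n₁ n₂ m : ℕ} (d : ℕ) (ρ : ℝ) (u : Fin m → MatSpace n₁ n₂) :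
    Set (Fin m × (Fin n₁ × Fin n₂) → ℝ) :=
  (⋃ I, nearDependent (blockIndex (Nat.mul_div_le n₁ d)) (blockIndex (Nat.mul_div_le n₂ d)) u
    ((ρ * Real.exp (-1)) ^ d / (2 * ((n₁ / d : ℕ) * (n₂ / d : ℕ) : ℝ) ^ d)) I) ∪
  {z | ∃ i, ρ * (2 * (n₁ * n₂)) ≤ |z i|}

/-- With δ = ρ/e an interval of radius δ has probability at most 1/e, so ε^k = e^{-k}. The rest is a
union bound over the m^d multi-indices and over the entries. -/
theorem measure_exceptional_le {n₁ n₂ m d k : ℕ} {ρ : ℝ} (hρ : 0 < ρ)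
    (u : Fin m → MatSpace n₁ n₂) (hn : 1 ≤ (n₁ / d) * (n₂ / d))
    (hdim : 1 + d * (k * ((n₁ / d) * (n₂ / d)) ^ (d - 1)) +
      d * d ^ d * (m * ((n₁ / d) * (n₂ / d) + m) ^ (d - 1)) ≤ ((n₁ / d) * (n₂ / d)) ^ d) :
    gaussianNoise m n₁ n₂ ρ (exceptional d ρ u) ≤ ENNReal.ofReal
      (m ^ d * (d * (k + 1) ^ d * Real.exp (-k)) +
        m * (n₁ * n₂) * (2 * Real.exp (-(2 * (n₁ * n₂)) ^ 2 / 2))) := by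
  have hnR : (0 : ℝ) < (n₁ / d : ℕ) * (n₂ / d : ℕ) := by exact_mod_cast hn
  rw [ENNReal.ofReal_add (by positivity) (by positivity)]
  refine (measure_union_le _ _).trans (add_le_add ?_
    (gaussianNoise_exists_abs_ge_le hρ (by positivity)))
  refine (measure_iUnion_fintype_le _ _).trans ?_
  have h1 := fun I => measure_nearDependent_le (gaussianReal 0 (ρ ^ 2).toNNReal)
    (δ := ρ * Real.exp (-1)) (by positivity) (ε := ENNReal.ofReal (Real.exp (-1)))
    (fun c => by
      have := gaussianReal_Icc_le hρ (ρ * Real.exp (-1)) c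
      rwa [mul_div_cancel_left₀ _ hρ.ne'] at this)
    (blockIndex_injective (Nat.mul_div_le n₁ d)) (blockIndex_injective (Nat.mul_div_le n₂ d)) u
    (τ := (ρ * Real.exp (-1)) ^ d / (2 * ((n₁ / d : ℕ) * (n₂ / d : ℕ) : ℝ) ^ d))
    (by field_simp; exact le_rfl) I (k := k) hn hdim
  refine (Finset.sum_le_card_nsmul _ _ _ fun I _ => h1 I).trans (le_of_eq ?_)
  rw [nsmul_eq_mul, ← ENNReal.ofReal_pow (Real.exp_nonneg _), ← Real.exp_nat_mul,
    ← ENNReal.ofReal_natCast, ← ENNReal.ofReal_natCast, ← ENNReal.ofReal_mul (by positivity),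
    ← ENNReal.ofReal_mul (by positivity)]
  simp

open Classical in
-- Off the exceptional event the minors of the perturbed matrices have leave-one-out distances at
-- least τ. These yield independence at once, and after the change to an orthonormal basis they feed
-- the completeness of the certificate.
theorem certify_of_notMem_exceptional {n₁ n₂ r m : ℕ} (hr : r + 1 ≤ min n₁ n₂)
    {ρ : ℝ} (hρ : 0 < ρ) (hm : m ≤ n₁ * n₂) {u : Fin m → MatSpace n₁ n₂} (hu : ∀ i, ‖u i‖ ≤ 1)
    {z : Fin m × (Fin n₁ × Fin n₂) → ℝ} (hz : z ∉ exceptional (r + 1) ρ u) :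
    Module.finrank ℝ (perturbedSpan u z) = m ∧
      ∀ b : Fin m → MatSpace n₁ n₂, Orthonormal ℝ b →
        Submodule.span ℝ (Set.range b) = perturbedSpan u z →
        ∃ η, RealRAM.certifierOutput n₁ n₂ (r + 1) m
            (memGram (inputState n₁ n₂ r m b).real n₁ n₂ m (r + 1)) = some η ∧
          min ρ 1 ^ (r + 1) / (3 * 9 ^ (r + 1)) / ((n₁ : ℝ) * n₂) ^ (8 * (r + 1)) ≤ η := by
  obtain ⟨hr₁, hr₂⟩ := le_min_iff.1 hr
  simp only [exceptional, Set.mem_union, Set.mem_iUnion, not_or, not_exists, Set.mem_ofPred_eq,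
    not_le] at hz
  obtain ⟨hz1, hz2⟩ := hz
  have hq₁ : 1 ≤ n₁ / (r + 1) := (Nat.one_le_div_iff (by omega)).2 hr₁
  have hq₂ : 1 ≤ n₂ / (r + 1) := (Nat.one_le_div_iff (by omega)).2 hr₂
  have hn : (1 : ℝ) ≤ (n₁ / (r + 1) : ℕ) * (n₂ / (r + 1) : ℕ) := by
    exact_mod_cast Nat.mul_le_mul hq₁ hq₂
  have hnN : ((n₁ / (r + 1) : ℕ) * (n₂ / (r + 1) : ℕ) : ℝ) ≤ n₁ * n₂ := by
    exact_mod_cast Nat.mul_le_mul (Nat.div_le_self _ _) (Nat.div_le_self _ _)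
  set n : ℝ := (n₁ / (r + 1) : ℕ) * (n₂ / (r + 1) : ℕ) with hndef
  have hN := hn.trans hnN
  set N : ℝ := (n₁ : ℝ) * n₂ with hNdef
  set τ := (ρ * Real.exp (-1)) ^ (r + 1) / (2 * n ^ (r + 1)) with hτ
  have hτ0 : 0 < τ := by positivity
  set A := 1 + N * (ρ * (2 * N)) with hA
  have hA0 : 0 < A := by positivity
  have hmR : (m : ℝ) ≤ N := by rw [hNdef]; exact_mod_cast hm
  have hw := fun I y => sq_le_of_notMem_nearDependent hτ0.le (hz1 I) y
  refine ⟨finrank_perturbedSpan (linearIndependent_of_minors (by omega) hτ0 hw),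
    fun b hb hspan => ?_⟩
  have hwA : ∀ j, ‖perturbed u z j‖ ≤ A := fun j =>
    norm_perturbed_le (hu j) (by positivity) fun i => (hz2 i).le
  obtain ⟨η, h1, h2⟩ := certifierOutput_complete (r := r) (b := b)
    (μ := (τ / (N * A) ^ (r + 1)) ^ 2) (by positivity)
    (Nat.mul_pos (by omega) (by omega)) fun I y => by
      refine le_trans ?_ (minors_of_orthonormal hb hspan hτ0 hwA hA0 hw I y)
      have hm0 : (0 : ℝ) < m := by exact_mod_cast (Nat.zero_le _).trans_lt (I 0).2
      gcongr
  exact ⟨η, h1, (certificate_bound hN hn hnN (Nat.cast_nonneg m) hmR hρ).trans h2⟩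

end Smoothed

/-! ### Numerical estimates for the failure probability -/

/-- The powers of `x` are absorbed by an exponential. -/
theorem mul_pow_mul_exp_le {c κ x : ℝ} (hκ : 0 < κ) (j : ℕ)
    (hx : c * (j + 1).factorial / κ ^ (j + 1) ≤ x) (hx0 : 0 ≤ x) :
    c * x ^ j * Real.exp (-(2 * κ * x)) ≤ Real.exp (-(κ * x)) := by
  have h1 := Real.pow_div_factorial_le_exp (κ * x) (by positivity) (j + 1)
  rw [div_le_iff₀ (by positivity)] at h1 hx
  have hf : (0 : ℝ) < (j + 1).factorial := by positivity
  have h2 : c * x ^ j ≤ Real.exp (κ * x) := by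
    refine le_of_mul_le_mul_right ?_ hf
    calc c * x ^ j * (j + 1).factorial = c * (j + 1).factorial * x ^ j := by ring
      _ ≤ x * κ ^ (j + 1) * x ^ j := by gcongr
      _ = (κ * x) ^ (j + 1) := by ring
      _ ≤ _ := h1
  calc _ ≤ Real.exp (κ * x) * Real.exp (-(2 * κ * x)) := by gcongr
    _ = _ := by rw [← Real.exp_add]; congr 1; ring

theorem failure_probability_le {d m k : ℕ} {N κ : ℝ} (hd : 1 ≤ d) (hκ : 0 < κ)
    (hN : 1 ≤ N) (hm : m ≤ N) (hk : k + 1 ≤ 2 * N) (hk' : 2 * κ * N ≤ k + 1)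
    (hbig : (d * 2 ^ d * Real.exp 1 + 2) * (2 * d + 1).factorial / κ ^ (2 * d + 1) ≤ N) :
    m ^ d * (d * (k + 1) ^ d * Real.exp (-k)) + m * N * (2 * Real.exp (-(2 * N) ^ 2 / 2)) ≤
      Real.exp (-(κ * N)) := by
  refine le_trans ?_ (mul_pow_mul_exp_le hκ (2 * d) hbig (by linarith))
  have hN0 : 0 ≤ N := by linarith
  have h1 : (m : ℝ) ^ d * (d * (k + 1) ^ d * Real.exp (-k)) ≤
      d * 2 ^ d * Real.exp 1 * N ^ (2 * d) * Real.exp (-(2 * κ * N)) := by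
    calc _ ≤ N ^ d * (d * (2 * N) ^ d * Real.exp (1 + -(2 * κ * N))) := by
          gcongr; linarith
      _ = _ := by rw [Real.exp_add]; ring
  have h2 : m * N * (2 * Real.exp (-(2 * N) ^ 2 / 2)) ≤
      2 * N ^ (2 * d) * Real.exp (-(2 * κ * N)) := by
    have h3 : N * N ≤ N ^ (2 * d) := by
      rw [← sq]; exact pow_le_pow_right₀ hN (by omega)
    have h4 : -(2 * N) ^ 2 / 2 ≤ -(2 * κ * N) := by nlinarith
    calc _ ≤ N * N * (2 * Real.exp (-(2 * κ * N))) := by gcongr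
      _ ≤ N ^ (2 * d) * (2 * Real.exp (-(2 * κ * N))) := by gcongr
      _ = _ := by ring
  linarith

theorem le_two_mul_mul_div {d n : ℕ} (hd : 0 < d) (h : d ≤ n) : n ≤ 2 * d * (n / d) := by
  have h1 : 1 ≤ n / d := (Nat.one_le_div_iff hd).2 h
  have h2 := Nat.lt_mul_div_succ n hd
  nlinarith

/-- The numbers of blocks and of conditions. -/
theorem block_dimension {d n m : ℕ} (hd : 2 ≤ d) (hm : 1 ≤ m)
    (h : d ^ (d + 1) * 2 ^ (d + 1) * m ≤ n) :
    1 + d * (n / (2 * d) * n ^ (d - 1)) + d * d ^ d * (m * (n + m) ^ (d - 1)) ≤ n ^ d := by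
  obtain ⟨d, rfl⟩ : ∃ e, d = e + 1 := ⟨d - 1, by omega⟩
  simp only [Nat.add_sub_cancel]
  have hp : 1 ≤ (d + 1) ^ (d + 1 + 1) := Nat.one_le_pow _ _ (by omega)
  have h4 : 4 ≤ 2 ^ (d + 1 + 1) := by
    calc 4 = 2 ^ 2 := rfl
      _ ≤ _ := Nat.pow_le_pow_right (by omega) (by omega)
  have hmn : 4 * m ≤ n := by
    refine le_trans (Nat.mul_le_mul_right _ ?_) h
    nlinarith
  have h1 : 2 * (d + 1) * (n / (2 * (d + 1))) ≤ n := Nat.mul_div_le _ _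
  have h2 : (n + m) ^ d ≤ 2 ^ d * n ^ d := by
    rw [← mul_pow]; exact Nat.pow_le_pow_left (by omega) _
  have hnd : 1 ≤ n ^ d := Nat.one_le_pow _ _ (by omega)
  -- The budget n^d is shared out: one half to the echelon tree, one quarter to the annihilator
  -- conditions, one quarter to the summand 1.
  have e1 : 4 * ((d + 1) * (n / (2 * (d + 1)) * n ^ d)) ≤ 2 * (n * n ^ d) := by nlinarith
  have e2 : 4 * ((d + 1) * (d + 1) ^ (d + 1) * (m * (n + m) ^ d)) ≤ n * n ^ d := by
    calc _ ≤ 4 * ((d + 1) * (d + 1) ^ (d + 1) * (m * (2 ^ d * n ^ d))) := by gcongr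
      _ = (d + 1) ^ (d + 1 + 1) * 2 ^ (d + 1 + 1) * m * n ^ d := by ring
      _ ≤ _ := by gcongr
  have e3 : 4 ≤ n * n ^ d := by nlinarith
  rw [pow_succ n d, mul_comm (n ^ d) n]
  omega


/-! ### Assembly of the theorem -/

theorem IsRobustlyEntangled.mono {n₁ n₂ r : ℕ} {ε ε' : ℝ} {U : Submodule ℝ (MatSpace n₁ n₂)}
    (h : IsRobustlyEntangled r ε U) (hε : ε' ≤ ε) : IsRobustlyEntangled r ε' U :=
  fun v hv hv1 u hu => hε.trans (h v hv hv1 u hu)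

theorem Outputs.unique {P : RealRAM.Program} {n₁ n₂ r m : ℕ} {b : Fin m → MatSpace n₁ n₂}
    {o o' : Option ℝ} {t t' : ℕ} (h : Outputs P r b o t) (h' : Outputs P r b o' t') : o = o' := by
  obtain ⟨s, hs, rfl⟩ := h
  obtain ⟨s', hs', rfl⟩ := h'
  rw [(hs.det hs').1]

theorem Submodule.exists_orthonormal_span_eq {m : ℕ} {E : Type*} [NormedAddCommGroup E]
    [InnerProductSpace ℝ E] [FiniteDimensional ℝ E] {U : Submodule ℝ E}
    (hU : Module.finrank ℝ U = m) :
    ∃ b : Fin m → E, Orthonormal ℝ b ∧ Submodule.span ℝ (Set.range b) = U := by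
  subst hU
  refine ⟨fun i => stdOrthonormalBasis ℝ U i,
    (stdOrthonormalBasis ℝ U).orthonormal.comp_linearIsometry U.subtypeₗᵢ, ?_⟩
  have h : Set.range (fun i => (stdOrthonormalBasis ℝ U i : E)) =
      U.subtype '' Set.range (stdOrthonormalBasis ℝ U) := by
    rw [← Set.range_comp]; rfl
  rw [h, Submodule.span_image, ← OrthonormalBasis.coe_toBasis, Module.Basis.span_eq,
    Submodule.map_top, Submodule.range_subtype]

theorem certifier_time {n₁ n₂ r k : ℕ} (hr1 : 1 ≤ r) (hr : r + 1 ≤ min n₁ n₂)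
    (hk : ∀ B, RealRAM.certifierCost B ≤ (B + 2) ^ k) {ρ : ℝ} (hρ : 0 < ρ) :
    (RealRAM.certifierCost ((n₁ * n₂) ^ (3 * (r + 1))) : ℝ) ≤
      (((n₁ : ℝ) * n₂) / min ρ 1) ^ ((7 * k + 1) * r : ℝ) := by
  obtain ⟨h₁, h₂⟩ := le_min_iff.1 hr
  have hN : 4 ≤ n₁ * n₂ := by nlinarith
  have hNR : ((n₁ * n₂ : ℕ) : ℝ) = (n₁ : ℝ) * n₂ := by push_cast; rfl
  rw [← hNR]
  generalize n₁ * n₂ = N at hN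
  -- One more factor N ≥ 4 absorbs the summand 2, and 3(r + 1) + 1 ≤ 7r because r ≥ 1.
  have h1 : RealRAM.certifierCost (N ^ (3 * (r + 1))) ≤ N ^ (7 * k * r) := by
    refine (hk _).trans ?_
    calc _ ≤ (N ^ (7 * r)) ^ k := by
          refine Nat.pow_le_pow_left ?_ k
          have : 1 ≤ N ^ (3 * (r + 1)) := Nat.one_le_pow _ _ (by omega)
          calc _ ≤ N ^ (3 * (r + 1)) * N := by nlinarith
            _ = N ^ (3 * (r + 1) + 1) := (pow_succ _ _).symm
            _ ≤ _ := Nat.pow_le_pow_right (by omega) (by omega)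
      _ = _ := by rw [← pow_mul]; congr 1; ring
  have hN1 : (1 : ℝ) ≤ N := by exact_mod_cast (by omega : 1 ≤ N)
  have hq : 0 < min ρ 1 := lt_min hρ one_pos
  have hle : (N : ℝ) ≤ N / min ρ 1 := le_div_self (by linarith) hq (min_le_right _ _)
  calc (RealRAM.certifierCost (N ^ (3 * (r + 1))) : ℝ) ≤ ((N ^ (7 * k * r) : ℕ) : ℝ) := by
        exact_mod_cast h1
    _ = (N : ℝ) ^ ((7 * k * r : ℕ) : ℝ) := by rw [Real.rpow_natCast]; push_cast; rfl
    _ ≤ (N : ℝ) ^ ((7 * k + 1) * r : ℝ) := by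
        refine Real.rpow_le_rpow_of_exponent_le hN1 ?_
        push_cast
        have : (0 : ℝ) ≤ r := Nat.cast_nonneg r
        nlinarith
    _ ≤ _ := Real.rpow_le_rpow (by linarith) hle (by positivity)

theorem exceptional_eq_empty {n₁ n₂ d : ℕ} (hd : 0 < d) (ρ : ℝ) (u : Fin 0 → MatSpace n₁ n₂) :
    exceptional d ρ u = ∅ := by
  ext z
  simp only [exceptional, Set.mem_union, Set.mem_iUnion, Set.mem_ofPred_eq,
    Set.mem_empty_iff_false, iff_false, not_or, not_exists]
  exact ⟨fun I => (I ⟨0, hd⟩).elim0, fun i => i.1.elim0⟩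

/-- No lower bound on N is assumed: m ≥ 1 together with the smallness of m/N forces N to exceed
every threshold, and for m = 0 the exceptional event is empty. The value of κ comes from k = n/(2d)
and N ≤ 4d²n, which give N ≤ 8d³(k + 1); half of that rate absorbs the polynomial factors. -/
theorem gaussianNoise_exceptional_le {n₁ n₂ m d : ℕ} (hd : 2 ≤ d) (h₁ : d ≤ n₁) (h₂ : d ≤ n₂)
    {ρ κ : ℝ} (hρ : 0 < ρ) (hκ : κ = 1 / (16 * d ^ 3))
    (hm : (m : ℝ) * (d ^ (d + 3) * 2 ^ (d + 3) +
      (d * 2 ^ d * Real.exp 1 + 2) * (2 * d + 1).factorial / κ ^ (2 * d + 1)) ≤ n₁ * n₂)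
    (u : Fin m → MatSpace n₁ n₂) :
    gaussianNoise m n₁ n₂ ρ (exceptional d ρ u) ≤
      ENNReal.ofReal (Real.exp (-(κ * (n₁ * n₂)))) := by
  rcases Nat.eq_zero_or_pos m with rfl | hm0
  · rw [exceptional_eq_empty (by omega)]; simp
  have hdR : (0 : ℝ) < d := by exact_mod_cast (by omega : 0 < d)
  have hκ0 : 0 < κ := by rw [hκ]; positivity
  have hX : 0 ≤ (d * 2 ^ d * Real.exp 1 + 2) * (2 * d + 1).factorial / κ ^ (2 * d + 1) := by
    positivity
  have hY : (0 : ℝ) ≤ (d : ℝ) ^ (d + 3) * 2 ^ (d + 3) := by positivity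
  have hm1 : (1 : ℝ) ≤ m := by exact_mod_cast hm0
  set X := (d * 2 ^ d * Real.exp 1 + 2) * (2 * d + 1).factorial / κ ^ (2 * d + 1) with hXdef
  have hXN : X ≤ n₁ * n₂ := by nlinarith
  have hYN : d ^ (d + 3) * 2 ^ (d + 3) * m ≤ n₁ * n₂ := by
    have : (d : ℝ) ^ (d + 3) * 2 ^ (d + 3) * m ≤ n₁ * n₂ := by nlinarith
    exact_mod_cast this
  have g₁ := le_two_mul_mul_div (by omega) h₁
  have g₂ := le_two_mul_mul_div (by omega) h₂
  have hn1 : 1 ≤ n₁ / d * (n₂ / d) := Nat.mul_le_mul ((Nat.one_le_div_iff (by omega)).2 h₁)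
    ((Nat.one_le_div_iff (by omega)).2 h₂)
  set n := n₁ / d * (n₂ / d) with hn
  have hNn : n₁ * n₂ ≤ 4 * d ^ 2 * n :=
    (Nat.mul_le_mul g₁ g₂).trans_eq (by rw [hn]; ring)
  have hnN : n ≤ n₁ * n₂ := Nat.mul_le_mul (Nat.div_le_self _ _) (Nat.div_le_self _ _)
  have hmn : d ^ (d + 1) * 2 ^ (d + 1) * m ≤ n := by
    have : 4 * d ^ 2 * (d ^ (d + 1) * 2 ^ (d + 1) * m) ≤ 4 * d ^ 2 * n :=
      le_trans (le_of_eq (by ring)) (hYN.trans hNn)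
    exact Nat.le_of_mul_le_mul_left this (by positivity)
  have hmn' : m ≤ n := by
    refine le_trans (Nat.le_mul_of_pos_left _ ?_) hmn
    have : 0 < d := by omega
    positivity
  refine (measure_exceptional_le (k := n / (2 * d)) hρ u hn1 (block_dimension hd hm0 hmn)).trans
    (ENNReal.ofReal_le_ofReal ?_)
  have hNR : ((n₁ * n₂ : ℕ) : ℝ) = (n₁ : ℝ) * n₂ := by push_cast; rfl
  rw [← hNR] at hXN ⊢
  have hN1 : 1 ≤ n₁ * n₂ := hn1.trans hnN
  refine failure_probability_le (by omega) hκ0 (by exact_mod_cast hN1)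
    (by exact_mod_cast hmn'.trans hnN) ?_ ?_ hXN
  · have : n / (2 * d) ≤ n := Nat.div_le_self _ _
    exact_mod_cast (by omega : n / (2 * d) + 1 ≤ 2 * (n₁ * n₂))
  · have h1 : n < 2 * d * (n / (2 * d) + 1) := Nat.lt_mul_div_succ n (by omega)
    have h2 : n₁ * n₂ ≤ 8 * d ^ 3 * (n / (2 * d) + 1) := by
      calc n₁ * n₂ ≤ 4 * d ^ 2 * n := hNn
        _ ≤ 4 * d ^ 2 * (2 * d * (n / (2 * d) + 1)) := Nat.mul_le_mul_left _ h1.le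
        _ = _ := by ring
    have h3 : ((n₁ * n₂ : ℕ) : ℝ) ≤ 8 * (d : ℝ) ^ 3 * (((n / (2 * d) : ℕ) : ℝ) + 1) := by
      exact_mod_cast h2
    rw [hκ]
    calc 2 * (1 / (16 * (d : ℝ) ^ 3)) * ((n₁ * n₂ : ℕ) : ℝ) = ((n₁ * n₂ : ℕ) : ℝ) / (8 * (d : ℝ) ^ 3) := by
          field_simp; norm_num
      _ ≤ _ := by rw [div_le_iff₀ (by positivity)]; linarith

/-- A single program `P` certifies robust `r`-entanglement of smoothed subspaces.  The sizes
`n₁, n₂, r, m` and an orthonormal basis of the subspace are its only input; in particular it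
is not given `ρ`.

First clause (every orthonormal input): `P` halts within `(n₁ n₂ / min(ρ,1)) ^ (C r)` steps, and
an output `η` is always correct.  Second clause (smoothed input): outside an event of (outer)
probability at most `exp (-κ n₁ n₂)`, the perturbed subspace has dimension `m`, is
`c' min(ρ,1)^(r+1) / (n₁ n₂)^(c r)`-robustly `r`-entangled, and `P` certifies at least this much,
whichever orthonormal basis of it is given. -/
theorem corollary7p2 :
    ∃ (P : RealRAM.Program) (c C : ℝ), 0 < c ∧ 0 < C ∧
    ∀ r : ℕ, 1 ≤ r →
    ∃ c_r c'_r κ_r : ℝ, 0 < c_r ∧ 0 < c'_r ∧ 0 < κ_r ∧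
    ∀ n₁ n₂ : ℕ, r < min n₁ n₂ →
    ∀ ρ : ℝ, 0 < ρ →
    ∀ m : ℕ,
      (∀ b : Fin m → MatSpace n₁ n₂, Orthonormal ℝ b →
        (∃ (o : Option ℝ) (t : ℕ), Outputs P r b o t ∧
          (t : ℝ) ≤ (((n₁ : ℝ) * n₂) / min ρ 1) ^ (C * r)) ∧
        (∀ (η : ℝ) (t : ℕ), Outputs P r b (some η) t →
          0 < η ∧ IsRobustlyEntangled r η (Submodule.span ℝ (Set.range b)))) ∧
      ((m : ℝ) ≤ c_r * (n₁ * n₂) →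
        ∀ u : Fin m → MatSpace n₁ n₂, (∀ i, ‖u i‖ ≤ 1) →
        gaussianNoise m n₁ n₂ ρ
          {z | ¬ (Module.finrank ℝ (perturbedSpan u z) = m ∧
            IsRobustlyEntangled r
              (c'_r * min ρ 1 ^ (r + 1) / ((n₁ : ℝ) * n₂) ^ (c * r)) (perturbedSpan u z) ∧
            ∀ b : Fin m → MatSpace n₁ n₂, Orthonormal ℝ b →
              Submodule.span ℝ (Set.range b) = perturbedSpan u z →
              ∃ (η : ℝ) (t : ℕ), Outputs P r b (some η) t ∧
                c'_r * min ρ 1 ^ (r + 1) / ((n₁ : ℝ) * n₂) ^ (c * r) ≤ η)}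
          ≤ ENNReal.ofReal (Real.exp (-κ_r * (n₁ * n₂)))) := by
  obtain ⟨k, hk⟩ := RealRAM.polyBdd_certifierCost
  -- The exponent 16 r dominates 8(r + 1) since r ≥ 1, and the added 1 keeps C positive even if k =
  -- 0.
  refine ⟨RealRAM.certifier, 16, 7 * k + 1, by norm_num, by positivity, fun r hr1 => ?_⟩
  obtain ⟨d, hd⟩ : ∃ d, d = r + 1 := ⟨_, rfl⟩
  have hdR : (1 : ℝ) ≤ d := by exact_mod_cast (by omega : 1 ≤ d)
  obtain ⟨κ, hκ⟩ : ∃ κ : ℝ, κ = 1 / (16 * d ^ 3) := ⟨_, rfl⟩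
  have hκ0 : 0 < κ := by rw [hκ]; positivity
  set X : ℝ := d ^ (d + 3) * 2 ^ (d + 3) +
      (d * 2 ^ d * Real.exp 1 + 2) * (2 * d + 1).factorial / κ ^ (2 * d + 1) with hX
  have hX1 : 1 ≤ X := by
    have h1 : (1 : ℝ) ≤ d ^ (d + 3) * 2 ^ (d + 3) :=
      one_le_mul_of_one_le_of_one_le (one_le_pow₀ hdR) (one_le_pow₀ (by norm_num))
    have h2 : 0 ≤ (d * 2 ^ d * Real.exp 1 + 2) * (2 * d + 1).factorial / κ ^ (2 * d + 1) := by
      positivity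
    linarith
  refine ⟨1 / X, 1 / (3 * 9 ^ (r + 1)), κ, by positivity, by positivity, hκ0,
    fun n₁ n₂ hr ρ hρ m => ⟨fun b hb => ?_, fun hm u hu => ?_⟩⟩
  · obtain ⟨t, ht, hout⟩ := exists_outputs hr hr1 hb
    refine ⟨⟨_, t, hout, ?_⟩, fun η t' hη => certifierOutput_sound hr hr1 hb (hout.unique hη)⟩
    exact (Nat.cast_le.2 ht).trans (certifier_time hr1 hr hk hρ)
  obtain ⟨h₁, h₂⟩ := le_min_iff.1 (Nat.succ_le_of_lt hr)
  have hNpos : (1 : ℝ) ≤ n₁ * n₂ := by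
    exact_mod_cast Nat.mul_pos (by omega : 0 < n₁) (by omega : 0 < n₂)
  have hmX : (m : ℝ) * X ≤ n₁ * n₂ := by
    rwa [one_div, inv_mul_eq_div, le_div_iff₀ (by linarith)] at hm
  have hmN : m ≤ n₁ * n₂ := by
    have : (m : ℝ) ≤ n₁ * n₂ := le_trans (le_mul_of_one_le_right (Nat.cast_nonneg m) hX1) hmX
    exact_mod_cast this
  have hηle : 1 / (3 * 9 ^ (r + 1)) * min ρ 1 ^ (r + 1) / ((n₁ : ℝ) * n₂) ^ (16 * r : ℝ) ≤
      min ρ 1 ^ (r + 1) / (3 * 9 ^ (r + 1)) / ((n₁ : ℝ) * n₂) ^ (8 * (r + 1)) := by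
    have hq : 0 ≤ min ρ 1 := (lt_min hρ one_pos).le
    have e : ((n₁ : ℝ) * n₂) ^ (8 * (r + 1)) ≤ ((n₁ : ℝ) * n₂) ^ (16 * r : ℝ) := by
      rw [show (16 * r : ℝ) = ((16 * r : ℕ) : ℝ) by push_cast; rfl, Real.rpow_natCast]
      exact pow_le_pow_right₀ hNpos (by omega)
    rw [one_div_mul_eq_div]
    gcongr
  refine (measure_mono fun z hz => ?_).trans ((gaussianNoise_exceptional_le (d := r + 1)
    (by omega) h₁ h₂ hρ (hd ▸ hκ) (hd ▸ hmX) u).trans_eq (by rw [neg_mul]))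
  by_contra hexc
  refine hz ?_
  obtain ⟨hfin, hcert⟩ := certify_of_notMem_exceptional hr hρ hmN hu hexc
  refine ⟨hfin, ?_, fun b hb hspan => ?_⟩
  -- Robust entanglement is not proved separately: it is read off from the soundness of the
  -- certificate on some orthonormal basis.
  · obtain ⟨b, hb, hspan⟩ := Submodule.exists_orthonormal_span_eq hfin
    obtain ⟨η, h1, h2⟩ := hcert b hb hspan
    rw [← hspan]
    exact (certifierOutput_sound hr hr1 hb h1).2.mono (hηle.trans h2)
  · obtain ⟨η, h1, h2⟩ := hcert b hb hspan
    obtain ⟨t, -, hout⟩ := exists_outputs hr hr1 hb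
    exact ⟨η, t, h1 ▸ hout, hηle.trans h2⟩
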